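/- Let $\mathcal K=(K,\prec_{\mathcal K})$ be an abstract elementary class, let $\mu\ge \mathrm{LS}(\mathcal K)$ be a cardinal, let $\mathcal K_\mu$ be the class of models of cardinality $\mu$, and let $\delta<\mu^+$ be a limit ordinal. Models are in $\mathcal K_\mu$; Galois types $\mathrm{tp}(a/M)\in\operatorname{ga-S}(M)$ of elements over $M\in\mathcal K_\mu$ are computed in strong extensions in $\mathcal K_\mu$. Definitions. $M'$ is *universal over* $M$ if $M\prec_{\mathcal K}M'$ and every strong extension of $M$ in $\mathcal K_\mu$ embeds into $M'$ over $M$ by a $\mathcal K$-embedding. For a limit ordinal $\theta<\mu^+$, $M$ is a *$(\mu,\theta)$-limit model over $N$*, witnessed by $\langle M_i\mid i<\theta\rangle$, if this is a $\prec_{\mathcal K}$-increasing continuous sequence in $\mathcal K_\mu$ with $M_0=N$, $M=\bigcup_{i<\theta}M_i$, and $M_{i+1}$ universal over $M_i$ for all $i<\theta$; it is a *limit model (over $N$)* if this holds for some $\theta$ (and, when $N$ is not specified, some $N$). A type $p\in\operatorname{ga-S}(M)$ *$\mu$-splits over* $N\prec_{\mathcal K}M$ if there are $N_1,N_2\in\mathcal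 K_\mu$ with $N\prec_{\mathcal K}N_1,N_2\prec_{\mathcal K}M$ and an isomorphism $h:N_1\to N_2$ fixing $N$ pointwise such that $h(p\restriction N_1)\ne p\restriction N_2$. For $\alpha<\mu^+$, a *tower* $(\bar M,\bar a,\bar N)\in\mathcal K^*_{\mu,\alpha}$ consists of a $\prec_{\mathcal K}$-increasing (not necessarily continuous) sequence $\langle M_i\mid i<\alpha\rangle$ of limit models in $\mathcal K_\mu$, and, for $i+1<\alpha$, elements $a_i\in M_{i+1}\setminus M_i$ and models $N_i\in\mathcal K_\mu$ such that $M_i$ is universal over $N_i$ and $\mathrm{tp}(a_i/M_i)$ does not $\mu$-split over $N_i$. Write $(\bar M,\bar a,\bar N)\le(\bar M',\bar a,\bar N)$ if for all $i<\alpha$, $M_i\prec_{\mathcal K}M_i'$, and $M_i'$ is universal over $M_i$ whenever $M_i'\ne M_i$. The tower $(\bar M,\bar a,\bar N)$ is *reduced* if for every tower $(\bar M',\bar a,\bar N)\in\mathcal K^*_{\mu,\alpha}$ with $(\bar M,\bar a,\bar N)\le(\bar M',\bar a,\bar N)$ and every $i<\alpha$, $M_i'\cap\bigcup_{j<\alpha}M_j=M_i$;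 it is *continuous at* a limit ordinal $\beta<\alpha$ if $M_\beta=\bigcup_{i<\beta}M_i$. Proposition. Assume: (1) $\mathcal K_\mu$ has the joint embedding and amalgamation properties and no maximal model; (2) $\mathcal K$ is stable in $\mu$, i.e. $|\operatorname{ga-S}(M)|\le\mu$ for every $M\in\mathcal K_\mu$; (3) (limit continuity of non-$\mu$-splitting) if $M$ is a limit model witnessed by $\langle M_i\mid i<\theta\rangle$ for some limit ordinal $\theta<\mu^+$, $p\in\operatorname{ga-S}(M)$, and $N\prec_{\mathcal K}M_0$ in $\mathcal K_\mu$ is such that $p\restriction M_i$ does not $\mu$-split over $N$ for all $i<\theta$, then $p$ does not $\mu$-split over $N$. Suppose further that for every $\alpha<\mu^+$, every reduced tower in $\mathcal K^*_{\mu,\alpha}$ is continuous at every limit ordinal $\beta<\alpha$ with $\operatorname{cf}(\beta)=\operatorname{cf}(\delta)$. Then $\mathcal K$ satisfies $(\mu,\delta)$-symmetry for non-$\mu$-splitting: whenever $M,M_0,N\in\mathcal K_\mu$ and elements $a,b$ (all inside a common model in $\mathcal K_\mu$ of which $M$ is a strong submodel) are such that $M$ is universal over $M_0$, $M_0$ is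 a $(\mu,\delta)$-limit model over $N$, $a\in M\setminus M_0$, $\mathrm{tp}(a/M_0)$ is non-algebraic and does not $\mu$-split over $N$, and $\mathrm{tp}(b/M)$ is non-algebraic and does not $\mu$-split over $M_0$, then, in some strong extension in $\mathcal K_\mu$ of the common model, there is a limit model $M^b$ over $M_0$ containing $b$ such that $\mathrm{tp}(a/M^b)$ does not $\mu$-split over $N$. -/

import Mathlib

open FirstOrder FirstOrder.Language Cardinal

universe u

/-- For substructures `S ≤ T` of `V`, the substructure `S` regarded as a substructure of the
structure `T`. -/
def FirstOrder.Language.Substructure.within {L : FirstOrder.Language.{u, u}} {V : Type u} [L.Structure V]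
    (S T : L.Substructure V) : L.Substructure T :=
  S.comap T.subtype.toHom

/-- An abstract elementary class in the language `L`: a class `Mem` of `L`-structures together with
a strong-substructure relation; `Strong N S` says that the substructure `S` of `N` satisfies
`S ≺_K N`. A configuration of several models is always given by substructures of one
`L`-structure `V`, which need not belong to the class. -/
structure AEC (L : FirstOrder.Language.{u, u}) where
  Mem : ∀ (M : Type u) [L.Structure M], Prop
  Strong : ∀ (N : Type u) [L.Structure N], L.Substructure N → Prop
  /-- closure under isomorphism -/
  mem_of_equiv : ∀ (M N : Type u) [L.Structure M] [L.Structure N], (M ≃[L] N) → Mem M → Mem N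
  strong_of_equiv : ∀ (M N : Type u) [L.Structure M] [L.Structure N] (e : M ≃[L] N)
    (S : L.Substructure M), Strong M S → Strong N (S.map e.toHom)
  /-- `≺_K` is a partial order on the class, refining the substructure relation -/
  mem_of_strong : ∀ (N : Type u) [L.Structure N] (S : L.Substructure N),
    Strong N S → Mem S ∧ Mem N
  refl : ∀ (N : Type u) [L.Structure N], Mem N → Strong N ⊤
  trans : ∀ (N : Type u) [L.Structure N] (S T : L.Substructure N), S ≤ T →
    Strong T (S.within T) → Strong N T → Strong N S
  /-- coherence -/
  coherence : ∀ (N : Type u) [L.Structure N] (S T : L.Substructure N), S ≤ T →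
    Strong N S → Strong N T → Strong T (S.within T)
  /-- Tarski–Vaught chain axioms: the union `U` of a continuous `≺_K`-increasing chain `S i`,
  `i < δ`, belongs to the class, is a strong extension of each `S i`, and is a strong substructure
  of every `N` of which all the `S i` are strong substructures -/
  chain : ∀ (V : Type u) [L.Structure V] (δ : Ordinal.{u}) (S : Ordinal.{u} → L.Substructure V)
    (U : L.Substructure V), Order.IsSuccLimit δ →
    (∀ i < δ, Mem (S i)) →
    (∀ i j, i ≤ j → j < δ → S i ≤ S j ∧ Strong (S j) ((S i).within (S j))) →
    (∀ i < δ, Order.IsSuccLimit i → (S i : Set V) = ⋃ j ∈ Set.Iio i, (S j : Set V)) →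
    (U : Set V) = ⋃ i ∈ Set.Iio δ, (S i : Set V) →
    Mem U ∧ (∀ i < δ, Strong U ((S i).within U)) ∧ ((∀ i < δ, Strong V (S i)) → Strong V U)
  /-- Löwenheim–Skolem–Tarski axiom -/
  exists_LS : ∃ κ : Cardinal.{u}, ℵ₀ ≤ κ ∧ L.card ≤ κ ∧
    ∀ (N : Type u) [L.Structure N], Mem N → ∀ A : Set N,
      ∃ S : L.Substructure N, Strong N S ∧ A ⊆ S ∧ #S ≤ #A + κ

namespace AEC

variable {L : FirstOrder.Language.{u, u}} (K : AEC L)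

/-- The Löwenheim–Skolem number `LS(K)`. -/
noncomputable def LS : Cardinal.{u} :=
  sInf {κ : Cardinal.{u} | ℵ₀ ≤ κ ∧ L.card ≤ κ ∧
    ∀ (N : Type u) [L.Structure N], K.Mem N → ∀ A : Set N,
      ∃ S : L.Substructure N, K.Strong N S ∧ A ⊆ S ∧ #S ≤ #A + κ}

/-- `M ∈ K_μ`. -/
def InK (μ : Cardinal.{u}) (M : Type u) [L.Structure M] : Prop :=
  K.Mem M ∧ #M = μ

/-- `S ≺_K T`, for two substructures of one structure. -/
def Le {V : Type u} [L.Structure V] (S T : L.Substructure V) : Prop :=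
  S ≤ T ∧ K.Strong T (S.within T)

/-- `f : M → N` is a `K`-embedding: an isomorphism from `M` onto a strong substructure of `N`. -/
def IsEmb {M N : Type u} [L.Structure M] [L.Structure N] (f : M ↪[L] N) : Prop :=
  K.Strong N f.toHom.range

variable {K}

theorem isEmb_equiv {M N : Type u} [L.Structure M] [L.Structure N] (e : M ≃[L] N)
    (hN : K.Mem N) : K.IsEmb e.toEmbedding := by
  have h : e.toEmbedding.toHom.range = ⊤ := by
    ext x
    simp only [Hom.mem_range, Substructure.mem_top, iff_true]
    exact ⟨e.symm x, e.apply_symm_apply x⟩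
  unfold IsEmb
  rw [h]
  exact K.refl N hN

theorem isEmb_subtype {N : Type u} [L.Structure N] {S : L.Substructure N} (h : K.Strong N S) :
    K.IsEmb S.subtype := by
  unfold IsEmb
  rwa [Substructure.range_subtype]

theorem isEmb_inclusion {V : Type u} [L.Structure V] {S T : L.Substructure V} (h : K.Le S T) :
    K.IsEmb (Substructure.inclusion h.1) := by
  have h' : (Substructure.inclusion h.1).toHom.range = S.within T := by
    ext x
    simp only [Hom.mem_range, Substructure.within, Substructure.mem_comap]
    constructor
    · rintro ⟨y, rfl⟩
      exact y.2
    · intro hx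
      exact ⟨⟨x, hx⟩, rfl⟩
  unfold IsEmb
  rw [h']
  exact h.2

theorem IsEmb.comp {M N P : Type u} [L.Structure M] [L.Structure N] [L.Structure P]
    {g : N ↪[L] P} {f : M ↪[L] N} (hg : K.IsEmb g) (hf : K.IsEmb f) : K.IsEmb (g.comp f) := by
  refine K.trans P _ g.toHom.range ?_ ?_ hg
  · rintro x ⟨y, rfl⟩
    exact ⟨f y, rfl⟩
  · have h := K.strong_of_equiv N _ g.equivRange _ hf
    convert h using 1
    ext x
    simp only [Substructure.within, Substructure.mem_comap, Substructure.mem_map, Hom.mem_range]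
    constructor
    · rintro ⟨y, hy⟩
      exact ⟨f y, ⟨y, rfl⟩, Subtype.ext hy⟩
    · rintro ⟨_, ⟨y, rfl⟩, hy⟩
      exact ⟨y, congrArg Subtype.val hy⟩

variable (K)

/-! ### Galois types over models of cardinality `μ` -/

/-- A triple `(M, N, a)`: a `K`-embedding of `M` into some `N ∈ K_μ`, and an element `a ∈ N`. -/
structure PreType (μ : Cardinal.{u}) (M : Type u) [L.Structure M] where
  carrier : Type u
  [str : L.Structure carrier]
  inK : K.InK μ carrier
  emb : M ↪[L] carrier
  isEmb : K.IsEmb emb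
  elt : carrier

attribute [instance] PreType.str

variable {K}

/-- Two triples are related if there is an amalgam over `M` in `K_μ` identifying the elements. -/
def PreType.Rel {μ : Cardinal.{u}} {M : Type u} [L.Structure M] (p q : K.PreType μ M) : Prop :=
  ∃ (P : Type u) (_ : L.Structure P) (f : p.carrier ↪[L] P) (g : q.carrier ↪[L] P),
    K.InK μ P ∧ K.IsEmb f ∧ K.IsEmb g ∧ (∀ x : M, f (p.emb x) = g (q.emb x)) ∧ f p.elt = g q.elt

variable (K)

/-- `ga-S(M)`, for `M ∈ K_μ`: triples modulo the equivalence relation generated by `PreType.Rel`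
(which is itself an equivalence relation when `K_μ` has amalgamation). -/
def GaS (μ : Cardinal.{u}) (M : Type u) [L.Structure M] : Type (u + 1) :=
  Quot (PreType.Rel (K := K) (μ := μ) (M := M))

variable {K}

/-- Precomposition with a `K`-embedding `f : A → B`, as an operation `ga-S(B) → ga-S(A)`. -/
def GaS.pull {μ : Cardinal.{u}} {A B : Type u} [L.Structure A] [L.Structure B]
    (f : A ↪[L] B) (hf : K.IsEmb f) (p : K.GaS μ B) : K.GaS μ A :=
  Quot.map
    (fun t : K.PreType μ B =>
      ({ carrier := t.carrier, inK := t.inK, emb := t.emb.comp f, isEmb := t.isEmb.comp hf,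
         elt := t.elt } : K.PreType μ A))
    (fun _ _ ⟨P, i, g, h, hP, hg, hh, he, ha⟩ =>
      ⟨P, i, g, h, hP, hg, hh, fun x => he (f x), ha⟩) p

/-- The restriction `p ↾ S` of `p ∈ ga-S(T)`, where `S ≺_K T`. -/
def GaS.res {μ : Cardinal.{u}} {V : Type u} [L.Structure V] {S T : L.Substructure V}
    (h : K.Le S T) (p : K.GaS μ T) : K.GaS μ S :=
  p.pull (Substructure.inclusion h.1) (isEmb_inclusion h)

/-- The image `h(p) ∈ ga-S(B)` of `p ∈ ga-S(A)` under an isomorphism `h : A ≅ B`. -/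
def GaS.image {μ : Cardinal.{u}} {A B : Type u} [L.Structure A] [L.Structure B]
    (hA : K.Mem A) (h : A ≃[L] B) (p : K.GaS μ A) : K.GaS μ B :=
  p.pull h.symm.toEmbedding (isEmb_equiv h.symm hA)

/-- `tp(a/M; U)`, where `M ≺_K U ∈ K_μ` and `a ∈ U`. -/
def tp {μ : Cardinal.{u}} {U : Type u} [L.Structure U] (hU : K.InK μ U) {M : L.Substructure U}
    (hM : K.Strong U M) (a : U) : K.GaS μ M :=
  Quot.mk _ { carrier := U, inK := hU, emb := M.subtype, isEmb := isEmb_subtype hM, elt := a }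

/-- A type over `M` is algebraic if it is realized by an element of `M`. -/
def GaS.IsAlgebraic {μ : Cardinal.{u}} {M : Type u} [L.Structure M] (p : K.GaS μ M) : Prop :=
  ∃ t : K.PreType μ M, Quot.mk _ t = p ∧ t.elt ∈ Set.range t.emb

/-- `p ∈ ga-S(M)` `μ`-splits over `N ≺_K M`: there are `N₁, N₂ ∈ K_μ` with `N ≺_K N₁, N₂ ≺_K M`
and an isomorphism `h : N₁ ≅ N₂` over `N` such that `h(p ↾ N₁) ≠ p ↾ N₂`. -/
def GaS.Splits {μ : Cardinal.{u}} {V : Type u} [L.Structure V] {M : L.Substructure V}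
    (p : K.GaS μ M) (N : L.Substructure V) : Prop :=
  ∃ (N₁ N₂ : L.Substructure V) (h₁ : K.Le N₁ M) (h₂ : K.Le N₂ M) (m₁ : K.InK μ N₁)
    (_ : K.InK μ N₂) (h : N₁ ≃[L] N₂),
    K.Le N N₁ ∧ K.Le N N₂ ∧ (∀ x : N₁, (x : V) ∈ N → (h x : V) = x) ∧
    (p.res h₁).image m₁.1 h ≠ p.res h₂

variable (K)

/-! ### Joint embedding, amalgamation, no maximal models and stability in `μ` -/

/-- Joint embedding for `K_μ`. -/
def JointEmbedding (μ : Cardinal.{u}) : Prop :=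
  ∀ (M N : Type u) [L.Structure M] [L.Structure N], K.InK μ M → K.InK μ N →
    ∃ (P : Type u) (_ : L.Structure P) (f : M ↪[L] P) (g : N ↪[L] P),
      K.InK μ P ∧ K.IsEmb f ∧ K.IsEmb g

/-- Amalgamation for `K_μ`. -/
def Amalgamation (μ : Cardinal.{u}) : Prop :=
  ∀ (M N₁ N₂ : Type u) [L.Structure M] [L.Structure N₁] [L.Structure N₂]
    (f₁ : M ↪[L] N₁) (f₂ : M ↪[L] N₂), K.InK μ M → K.InK μ N₁ → K.InK μ N₂ →
    K.IsEmb f₁ → K.IsEmb f₂ →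
    ∃ (P : Type u) (_ : L.Structure P) (g₁ : N₁ ↪[L] P) (g₂ : N₂ ↪[L] P),
      K.InK μ P ∧ K.IsEmb g₁ ∧ K.IsEmb g₂ ∧ ∀ x : M, g₁ (f₁ x) = g₂ (f₂ x)

/-- No model of cardinality `μ` is maximal. -/
def NoMaximalModel (μ : Cardinal.{u}) : Prop :=
  ∀ (M : Type u) [L.Structure M], K.InK μ M →
    ∃ (N : Type u) (_ : L.Structure N) (f : M ↪[L] N),
      K.InK μ N ∧ K.IsEmb f ∧ ¬ Function.Surjective f

/-- `K` is (Galois-)stable in `μ`: there are at most `μ` types over each `M ∈ K_μ`. -/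
def Stable (μ : Cardinal.{u}) : Prop :=
  ∀ (M : Type u) [L.Structure M], K.InK μ M → #(K.GaS μ M) ≤ Cardinal.lift.{u + 1, u} μ

/-! ### Universal extensions and limit models -/

/-- `T` is universal over `S`: `S ≺_K T` are in `K_μ`, and every strong extension of `S` in `K_μ`
embeds into `T` over `S`. -/
def UniversalOver (μ : Cardinal.{u}) {V : Type u} [L.Structure V] (T S : L.Substructure V) :
    Prop :=
  K.InK μ S ∧ K.InK μ T ∧ K.Le S T ∧
    ∀ (P : Type u) [L.Structure P] (g : S ↪[L] P), K.InK μ P → K.IsEmb g →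
      ∃ f : P ↪[L] T, K.IsEmb f ∧ ∀ x : S, (f (g x) : V) = x

/-- `M` is a limit model witnessed by `⟨S i | i < θ⟩`: `θ < μ⁺` is a limit ordinal, and `S i` is an
increasing and continuous chain in `K_μ` with union `M` such that `S (i+1)` is universal over
`S i`. -/
structure LimitWitness (μ : Cardinal.{u}) (θ : Ordinal.{u}) {V : Type u} [L.Structure V]
    (M : L.Substructure V) (S : Ordinal.{u} → L.Substructure V) : Prop where
  isLimit : Order.IsSuccLimit θ
  lt_succ : θ < (Order.succ μ).ord
  inK : ∀ i < θ, K.InK μ (S i)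
  mono : ∀ i j, i ≤ j → j < θ → K.Le (S i) (S j)
  cont : ∀ i < θ, Order.IsSuccLimit i → (S i : Set V) = ⋃ j ∈ Set.Iio i, (S j : Set V)
  universal : ∀ i < θ, K.UniversalOver μ (S (i + 1)) (S i)
  union : (M : Set V) = ⋃ i ∈ Set.Iio θ, (S i : Set V)

variable {K} in
theorem LimitWitness.le {μ : Cardinal.{u}} {θ : Ordinal.{u}} {V : Type u} [L.Structure V]
    {M : L.Substructure V} {S : Ordinal.{u} → L.Substructure V} (h : K.LimitWitness μ θ M S)
    {i : Ordinal.{u}} (hi : i < θ) : K.Le (S i) M := by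
  refine ⟨?_, (K.chain V θ S M h.isLimit (fun i hi => (h.inK i hi).1) h.mono h.cont h.union).2.1
    i hi⟩
  intro x hx
  have : x ∈ (M : Set V) := by
    rw [h.union]
    exact Set.mem_biUnion (show i ∈ Set.Iio θ from hi) hx
  exact this

/-- `M` is a `(μ, θ)`-limit model over `N`. -/
def IsLimitOver (μ : Cardinal.{u}) (θ : Ordinal.{u}) {V : Type u} [L.Structure V]
    (M N : L.Substructure V) : Prop :=
  ∃ S : Ordinal.{u} → L.Substructure V, K.LimitWitness μ θ M S ∧ S 0 = N

/-- `M` is a limit model, i.e. a `(μ, θ)`-limit model over some `N` for some `θ`. -/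
def IsLimitModel (μ : Cardinal.{u}) {V : Type u} [L.Structure V] (M : L.Substructure V) : Prop :=
  ∃ (θ : Ordinal.{u}) (N : L.Substructure V), K.IsLimitOver μ θ M N

/-- Limit continuity for non-`μ`-splitting. -/
def ContinuousNonsplitting (μ : Cardinal.{u}) : Prop :=
  ∀ (V : Type u) [L.Structure V] (θ : Ordinal.{u}) (M : L.Substructure V)
    (S : Ordinal.{u} → L.Substructure V) (hS : K.LimitWitness μ θ M S) (p : K.GaS μ M)
    (N : L.Substructure V), K.InK μ N → K.Le N (S 0) →
    (∀ (i : Ordinal.{u}) (hi : i < θ), ¬ (p.res (hS.le hi)).Splits N) → ¬ p.Splits N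

/-! ### Towers -/

/-- A tower `(M̄, ā, N̄) ∈ K*_{μ,α}` inside the model `U ∈ K_μ`. Only the values `M i` for `i < α`
and `a i`, `N i` for `i + 1 < α` are relevant. No continuity is required. -/
structure Tower (μ : Cardinal.{u}) (α : Ordinal.{u}) {U : Type u} [L.Structure U]
    (hU : K.InK μ U) where
  M : Ordinal.{u} → L.Substructure U
  a : Ordinal.{u} → U
  N : Ordinal.{u} → L.Substructure U
  strong : ∀ i < α, K.Strong U (M i)
  mono : ∀ i j, i ≤ j → j < α → K.Le (M i) (M j)
  limit : ∀ i < α, K.IsLimitModel μ (M i)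
  a_mem : ∀ i, i + 1 < α → a i ∈ M (i + 1)
  a_notMem : ∀ i, i + 1 < α → a i ∉ M i
  universal : ∀ i, i + 1 < α → K.UniversalOver μ (M i) (N i)
  nonsplit : ∀ (i : Ordinal.{u}) (_ : i + 1 < α) (hM : K.Strong U (M i)),
    ¬ (tp hU hM (a i)).Splits (N i)

variable {K}

/-- The tower `T'` in `U'` extends (in the order `≤`) the tower `T` in `U`, where `U` is identified
with its image under the `K`-embedding `g : U → U'`. -/
def Tower.Extends {μ : Cardinal.{u}} {α : Ordinal.{u}} {U U' : Type u} [L.Structure U]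
    [L.Structure U'] {hU : K.InK μ U} {hU' : K.InK μ U'} (g : U ↪[L] U')
    (T : K.Tower μ α hU) (T' : K.Tower μ α hU') : Prop :=
  (∀ i, i + 1 < α → T'.a i = g (T.a i)) ∧
  (∀ i, i + 1 < α → T'.N i = (T.N i).map g.toHom) ∧
  ∀ i < α, K.Le ((T.M i).map g.toHom) (T'.M i) ∧
    (T'.M i ≠ (T.M i).map g.toHom → K.UniversalOver μ (T'.M i) ((T.M i).map g.toHom))

/-- A tower is reduced if `M'ᵢ ∩ ⋃ⱼ Mⱼ = Mᵢ` for every extension `(M̄', ā, N̄)` and every `i`. -/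
def Tower.Reduced {μ : Cardinal.{u}} {α : Ordinal.{u}} {U : Type u} [L.Structure U]
    {hU : K.InK μ U} (T : K.Tower μ α hU) : Prop :=
  ∀ (U' : Type u) [L.Structure U'] (hU' : K.InK μ U') (g : U ↪[L] U') (T' : K.Tower μ α hU'),
    K.IsEmb g → T.Extends g T' → ∀ i < α,
      (T'.M i : Set U') ∩ ⋃ j ∈ Set.Iio α, g '' (T.M j : Set U) = g '' (T.M i : Set U)

/-- The tower is continuous at `β`. -/
def Tower.ContinuousAt {μ : Cardinal.{u}} {α : Ordinal.{u}} {U : Type u} [L.Structure U]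
    {hU : K.InK μ U} (T : K.Tower μ α hU) (β : Ordinal.{u}) : Prop :=
  (T.M β : Set U) = ⋃ i ∈ Set.Iio β, (T.M i : Set U)

variable (K)

/-! ### Symmetry -/

/-- `(μ, δ)`-symmetry for non-`μ`-splitting. The elements `a, b` and the models `N, M₀, M` lie in a
common `U ∈ K_μ`; the model `M^b` lies in a strong extension `U'` of `U` (via `g`). -/
def Symmetry (μ : Cardinal.{u}) (δ : Ordinal.{u}) : Prop :=
  ∀ (U : Type u) [L.Structure U] (hU : K.InK μ U) (N M₀ M : L.Substructure U)
    (hM₀ : K.Strong U M₀) (hM : K.Strong U M) (a b : U),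
    K.UniversalOver μ M M₀ → K.IsLimitOver μ δ M₀ N →
    a ∈ M → a ∉ M₀ →
    ¬ (tp hU hM₀ a).IsAlgebraic → ¬ (tp hU hM₀ a).Splits N →
    ¬ (tp hU hM b).IsAlgebraic → ¬ (tp hU hM b).Splits M₀ →
    ∃ (U' : Type u) (_ : L.Structure U') (hU' : K.InK μ U') (g : U ↪[L] U')
      (Mb : L.Substructure U') (hMb : K.Strong U' Mb) (θ : Ordinal.{u}),
      K.IsEmb g ∧ K.IsLimitOver μ θ Mb (M₀.map g.toHom) ∧ g b ∈ Mb ∧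
      ¬ (tp hU' hMb (g a)).Splits (N.map g.toHom)

end AEC

/-! The ambient model `U` is embedded by `e` into a model `V` in which every strong submodel of size
`μ` has universal extensions absorbing any prescribed `μ` elements; types and splitting are then
studied inside `V`. Such a `V` is the union of a continuous chain of length `μ⁺` in which each
successor realizes all types over its predecessor (stability and amalgamation);
`universalOver_of_realizesAll` shows that `μ` such steps give universality.

Identify `U` with its image. Since `M₀` is universal over `N`, non-splitting types extend
(`exists_nonsplitting_extension`). Hence there are limit models `S i ⊇ M₀`, `i < δ`, and copies `h
i` of `U` over `M₀` such that `h i a ∉ S i`, the type of `h i a` over `S i` does not split over `N`,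
and `S i` contains all earlier `S j` and the ranges of the earlier `h j`. Let `D` contain `M`, all
`S i` and all ranges of the `h i`, and let `b'` realize an extension of `tp(b/M)` to `D` that does
not split over `M₀`. The `S i`, topped by a limit model containing `D` and `b'`, form a tower of
length `δ + 1` with elements `h i a` and constant base `N`.

This tower has a reduced extension `M'` (`IsTower.exists_isReducedTower`): otherwise a continuous
chain of `μ⁺` towers would at every step move an element already present into a new level, against
the diagonal argument `Cardinal.false_of_injOn_of_continuous`. Limit continuity of non-splitting
keeps unions of towers towers. By hypothesis `M'` is continuous at `δ`, so `b'` lies in some `M' i`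
with `i < δ`, while `tp(h i a / M' i)` does not split over `N`. Extend this type without splitting
to a limit model `Mb ⊇ M' i` over `M₀`, realized by `a'`.

It remains to carry `(a, b)` to `(a', b')` over `M₀`. The maps `e` and `h i` both send `M` into `D`
and agree on `M₀`, so non-splitting of `tp(b'/D)` over `M₀` yields an embedding of `U` that agrees
with `h i` on `M` and sends `b` to `b'`. A further embedding fixing `M' i`, hence `b'`, sends `h i
a` to `a'`. The composite places the configuration as symmetry demands, with `Mb` as the limit
model. -/

theorem Ordinal.exists_seq {α : Type*} [Nonempty α]
    (Good : Ordinal.{u} → (Ordinal.{u} → α) → α → Prop)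
    (hcongr : ∀ i f g x, (∀ j < i, f j = g j) → Good i f x → Good i g x) (θ : Ordinal.{u})
    (step : ∀ i < θ, ∀ f, (∀ j < i, Good j f (f j)) → ∃ x, Good i f x) :
    ∃ f : Ordinal.{u} → α, ∀ i < θ, Good i f (f i) := by
  classical
  -- The value `c` fills the positions at and beyond `i`; by `hcongr` these do not influence `Good
  -- i`.
  let c : α := Classical.arbitrary α
  let F : (i : Ordinal.{u}) → ((j : Ordinal.{u}) → j < i → α) → α := fun i r =>
    if h : ∃ x, Good i (fun j => if hj : j < i then r j hj else c) x then h.choose else c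
  let f : Ordinal.{u} → α := WellFounded.fix Ordinal.lt_wf F
  have hf : ∀ i, f i = F i (fun j _ => f j) := fun i => WellFounded.fix_eq _ _ _
  refine ⟨f, fun i => ?_⟩
  induction i using WellFoundedLT.induction with
  | ind i ih =>
    intro hi
    obtain ⟨x, hx⟩ := step i hi f (fun j hj => ih j hj (hj.trans hi))
    have h : ∃ x, Good i (fun j => if hj : j < i then f j else c) x :=
      ⟨x, hcongr i f _ x (fun j hj => by simp [hj]) hx⟩
    have h1 : f i = h.choose := by
      rw [hf i]
      exact dif_pos h
    rw [h1]
    exact hcongr i _ f _ (fun j hj => by simp [hj]) h.choose_spec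

/-! ### Cardinal arithmetic below `μ⁺` -/

section Cardinality

variable {μ : Cardinal.{u}}

theorem Cardinal.mk_biUnion_Iio_le (hμ : ℵ₀ ≤ μ) {θ : Ordinal.{u}} (hθ : θ < (Order.succ μ).ord)
    {α : Type u} (A : Ordinal.{u} → Set α) (hA : ∀ i < θ, #(A i) ≤ μ) :
    #(⋃ i ∈ Set.Iio θ, A i : Set α) ≤ μ := by
  have h := mk_biUnion_le_lift.{u, u + 1} A (Set.Iio θ)
  rw [← Cardinal.lift_le.{u + 1}]
  refine h.trans ?_
  have h1 : lift.{u} #(Set.Iio θ) ≤ lift.{u + 1} μ := by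
    rw [mk_Iio_ordinal, Cardinal.lift_lift, Cardinal.lift_le]
    exact card_le_iff.2 hθ
  have h2 : (⨆ x : Set.Iio θ, lift.{u + 1} #(A x.1)) ≤ lift.{u + 1} μ := by
    refine ciSup_le' fun x => ?_
    rw [Cardinal.lift_le]
    exact hA _ x.2
  refine (mul_le_mul' h1 h2).trans ?_
  rw [← Cardinal.lift_mul, Cardinal.mul_eq_self hμ]

/-- Regularity of `μ⁺`. -/
theorem Ordinal.exists_lt_succ_ord_forall_lt (hμ : ℵ₀ ≤ μ) {ι : Type u} (hι : #ι ≤ μ)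
    (f : ι → Ordinal.{u}) (hf : ∀ i, f i < (Order.succ μ).ord) :
    ∃ γ < (Order.succ μ).ord, ∀ i, f i < γ := by
  refine ⟨⨆ i, f i + 1, ?_, fun i => Ordinal.lt_iSup_add_one f i⟩
  refine Ordinal.iSup_add_one_lt_of_lt_cof ?_ hf
  rw [(isRegular_succ hμ).cof_ord]
  exact Order.lt_succ_of_le hι

theorem Cardinal.isSuccLimit_succ_ord (hμ : ℵ₀ ≤ μ) : Order.IsSuccLimit (Order.succ μ).ord :=
  isSuccLimit_ord (hμ.trans (Order.le_succ μ))

theorem Cardinal.ord_lt_succ_ord (μ : Cardinal.{u}) : μ.ord < (Order.succ μ).ord :=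
  ord_lt_ord.2 (Order.lt_succ μ)

end Cardinality

namespace AEC

variable {L : FirstOrder.Language.{u, u}} {K : AEC L} {μ : Cardinal.{u}}

/-! ### Calculus of `K`-embeddings -/

section Embeddings

variable {M N P M' N' : Type u} [L.Structure M] [L.Structure N] [L.Structure P] [L.Structure M']
  [L.Structure N']

theorem IsEmb.mem_dom {f : M ↪[L] N} (h : K.IsEmb f) : K.Mem M :=
  K.mem_of_equiv _ _ f.equivRange.symm (K.mem_of_strong _ _ h).1

theorem IsEmb.mem_cod {f : M ↪[L] N} (h : K.IsEmb f) : K.Mem N :=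
  (K.mem_of_strong _ _ h).2

/-- This is the coherence axiom inside `P`, transported back along the isomorphism of `N` with the
range of `g`. -/
theorem IsEmb.of_comp {g : N ↪[L] P} {f : M ↪[L] N} (hg : K.IsEmb g)
    (h : K.IsEmb (g.comp f)) : K.IsEmb f := by
  have hle : (g.comp f).toHom.range ≤ g.toHom.range := by
    rintro x ⟨y, rfl⟩
    exact ⟨f y, rfl⟩
  have h1 := K.strong_of_equiv _ _ g.equivRange.symm _ (K.coherence P _ _ hle h hg)
  unfold IsEmb
  convert h1 using 1
  ext x
  simp only [Substructure.within, Substructure.mem_comap, Substructure.mem_map, Hom.mem_range]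
  constructor
  · rintro ⟨y, rfl⟩
    exact ⟨g.equivRange (f y), ⟨y, rfl⟩, g.equivRange.symm_apply_apply _⟩
  · rintro ⟨z, ⟨y, hy⟩, rfl⟩
    refine ⟨y, ?_⟩
    have : z = g.equivRange (f y) := Subtype.ext hy.symm
    rw [this]
    exact (g.equivRange.symm_apply_apply _).symm

theorem IsEmb.of_equiv {f : M ↪[L] N} (hf : K.IsEmb f) (e₁ : M ≃[L] M') (e₂ : N ≃[L] N')
    {f' : M' ↪[L] N'} (h : ∀ x, f' (e₁ x) = e₂ (f x)) : K.IsEmb f' := by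
  have h1 := K.strong_of_equiv _ _ e₂ _ hf
  unfold IsEmb
  convert h1 using 1
  ext x
  simp only [Substructure.mem_map, Hom.mem_range]
  constructor
  · rintro ⟨y, rfl⟩
    refine ⟨_, ⟨e₁.symm y, rfl⟩, ?_⟩
    have := h (e₁.symm y)
    rw [e₁.apply_symm_apply] at this
    exact this.symm
  · rintro ⟨_, ⟨y, rfl⟩, rfl⟩
    exact ⟨e₁ y, h y⟩

theorem isEmb_refl (h : K.Mem M) : K.IsEmb (Embedding.refl L M) :=
  isEmb_equiv (FirstOrder.Language.Equiv.refl L M) h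

theorem InK.of_equiv (h : K.InK μ M) (e : M ≃[L] N) : K.InK μ N :=
  ⟨K.mem_of_equiv _ _ e h.1, by rw [← h.2]; exact (Cardinal.mk_congr e.toEquiv).symm⟩

theorem isEmb_subtype_iff {S : L.Substructure N} : K.IsEmb S.subtype ↔ K.Strong N S := by
  unfold IsEmb
  rw [Substructure.range_subtype]

theorem isEmb_inclusion_iff {S T : L.Substructure N} (h : S ≤ T) :
    K.IsEmb (Substructure.inclusion h) ↔ K.Le S T := by
  have h' : (Substructure.inclusion h).toHom.range = S.within T := by
    ext x
    simp only [Hom.mem_range, Substructure.within, Substructure.mem_comap]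
    constructor
    · rintro ⟨y, rfl⟩
      exact y.2
    · intro hx
      exact ⟨⟨x, hx⟩, rfl⟩
  unfold IsEmb Le
  rw [h']
  exact ⟨fun h1 => ⟨h, h1⟩, fun h1 => h1.2⟩

/-- The corestriction of an embedding to a substructure containing its range is a `K`-embedding. -/
theorem IsEmb.codRestrict {f : M ↪[L] N} (hf : K.IsEmb f) {S : L.Substructure N}
    (hS : K.Strong N S) (h : ∀ x, f x ∈ S) : K.IsEmb (f.codRestrict S h) := by
  refine IsEmb.of_comp (g := S.subtype) (isEmb_subtype hS) ?_
  rwa [Embedding.subtype_comp_codRestrict]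

end Embeddings

/-! ### The relation between strong submodels of one structure -/

section Le

variable {V W : Type u} [L.Structure V] [L.Structure W] {S T R : L.Substructure V}

theorem le_of_strong (hS : K.Strong V S) (hT : K.Strong V T) (h : S ≤ T) : K.Le S T :=
  ⟨h, K.coherence _ _ _ h hS hT⟩

theorem Le.strong (h : K.Le S T) (hT : K.Strong V T) : K.Strong V S :=
  K.trans _ _ _ h.1 h.2 hT

theorem Le.trans (h : K.Le S T) (h' : K.Le T R) : K.Le S R :=
  (isEmb_inclusion_iff (h.1.trans h'.1)).1 ((isEmb_inclusion h').comp (isEmb_inclusion h))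

theorem Le.refl (h : K.Mem S) : K.Le S S :=
  (isEmb_inclusion_iff le_rfl).1 (isEmb_refl h)

theorem Le.of_le (h : K.Le S R) (h' : K.Le T R) (hle : S ≤ T) : K.Le S T :=
  (isEmb_inclusion_iff hle).1 (IsEmb.of_comp (isEmb_inclusion h') (isEmb_inclusion h))

theorem Le.mem_left (h : K.Le S T) : K.Mem S := (isEmb_inclusion h).mem_dom

theorem Le.mem_right (h : K.Le S T) : K.Mem T := (isEmb_inclusion h).mem_cod

theorem inK_range {f : W ↪[L] V} (h : K.InK μ W) : K.InK μ f.toHom.range :=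
  h.of_equiv f.equivRange

/-- `Le` depends only on the pair of models and not on the ambient structure, so `e` may be any
embedding of `L`-structures; `strong_map_iff`, in contrast, needs a `K`-embedding. -/
theorem le_map_iff (e : V ↪[L] W) : K.Le (S.map e.toHom) (T.map e.toHom) ↔ K.Le S T := by
  have hiff : S.map e.toHom ≤ T.map e.toHom ↔ S ≤ T :=
    Substructure.map_le_map_iff_of_injective e.injective
  constructor
  · intro h
    rw [← isEmb_inclusion_iff (hiff.1 h.1)]
    refine (isEmb_inclusion h).of_equiv (e.substructureEquivMap S).symm
      (e.substructureEquivMap T).symm fun x => ?_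
    obtain ⟨y, rfl⟩ := (e.substructureEquivMap S).surjective x
    rw [FirstOrder.Language.Equiv.symm_apply_apply]
    apply (e.substructureEquivMap T).injective
    rw [FirstOrder.Language.Equiv.apply_symm_apply]
    exact Subtype.ext rfl
  · intro h
    rw [← isEmb_inclusion_iff (hiff.2 h.1)]
    exact (isEmb_inclusion h).of_equiv (e.substructureEquivMap S)
      (e.substructureEquivMap T) fun x => Subtype.ext rfl

theorem inK_map_iff (e : V ↪[L] W) : K.InK μ (S.map e.toHom) ↔ K.InK μ S :=
  ⟨fun h => h.of_equiv (e.substructureEquivMap S).symm,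
    fun h => h.of_equiv (e.substructureEquivMap S)⟩

theorem strong_map_iff {e : V ↪[L] W} (he : K.IsEmb e) :
    K.Strong W (S.map e.toHom) ↔ K.Strong V S := by
  have h : K.IsEmb (e.comp S.subtype) ↔ K.Strong W (S.map e.toHom) := by
    unfold IsEmb
    have : (e.comp S.subtype).toHom.range = S.map e.toHom := by
      ext x
      simp only [Hom.mem_range, Substructure.mem_map]
      constructor
      · rintro ⟨y, rfl⟩
        exact ⟨y, y.2, rfl⟩
      · rintro ⟨y, hy, rfl⟩
        exact ⟨⟨y, hy⟩, rfl⟩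
    rw [this]
  rw [← h, ← isEmb_subtype_iff]
  exact ⟨fun h1 => IsEmb.of_comp he h1, fun h1 => he.comp h1⟩

theorem map_comap_eq_of_le {e : V ↪[L] W} {S : L.Substructure V} {T : L.Substructure W}
    (h : T ≤ S.map e.toHom) : (T.comap e.toHom).map e.toHom = T := by
  ext x
  simp only [Substructure.mem_map, Substructure.mem_comap]
  constructor
  · rintro ⟨y, hy, rfl⟩
    exact hy
  · intro hx
    obtain ⟨y, -, rfl⟩ := h hx
    exact ⟨y, hx, rfl⟩

theorem within_map_subtype {S T : L.Substructure V} (h : S ≤ T) :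
    (S.within T).map T.subtype.toHom = S := by
  ext x
  simp only [Substructure.mem_map, Substructure.mem_comap, Substructure.within]
  constructor
  · rintro ⟨y, hy, rfl⟩
    exact hy
  · intro hx
    exact ⟨⟨x, h hx⟩, hx, rfl⟩

end Le

/-! ### Universal extensions and limit models under embeddings -/

section Universal

variable {V W : Type u} [L.Structure V] [L.Structure W] {S T R : L.Substructure V}

theorem UniversalOver.map (h : K.UniversalOver μ T S) (e : V ↪[L] W) :
    K.UniversalOver μ (T.map e.toHom) (S.map e.toHom) := by
  obtain ⟨hS, hT, hle, hu⟩ := h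
  refine ⟨(inK_map_iff e).2 hS, (inK_map_iff e).2 hT, (le_map_iff e).2 hle, ?_⟩
  intro P _ g hP hg
  obtain ⟨f, hf, hfx⟩ := hu P (g.comp (e.substructureEquivMap S).toEmbedding) hP
    (hg.comp (isEmb_equiv _ ((inK_map_iff e).2 hS).1))
  refine ⟨(e.substructureEquivMap T).toEmbedding.comp f,
    (isEmb_equiv _ ((inK_map_iff e).2 hT).1).comp hf, fun x => ?_⟩
  obtain ⟨y, rfl⟩ := (e.substructureEquivMap S).surjective x
  have := hfx y
  change e (f (g _) : V) = e y
  exact congrArg e this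

theorem UniversalOver.of_map {e : V ↪[L] W}
    (h : K.UniversalOver μ (T.map e.toHom) (S.map e.toHom)) : K.UniversalOver μ T S := by
  obtain ⟨hS, hT, hle, hu⟩ := h
  rw [inK_map_iff] at hS hT
  rw [le_map_iff] at hle
  refine ⟨hS, hT, hle, ?_⟩
  intro P _ g hP hg
  obtain ⟨f, hf, hfx⟩ := hu P (g.comp (e.substructureEquivMap S).symm.toEmbedding) hP
    (hg.comp (isEmb_equiv _ hS.1))
  refine ⟨(e.substructureEquivMap T).symm.toEmbedding.comp f,
    (isEmb_equiv _ hT.1).comp hf, fun x => ?_⟩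
  have := hfx (e.substructureEquivMap S x)
  change (f (g ((e.substructureEquivMap S).symm _)) : W) = e x at this
  rw [FirstOrder.Language.Equiv.symm_apply_apply] at this
  change ((e.substructureEquivMap T).symm (f (g x)) : V) = x
  apply e.injective
  rw [← this]
  obtain ⟨z, hz⟩ := (e.substructureEquivMap T).surjective (f (g x))
  rw [← hz, FirstOrder.Language.Equiv.symm_apply_apply]
  rfl

theorem universalOver_map_iff (e : V ↪[L] W) :
    K.UniversalOver μ (T.map e.toHom) (S.map e.toHom) ↔ K.UniversalOver μ T S :=
  ⟨UniversalOver.of_map, fun h => h.map e⟩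

/-- Universality is inherited by larger models. -/
theorem UniversalOver.mono_left (h : K.UniversalOver μ T S) (hle : K.Le T R) (hR : K.InK μ R) :
    K.UniversalOver μ R S := by
  obtain ⟨hS, hT, hST, hu⟩ := h
  refine ⟨hS, hR, hST.trans hle, fun P _ g hP hg => ?_⟩
  obtain ⟨f, hf, hfx⟩ := hu P g hP hg
  exact ⟨(Substructure.inclusion hle.1).comp f, (isEmb_inclusion hle).comp hf, hfx⟩

/-- Universality over a model is inherited by smaller base models, given amalgamation. -/
theorem UniversalOver.mono_right (hAP : K.Amalgamation μ) (h : K.UniversalOver μ R T)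
    (hle : K.Le S T) (hS : K.InK μ S) : K.UniversalOver μ R S := by
  obtain ⟨hT, hR, hTR, hu⟩ := h
  refine ⟨hS, hR, hle.trans hTR, fun P _ g hP hg => ?_⟩
  -- The given extension of `S` is amalgamated with `T` over `S`; the amalgam extends `T` and so
  -- embeds into `R` over `T`.
  obtain ⟨Q, _, g₁, g₂, hQ, h₁, h₂, h12⟩ :=
    hAP S T P (Substructure.inclusion hle.1) g hS hT hP (isEmb_inclusion hle) hg
  obtain ⟨f, hf, hfx⟩ := hu Q g₁ hQ h₁
  refine ⟨f.comp g₂, hf.comp h₂, fun x => ?_⟩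
  change (f (g₂ (g x)) : V) = x
  rw [← h12 x]
  exact hfx _

theorem LimitWitness.congr {θ : Ordinal.{u}} {M : L.Substructure V}
    {S S' : Ordinal.{u} → L.Substructure V} (h : K.LimitWitness μ θ M S)
    (hS : ∀ i < θ, S i = S' i) : K.LimitWitness μ θ M S' where
  isLimit := h.isLimit
  lt_succ := h.lt_succ
  inK i hi := hS i hi ▸ h.inK i hi
  mono i j hij hj := by
    rw [← hS i (hij.trans_lt hj), ← hS j hj]
    exact h.mono i j hij hj
  cont i hi hl := by
    rw [← hS i hi, h.cont i hi hl]
    exact Set.iUnion₂_congr fun j hj => by rw [hS j (lt_trans hj hi)]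
  universal i hi := by
    rw [← hS i hi, ← hS (i + 1) (by simpa using h.isLimit.succ_lt hi)]
    exact h.universal i hi
  union := by
    rw [h.union]
    exact Set.iUnion₂_congr fun j hj => by rw [hS j hj]

theorem coe_map_eq_iUnion_iff (e : V ↪[L] W) {M : L.Substructure V}
    {S : Ordinal.{u} → L.Substructure V} {θ : Ordinal.{u}} :
    ((M.map e.toHom : L.Substructure W) : Set W) =
      ⋃ i ∈ Set.Iio θ, (((S i).map e.toHom : L.Substructure W) : Set W) ↔
    (M : Set V) = ⋃ i ∈ Set.Iio θ, (S i : Set V) := by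
  have h1 : ∀ R : L.Substructure V, ((R.map e.toHom : L.Substructure W) : Set W) = e '' R :=
    fun R => rfl
  simp only [h1]
  rw [← Set.image_iUnion₂]
  exact e.injective.image_injective.eq_iff

theorem limitWitness_map_iff (e : V ↪[L] W) {θ : Ordinal.{u}} {M : L.Substructure V}
    {S : Ordinal.{u} → L.Substructure V} :
    K.LimitWitness μ θ (M.map e.toHom) (fun i => (S i).map e.toHom) ↔
      K.LimitWitness μ θ M S := by
  constructor
  · intro h
    exact ⟨h.isLimit, h.lt_succ, fun i hi => (inK_map_iff e).1 (h.inK i hi),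
      fun i j hij hj => (le_map_iff e).1 (h.mono i j hij hj),
      fun i hi hl => (coe_map_eq_iUnion_iff e).1 (h.cont i hi hl),
      fun i hi => (h.universal i hi).of_map, (coe_map_eq_iUnion_iff e).1 h.union⟩
  · intro h
    exact ⟨h.isLimit, h.lt_succ, fun i hi => (inK_map_iff e).2 (h.inK i hi),
      fun i j hij hj => (le_map_iff e).2 (h.mono i j hij hj),
      fun i hi hl => (coe_map_eq_iUnion_iff e).2 (h.cont i hi hl),
      fun i hi => (h.universal i hi).map e, (coe_map_eq_iUnion_iff e).2 h.union⟩

theorem LimitWitness.pos {θ : Ordinal.{u}} {M : L.Substructure V}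
    {S : Ordinal.{u} → L.Substructure V} (h : K.LimitWitness μ θ M S) : 0 < θ :=
  h.isLimit.bot_lt

theorem isLimitOver_map_iff (e : V ↪[L] W) {θ : Ordinal.{u}} {M N : L.Substructure V} :
    K.IsLimitOver μ θ (M.map e.toHom) (N.map e.toHom) ↔ K.IsLimitOver μ θ M N := by
  constructor
  · rintro ⟨S, hS, h0⟩
    -- The members below `θ` lie in the union, hence in the range of `e`, and can be pulled back.
    -- Members from `θ` on are irrelevant, which is why the witness is replaced through
    -- `LimitWitness.congr`.
    have hle : ∀ i < θ, ((S i).comap e.toHom).map e.toHom = S i := fun i hi =>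
      map_comap_eq_of_le (hS.le hi).1
    refine ⟨fun i => (S i).comap e.toHom, ?_, ?_⟩
    · rw [← limitWitness_map_iff e]
      exact hS.congr fun i hi => (hle i hi).symm
    · change (S 0).comap e.toHom = N
      rw [h0]
      exact Substructure.comap_map_eq_of_injective e.injective N
  · rintro ⟨S, hS, rfl⟩
    exact ⟨fun i => (S i).map e.toHom, (limitWitness_map_iff e).2 hS, rfl⟩

theorem isLimitModel_map_iff (e : V ↪[L] W) {M : L.Substructure V} :
    K.IsLimitModel μ (M.map e.toHom) ↔ K.IsLimitModel μ M := by
  constructor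
  · rintro ⟨θ, N, h⟩
    have hN : (N.comap e.toHom).map e.toHom = N := by
      obtain ⟨S, hS, rfl⟩ := h
      exact map_comap_eq_of_le (hS.le hS.pos).1
    rw [← hN] at h
    exact ⟨θ, _, (isLimitOver_map_iff e).1 h⟩
  · rintro ⟨θ, N, h⟩
    exact ⟨θ, _, (isLimitOver_map_iff e).2 h⟩

theorem LimitWitness.inK_union {θ : Ordinal.{u}} {M : L.Substructure V}
    {S : Ordinal.{u} → L.Substructure V} (h : K.LimitWitness μ θ M S) (hμ : ℵ₀ ≤ μ) :
    K.InK μ M := by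
  refine ⟨(h.le h.pos).mem_right, le_antisymm ?_ ?_⟩
  · change #(M : Set V) ≤ μ
    rw [h.union]
    exact mk_biUnion_Iio_le hμ h.lt_succ _ fun i hi => (h.inK i hi).2.le
  · rw [← (h.inK 0 h.pos).2]
    exact Cardinal.mk_le_mk_of_subset (h.le h.pos).1

end Universal

theorem aleph0_le_LS (K : AEC L) : ℵ₀ ≤ K.LS :=
  (csInf_mem (s := {κ : Cardinal.{u} | ℵ₀ ≤ κ ∧ L.card ≤ κ ∧
    ∀ (N : Type u) [L.Structure N], K.Mem N → ∀ A : Set N,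
      ∃ S : L.Substructure N, K.Strong N S ∧ A ⊆ S ∧ #S ≤ #A + κ}) K.exists_LS).1

/-! ### Galois types and non-splitting in terms of embeddings -/

section Types

variable {A B C : Type u} [L.Structure A] [L.Structure B] [L.Structure C]

theorem PreType.Rel.refl (t : K.PreType μ A) : t.Rel t :=
  ⟨t.carrier, t.str, Embedding.refl L _, Embedding.refl L _, t.inK, isEmb_refl t.inK.1,
    isEmb_refl t.inK.1, fun _ => rfl, rfl⟩

theorem PreType.Rel.symm {t s : K.PreType μ A} (h : t.Rel s) : s.Rel t := by
  obtain ⟨P, i, f, g, hP, hf, hg, hx, he⟩ := h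
  exact ⟨P, i, g, f, hP, hg, hf, fun x => (hx x).symm, he.symm⟩

theorem PreType.Rel.trans (hAP : K.Amalgamation μ) {t s r : K.PreType μ A} (h : t.Rel s)
    (h' : s.Rel r) : t.Rel r := by
  obtain ⟨P, _, f, g, hP, hf, hg, hx, he⟩ := h
  obtain ⟨P', _, f', g', hP', hf', hg', hx', he'⟩ := h'
  obtain ⟨Q, _, k, k', hQ, hk, hk', hkk⟩ := hAP s.carrier P P' g f' s.inK hP hP' hg hf'
  refine ⟨Q, inferInstance, k.comp f, k'.comp g', hQ, hk.comp hf, hk'.comp hg', fun x => ?_, ?_⟩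
  · change k (f (t.emb x)) = k' (g' (r.emb x))
    rw [hx, hkk, hx']
  · change k (f t.elt) = k' (g' r.elt)
    rw [he, hkk, he']

/-- Equality in the quotient is the generated equivalence relation; amalgamation makes `PreType.Rel`
transitive, so nothing new is generated. -/
theorem GaS.mk_eq_mk_iff (hAP : K.Amalgamation μ) {t s : K.PreType μ A} :
    (Quot.mk _ t : K.GaS μ A) = Quot.mk _ s ↔ t.Rel s := by
  rw [Quot.eq]
  constructor
  · intro h
    induction h with
    | rel _ _ h => exact h
    | refl _ => exact PreType.Rel.refl _
    | symm _ _ _ ih => exact ih.symm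
    | trans _ _ _ _ _ ih ih' => exact ih.trans hAP ih'
  · exact Relation.EqvGen.rel _ _

theorem GaS.pull_pull {f : B ↪[L] C} {g : A ↪[L] B} (hf : K.IsEmb f) (hg : K.IsEmb g)
    (p : K.GaS μ C) : (p.pull f hf).pull g hg = p.pull (f.comp g) (hf.comp hg) := by
  induction p using Quot.ind
  rfl

theorem GaS.pull_congr {f g : A ↪[L] B} (h : ∀ x, f x = g x) (hf : K.IsEmb f) (hg : K.IsEmb g)
    (p : K.GaS μ B) : p.pull f hf = p.pull g hg := by
  obtain rfl : f = g := Embedding.ext h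
  rfl

theorem GaS.pull_refl (h : K.IsEmb (Embedding.refl L A)) (p : K.GaS μ A) : p.pull _ h = p := by
  induction p using Quot.ind
  rfl

theorem GaS.pull_equiv_injective (e : A ≃[L] B) (hB : K.Mem B) {p q : K.GaS μ B}
    (h : p.pull e.toEmbedding (isEmb_equiv e hB) = q.pull e.toEmbedding (isEmb_equiv e hB)) :
    p = q := by
  have hA : K.Mem A := (isEmb_equiv e hB).mem_dom
  have key : ∀ r : K.GaS μ B, (r.pull e.toEmbedding (isEmb_equiv e hB)).pull
      e.symm.toEmbedding (isEmb_equiv e.symm hA) = r := fun r => by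
    rw [GaS.pull_pull, GaS.pull_congr (g := Embedding.refl L B) _ _ (isEmb_refl hB),
      GaS.pull_refl]
    intro x
    exact e.apply_symm_apply x
  rw [← key p, h, key q]

/-- `μ`-splitting, with both restrictions compared over the first of the two models. -/
theorem GaS.splits_iff {V : Type u} [L.Structure V] {M N : L.Substructure V} {p : K.GaS μ M} :
    p.Splits N ↔ ∃ (N₁ N₂ : L.Substructure V) (h₁ : K.Le N₁ M) (h₂ : K.Le N₂ M)
      (h : N₁ ≃[L] N₂), K.InK μ N₁ ∧ K.Le N N₁ ∧ K.Le N N₂ ∧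
      (∀ x : N₁, (x : V) ∈ N → (h x : V) = x) ∧
      p.pull (Substructure.inclusion h₁.1) (isEmb_inclusion h₁) ≠
        p.pull ((Substructure.inclusion h₂.1).comp h.toEmbedding)
          ((isEmb_inclusion h₂).comp (isEmb_equiv h h₂.mem_left)) := by
  have key : ∀ (N₁ N₂ : L.Substructure V) (h₁ : K.Le N₁ M) (h₂ : K.Le N₂ M) (h : N₁ ≃[L] N₂),
      (p.res h₁).image h₁.mem_left h = p.res h₂ ↔
      p.pull (Substructure.inclusion h₁.1) (isEmb_inclusion h₁) =
        p.pull ((Substructure.inclusion h₂.1).comp h.toEmbedding)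
          ((isEmb_inclusion h₂).comp (isEmb_equiv h h₂.mem_left)) := by
    intro N₁ N₂ h₁ h₂ h
    constructor
    · intro he
      rw [← GaS.pull_pull (isEmb_inclusion h₂) (isEmb_equiv h h₂.mem_left)]
      change _ = (p.res h₂).pull _ _
      rw [← he]
      unfold GaS.image GaS.res
      rw [GaS.pull_pull, GaS.pull_pull]
      apply GaS.pull_congr
      intro x
      change _ = Substructure.inclusion h₁.1 (h.symm (h x))
      rw [h.symm_apply_apply]
    · intro he
      unfold GaS.image GaS.res
      rw [he, GaS.pull_pull]
      apply GaS.pull_congr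
      intro x
      change Substructure.inclusion h₂.1 (h (h.symm x)) = _
      rw [h.apply_symm_apply]
  constructor
  · rintro ⟨N₁, N₂, h₁, h₂, m₁, m₂, h, hN₁, hN₂, hx, hne⟩
    exact ⟨N₁, N₂, h₁, h₂, h, m₁, hN₁, hN₂, hx, fun he => hne ((key _ _ _ _ _).2 he)⟩
  · rintro ⟨N₁, N₂, h₁, h₂, h, m₁, hN₁, hN₂, hx, hne⟩
    exact ⟨N₁, N₂, h₁, h₂, m₁, m₁.of_equiv h, h, hN₁, hN₂, hx,
      fun he => hne ((key _ _ _ _ _).1 he)⟩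

/-- A type `p ∈ ga-S(B)` does not `μ`-split over the image of `j : A → B`, stated for abstract
embeddings: any two embeddings over `A` of a model `C ∈ K_μ` into `B` pull `p` back to the same
type. -/
def GaS.NonSplitting (p : K.GaS μ B) (j : A ↪[L] B) : Prop :=
  ∀ (C : Type u) [L.Structure C] (g : A ↪[L] C) (f₁ f₂ : C ↪[L] B) (h₁ : K.IsEmb f₁)
    (h₂ : K.IsEmb f₂), K.InK μ C → K.IsEmb g → (∀ x, f₁ (g x) = j x) → (∀ x, f₂ (g x) = j x) →
    p.pull f₁ h₁ = p.pull f₂ h₂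

theorem le_map_subtype_iff {V : Type u} [L.Structure V] {M : L.Substructure V}
    {N : L.Substructure M} : K.Le (N.map M.subtype.toHom) M ↔ K.Strong M N := by
  have hle : N.map M.subtype.toHom ≤ M := by
    rintro x ⟨y, -, rfl⟩
    exact y.2
  have : (N.map M.subtype.toHom).within M = N :=
    Substructure.comap_map_eq_of_injective M.subtype_injective N
  unfold Le
  rw [this]
  exact ⟨fun h => h.2, fun h => ⟨hle, h⟩⟩

/-- Two embeddings of a model `C` over `N` amount to two submodels, their ranges, with the
isomorphism between them that passes through `C`. The embedding form is stable under composition and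
is the one used to extend and transfer types. -/
theorem GaS.not_splits_iff {V : Type u} [L.Structure V] {M N : L.Substructure V}
    (hN : K.Le N M) {p : K.GaS μ M} :
    ¬ p.Splits N ↔ p.NonSplitting (Substructure.inclusion hN.1) := by
  rw [← not_iff_not, not_not, GaS.splits_iff]
  constructor
  · rintro ⟨N₁, N₂, h₁, h₂, h, m₁, hN₁, hN₂, hx, hne⟩ hns
    exact hne (hns N₁ (Substructure.inclusion hN₁.1) (Substructure.inclusion h₁.1)
      ((Substructure.inclusion h₂.1).comp h.toEmbedding) _ _ m₁ (isEmb_inclusion hN₁)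
      (fun x => rfl) fun x => Subtype.ext (hx _ x.2))
  · intro hns
    by_contra hcon
    refine hns ?_
    intro C _ g f₁ f₂ h₁ h₂ hC hg e₁ e₂
    by_contra hne
    refine hcon ?_
    let k₁ := M.subtype.comp f₁
    let k₂ := M.subtype.comp f₂
    have hk : ∀ f : C ↪[L] M, K.IsEmb f → K.Le (M.subtype.comp f).toHom.range M := by
      intro f hf
      have : (M.subtype.comp f).toHom.range = f.toHom.range.map M.subtype.toHom :=
        Hom.range_comp f.toHom M.subtype.toHom
      rw [this, le_map_subtype_iff]
      exact hf
    have hNk : ∀ f : C ↪[L] M, (∀ x, f (g x) = Substructure.inclusion hN.1 x) →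
        N ≤ (M.subtype.comp f).toHom.range := by
      intro f e x hx
      exact ⟨g ⟨x, hx⟩, congrArg Subtype.val (e ⟨x, hx⟩)⟩
    have hk₁ := hk f₁ h₁
    have hk₂ := hk f₂ h₂
    refine ⟨k₁.toHom.range, k₂.toHom.range, hk₁, hk₂, k₂.equivRange.comp k₁.equivRange.symm,
      hC.of_equiv k₁.equivRange, Le.of_le hN hk₁ (hNk f₁ e₁), Le.of_le hN hk₂ (hNk f₂ e₂), ?_, ?_⟩
    · intro x hx
      have h1 : x = k₁.equivRange (g ⟨x, hx⟩) :=
        Subtype.ext (congrArg Subtype.val (e₁ ⟨x, hx⟩)).symm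
      change ((k₂.equivRange (k₁.equivRange.symm x)) : V) = x
      rw [h1, FirstOrder.Language.Equiv.symm_apply_apply, ← h1]
      exact congrArg Subtype.val (e₂ ⟨x, hx⟩)
    · intro he
      refine hne ?_
      have := congrArg (fun q => GaS.pull k₁.equivRange.toEmbedding
        (isEmb_equiv k₁.equivRange hk₁.mem_left) q) he
      simp only [GaS.pull_pull] at this
      refine Eq.trans this ?_
      apply GaS.pull_congr
      intro x
      refine Subtype.ext ?_
      change (k₂.equivRange (k₁.equivRange.symm (k₁.equivRange x)) : V) = _
      rw [FirstOrder.Language.Equiv.symm_apply_apply]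
      rfl

theorem GaS.NonSplitting.of_equiv {A' B' : Type u} [L.Structure A'] [L.Structure B']
    {p : K.GaS μ B} {j : A ↪[L] B} (h : p.NonSplitting j) (eA : A' ≃[L] A) (eB : B' ≃[L] B)
    (heB : K.Mem B) {j' : A' ↪[L] B'} (hj : ∀ x, eB (j' x) = j (eA x)) :
    (p.pull eB.toEmbedding (isEmb_equiv eB heB)).NonSplitting j' := by
  intro C _ g f₁ f₂ h₁ h₂ hC hg e₁ e₂
  rw [GaS.pull_pull, GaS.pull_pull]
  refine h C (g.comp eA.symm.toEmbedding) _ _ _ _ hC ?_ ?_ ?_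
  · exact hg.comp (isEmb_equiv _ hg.mem_dom)
  · intro x
    change eB (f₁ (g (eA.symm x))) = _
    rw [e₁, hj, FirstOrder.Language.Equiv.apply_symm_apply]
  · intro x
    change eB (f₂ (g (eA.symm x))) = _
    rw [e₂, hj, FirstOrder.Language.Equiv.apply_symm_apply]

/-- Non-splitting can be transferred along an embedding of the ambient structures. -/
theorem GaS.not_splits_map_iff {V W : Type u} [L.Structure V] [L.Structure W]
    {M N : L.Substructure V} (e : V ↪[L] W) (hN : K.Le N M) (hM : K.Mem (M.map e.toHom))
    {p : K.GaS μ (M.map e.toHom)} :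
    ¬ (p.pull (e.substructureEquivMap M).toEmbedding (isEmb_equiv _ hM)).Splits N ↔
      ¬ p.Splits (N.map e.toHom) := by
  have hN' := (le_map_iff e).2 hN
  rw [GaS.not_splits_iff hN, GaS.not_splits_iff hN']
  constructor
  · intro h
    have := h.of_equiv (e.substructureEquivMap N).symm (e.substructureEquivMap M).symm
      hN.mem_right (j' := Substructure.inclusion hN'.1) ?_
    · rw [GaS.pull_pull, GaS.pull_congr (g := Embedding.refl L _) _ _ (isEmb_refl hM),
        GaS.pull_refl] at this
      · exact this
      · intro x
        exact (e.substructureEquivMap M).apply_symm_apply x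
    · intro x
      obtain ⟨y, rfl⟩ := (e.substructureEquivMap N).surjective x
      rw [FirstOrder.Language.Equiv.symm_apply_apply]
      apply (e.substructureEquivMap M).injective
      rw [FirstOrder.Language.Equiv.apply_symm_apply]
      rfl
  · intro h
    exact h.of_equiv (e.substructureEquivMap N) (e.substructureEquivMap M) hM
      fun x => rfl

end Types

/-! ### Chains of models on a fixed set -/

/-- An `L`-structure with an injection into the set `X`: a structure on a subset of `X`. -/
structure PartialModel (L : FirstOrder.Language.{u, u}) (X : Type u) where
  carrier : Type u
  [str : L.Structure carrier]
  ι : carrier → X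
  inj : Function.Injective ι

attribute [instance] PartialModel.str

/-- `P ≺_K Q` for structures on subsets of `X`. -/
def PartialModel.Le (K : AEC L) {X : Type u} (P Q : PartialModel L X) : Prop :=
  ∃ f : P.carrier ↪[L] Q.carrier, K.IsEmb f ∧ ∀ x, Q.ι (f x) = P.ι x

namespace PartialModel

variable {X : Type u}

theorem Le.refl {P : PartialModel L X} (h : K.Mem P.carrier) : P.Le K P :=
  ⟨Embedding.refl L _, isEmb_refl h, fun _ => rfl⟩

theorem Le.trans {P Q R : PartialModel L X} (h : P.Le K Q) (h' : Q.Le K R) : P.Le K R := by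
  obtain ⟨f, hf, hfx⟩ := h
  obtain ⟨g, hg, hgx⟩ := h'
  exact ⟨g.comp f, hg.comp hf, fun x => (hgx (f x)).trans (hfx x)⟩

theorem Le.range_subset {P Q : PartialModel L X} (h : P.Le K Q) :
    Set.range P.ι ⊆ Set.range Q.ι := by
  obtain ⟨f, -, hfx⟩ := h
  rintro _ ⟨x, rfl⟩
  exact ⟨f x, hfx x⟩

/-- Since the labels in `X` are injective, an embedding that preserves labels is unique. The
transition maps therefore commute automatically, and the union is their direct limit, labelled by
`X` again. -/
theorem exists_union {γ : Ordinal.{u}} (hγ : Order.IsSuccLimit γ)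
    (P : Ordinal.{u} → PartialModel L X)
    (hle : ∀ i j, i ≤ j → j < γ → (P i).Le K (P j))
    (hcont : ∀ j < γ, Order.IsSuccLimit j →
      Set.range (P j).ι = ⋃ i ∈ Set.Iio j, Set.range (P i).ι) :
    ∃ Q : PartialModel L X, K.Mem Q.carrier ∧ (∀ i < γ, (P i).Le K Q) ∧
      Set.range Q.ι = ⋃ i ∈ Set.Iio γ, Set.range (P i).ι := by
  let I := γ.ToType
  let o : I → Ordinal.{u} := fun i => (Ordinal.ToType.mk.symm i : Set.Iio γ)
  have ho : ∀ i, o i < γ := fun i => (Ordinal.ToType.mk.symm i : Set.Iio γ).2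
  have hoi : ∀ i < γ, ∃ k, o k = i := fun i hi =>
    ⟨Ordinal.ToType.mk ⟨i, hi⟩, by simp [o]⟩
  have hom : ∀ {i j : I}, i ≤ j → o i ≤ o j := fun h => by
    change (Ordinal.ToType.mk.symm _ : Set.Iio γ) ≤ Ordinal.ToType.mk.symm _
    simpa using h
  have : Nonempty I := ⟨(hoi 0 hγ.bot_lt).choose⟩
  choose f hf hfx using fun (i j : I) (h : i ≤ j) => hle (o i) (o j) (hom h) (ho j)
  let G : I → Type u := fun i => (P (o i)).carrier
  let : ∀ i, L.Structure (G i) := fun i => (P (o i)).str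
  have : DirectedSystem G fun i j h => f i j h :=
    ⟨fun i x => (P (o i)).inj (hfx i i le_rfl x),
      fun k j i hij hjk x => (P (o k)).inj (by
        rw [hfx j k hjk, hfx i j hij, hfx i k])⟩
  let D := Language.DirectLimit G f
  let of : ∀ i, G i ↪[L] D := fun i => Language.DirectLimit.of L I G f i
  have hof : ∀ i j (h : i ≤ j) x, of j (f i j h x) = of i x :=
    fun i j h x => Language.DirectLimit.of_f
  have hex : ∀ z : D, ∃ i x, of i x = z := fun z => Language.DirectLimit.exists_of z
  choose q r hqr using hex
  let ι : D → X := fun z => (P (o (q z))).ι (r z)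
  have hι : ∀ i x, ι (of i x) = (P (o i)).ι x := by
    intro i x
    obtain ⟨k, hk₁, hk₂⟩ := directed_of (· ≤ ·) (q (of i x)) i
    have h1 := (hof _ k hk₁ _).trans ((hqr (of i x)).trans (hof i k hk₂ x).symm)
    have h2 := (of k).injective h1
    change (P (o _)).ι _ = _
    rw [← hfx _ k hk₁, ← hfx i k hk₂, h2]
  have hιinj : Function.Injective ι := by
    intro z w h
    obtain ⟨i, x, rfl⟩ : ∃ i x, of i x = z := ⟨_, _, hqr z⟩
    obtain ⟨j, y, rfl⟩ : ∃ i x, of i x = w := ⟨_, _, hqr w⟩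
    rw [hι, hι] at h
    obtain ⟨k, hk₁, hk₂⟩ := directed_of (· ≤ ·) i j
    rw [← hof _ k hk₁, ← hof j k hk₂]
    congr 1
    apply (P (o k)).inj
    rw [hfx, hfx, h]
  classical
  -- The images of the members form a chain inside the direct limit, to which the chain axiom
  -- applies with union the whole structure; `⊤` is a filler for indices not below `γ`.
  let S : Ordinal.{u} → L.Substructure D := fun i =>
    if h : i < γ then (of (hoi i h).choose).toHom.range else ⊤
  have hS : ∀ k : I, S (o k) = (of k).toHom.range := by
    intro k
    have h1 : (hoi (o k) (ho k)).choose = k := by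
      apply Ordinal.ToType.mk.symm.injective
      exact Subtype.ext (hoi (o k) (ho k)).choose_spec
    change (if h : o k < γ then _ else _) = _
    rw [dif_pos (ho k), h1]
  have hSι : ∀ i < γ, ∀ z : D, z ∈ S i ↔ ι z ∈ Set.range (P i).ι := by
    intro i hi z
    obtain ⟨k, rfl⟩ := hoi i hi
    rw [hS]
    constructor
    · rintro ⟨x, rfl⟩
      exact ⟨x, (hι k x).symm⟩
    · rintro ⟨x, hx⟩
      refine ⟨x, hιinj ?_⟩
      rw [← hx]
      exact hι k x
  have hSmono : ∀ i j, i ≤ j → j < γ → K.Le (S i) (S j) := by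
    intro i j hij hj
    obtain ⟨k, rfl⟩ := hoi j hj
    obtain ⟨l, rfl⟩ := hoi i (hij.trans_lt hj)
    have hlk : l ≤ k := by
      have : (Ordinal.ToType.mk.symm l : Set.Iio γ) ≤ Ordinal.ToType.mk.symm k := hij
      simpa using this
    rw [hS, hS]
    have hr : (of l).toHom.range ≤ (of k).toHom.range := by
      rintro _ ⟨x, rfl⟩
      exact ⟨f l k hlk x, hof l k hlk x⟩
    refine (isEmb_inclusion_iff hr).1 ?_
    exact (hf l k hlk).of_equiv (of l).equivRange (of k).equivRange fun x =>
      Subtype.ext (hof l k hlk x).symm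
  have hchain := K.chain D γ S ⊤ hγ (fun i hi => (hSmono i i le_rfl hi).mem_left) hSmono
    (by
      intro i hi hl
      ext z
      simp only [SetLike.mem_coe, Set.mem_iUnion, exists_prop, Set.mem_Iio]
      rw [hSι i hi, hcont i hi hl]
      simp only [Set.mem_iUnion, exists_prop, Set.mem_Iio]
      exact exists_congr fun j => and_congr_right fun hj => (hSι j (lt_trans hj hi) z).symm)
    (by
      ext z
      simp only [Substructure.coe_top, Set.mem_univ, true_iff, Set.mem_iUnion, exists_prop,
        Set.mem_Iio]
      exact ⟨o (q z), ho _, by rw [SetLike.mem_coe, hS]; exact ⟨r z, hqr z⟩⟩)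
  have hmem : K.Mem D := K.mem_of_equiv _ _ Substructure.topEquiv hchain.1
  have hDS : ∀ i < γ, K.Strong D (S i) := fun i hi =>
    Le.strong ⟨le_top, hchain.2.1 i hi⟩ (K.refl D hmem)
  refine ⟨⟨D, ι, hιinj⟩, hmem, ?_, ?_⟩
  · intro i hi
    have h1 := hDS i hi
    obtain ⟨k, rfl⟩ := hoi i hi
    rw [hS] at h1
    exact ⟨of k, h1, fun x => hι k x⟩
  · ext x
    simp only [Set.mem_iUnion, exists_prop, Set.mem_Iio]
    constructor
    · rintro ⟨z, rfl⟩
      exact ⟨o (q z), ho _, r z, rfl⟩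
    · rintro ⟨i, hi, y, rfl⟩
      obtain ⟨k, rfl⟩ := hoi i hi
      exact ⟨of k y, hι k y⟩

theorem inK_of_range_eq (hμ : ℵ₀ ≤ μ) {γ : Ordinal.{u}} (hγ : γ < (Order.succ μ).ord)
    (h0 : 0 < γ)
    {P : Ordinal.{u} → PartialModel L X} (hP : ∀ i < γ, K.InK μ (P i).carrier)
    {Q : PartialModel L X} (hQ : K.Mem Q.carrier)
    (h : Set.range Q.ι = ⋃ i ∈ Set.Iio γ, Set.range (P i).ι) : K.InK μ Q.carrier := by
  refine ⟨hQ, ?_⟩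
  have hr : ∀ P : PartialModel L X, #P.carrier = #(Set.range P.ι) := fun P =>
    (mk_range_eq P.ι P.inj).symm
  rw [hr]
  refine le_antisymm ?_ ?_
  · rw [h]
    exact mk_biUnion_Iio_le hμ hγ _ fun i hi => by rw [← hr, (hP i hi).2]
  · rw [← (hP 0 h0).2, hr]
    refine mk_le_mk_of_subset ?_
    rw [h]
    exact Set.subset_biUnion_of_mem (u := fun i => Set.range (P i).ι) (show 0 ∈ Set.Iio γ from h0)

/-- Only `μ` labels are in use, so enough fresh ones remain for the new elements of `B`. -/
theorem exists_extend (hμ : ℵ₀ ≤ μ) (hX : μ < #X) (P : PartialModel L X)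
    (hP : #P.carrier = μ) {B : Type u} [L.Structure B] (f : P.carrier ↪[L] B) (hB : #B = μ) :
    ∃ ι : B → X, Function.Injective ι ∧ ∀ x, ι (f x) = P.ι x := by
  classical
  have : Infinite X := infinite_iff.2 (hμ.trans hX.le)
  have hr : #(Set.range P.ι) = μ := by rw [mk_range_eq P.ι P.inj, hP]
  have hc : #B ≤ #((Set.range P.ι)ᶜ : Set X) := by
    rw [mk_compl_of_infinite _ (by rwa [hr]), hB]
    exact hX.le
  obtain ⟨k⟩ : Nonempty (B ↪ ((Set.range P.ι)ᶜ : Set X)) := hc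
  let ι : B → X := fun b => if h : ∃ x, f x = b then P.ι h.choose else k b
  have h1 : ∀ x, ι (f x) = P.ι x := by
    intro x
    have h : ∃ y, f y = f x := ⟨x, rfl⟩
    change (if h : ∃ y, f y = f x then P.ι h.choose else _) = _
    rw [dif_pos h, f.injective h.choose_spec]
  have h2 : ∀ b, (¬ ∃ x, f x = b) → ι b = k b := fun b hb => dif_neg hb
  refine ⟨ι, ?_, h1⟩
  intro a b hab
  by_cases ha : ∃ x, f x = a <;> by_cases hb : ∃ x, f x = b
  · obtain ⟨x, rfl⟩ := ha
    obtain ⟨y, rfl⟩ := hb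
    rw [h1, h1] at hab
    rw [P.inj hab]
  · obtain ⟨x, rfl⟩ := ha
    rw [h1, h2 b hb] at hab
    exact absurd ⟨x, hab⟩ (k b).2
  · obtain ⟨x, rfl⟩ := hb
    rw [h1, h2 a ha] at hab
    exact absurd ⟨x, hab.symm⟩ (k a).2
  · rw [h2 a ha, h2 b hb] at hab
    exact k.injective (Subtype.ext hab)

end PartialModel

/-- A continuous chain of embeddings of the members of a chain glues to an embedding of its
union. The embeddings are given by a function `h` on the ambient structure. -/
theorem exists_glue {V Q : Type u} [L.Structure V] [L.Structure Q] {X : Type u} {γ : Ordinal.{u}}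
    (hγ : Order.IsSuccLimit γ) {S : Ordinal.{u} → L.Substructure V} {T : L.Substructure V}
    (hmono : ∀ i j, i ≤ j → j < γ → K.Le (S i) (S j))
    (hcont : ∀ i < γ, Order.IsSuccLimit i → (S i : Set V) = ⋃ j ∈ Set.Iio i, (S j : Set V))
    (hT : (T : Set V) = ⋃ i ∈ Set.Iio γ, (S i : Set V)) {ι : Q → X}
    (hι : Function.Injective ι) (h : V → X)
    (hφ : ∀ i < γ, ∃ φ : S i ↪[L] Q, K.IsEmb φ ∧ ∀ x, ι (φ x) = h x) :
    ∃ φ : T ↪[L] Q, K.IsEmb φ ∧ ∀ x, ι (φ x) = h x := by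
  choose φ hφe hφx using hφ
  have hmem : ∀ x : V, x ∈ T ↔ ∃ i < γ, x ∈ S i := by
    intro x
    rw [← SetLike.mem_coe, hT]
    simp
  have hfin : ∀ {n : ℕ} (x : Fin n → T), ∃ i < γ, ∀ k, (x k : V) ∈ S i := by
    intro n x
    choose i hi hx using fun k => (hmem (x k)).1 (x k).2
    refine ⟨Finset.univ.sup i, (Finset.sup_lt_iff hγ.bot_lt).2 fun k _ => hi k, fun k => ?_⟩
    exact (hmono _ _ (Finset.le_sup (Finset.mem_univ k))
      ((Finset.sup_lt_iff hγ.bot_lt).2 fun k _ => hi k)).1 (hx k)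
  choose d hd hdx using fun x : T => (hmem x).1 x.2
  let g : T → Q := fun x => φ (d x) (hd x) ⟨x, hdx x⟩
  have hg : ∀ x, ι (g x) = h x := fun x => hφx (d x) (hd x) ⟨x, hdx x⟩
  have hgi : ∀ i (hi : i < γ) (x : T) (hx : (x : V) ∈ S i), g x = φ i hi ⟨x, hx⟩ := by
    intro i hi x hx
    apply hι
    rw [hg, hφx i hi]
  have hinj : Function.Injective g := by
    intro x y hxy
    have hm := max_lt (hd x) (hd y)
    have h1 := (hmono _ _ (le_max_left (d x) (d y)) hm).1 (hdx x)
    have h2 := (hmono _ _ (le_max_right (d x) (d y)) hm).1 (hdx y)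
    rw [hgi _ hm x h1, hgi _ hm y h2] at hxy
    have h3 := (φ _ _).injective hxy
    exact Subtype.ext (congrArg (fun z : S (max (d x) (d y)) => (z : V)) h3)
  have hle : ∀ i < γ, S i ≤ T := fun i hi x hx => (hmem x).2 ⟨i, hi, hx⟩
  let ψ : T ↪[L] Q :=
    { toFun := g
      inj' := hinj
      map_fun' := by
        intro n F x
        obtain ⟨i, hi, hx⟩ := hfin x
        have h1 := (φ i hi).map_fun F (fun k => ⟨x k, hx k⟩)
        have h2 : ((Structure.funMap F x : T) : V) ∈ S i := by
          have := (Structure.funMap F (fun k => (⟨x k, hx k⟩ : S i))).2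
          exact this
        rw [hgi i hi _ h2]
        refine Eq.trans ?_ (h1.trans ?_)
        · rfl
        · congr 1
          funext k
          exact (hgi i hi (x k) (hx k)).symm
      map_rel' := by
        intro n R x
        obtain ⟨i, hi, hx⟩ := hfin x
        have h1 := (φ i hi).map_rel R (fun k => ⟨x k, hx k⟩)
        have h2 : g ∘ x = φ i hi ∘ fun k => (⟨x k, hx k⟩ : S i) := by
          funext k
          exact hgi i hi (x k) (hx k)
        rw [h2]
        exact h1 }
  refine ⟨ψ, ?_, hg⟩
  have hψ : ∀ i (hi : i < γ) (x : S i), ψ ⟨x, hle i hi x.2⟩ = φ i hi x := fun i hi x =>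
    hgi i hi ⟨x, hle i hi x.2⟩ x.2
  -- The images form a continuous chain of strong submodels of `Q`; the last clause of the chain
  -- axiom makes their union, the range of `ψ`, strong in `Q`.
  let R : Ordinal.{u} → L.Substructure Q := fun i => ((S i).within T).map ψ.toHom
  have hRφ : ∀ i (hi : i < γ), R i = (φ i hi).toHom.range := by
    intro i hi
    ext z
    constructor
    · rintro ⟨x, hx, rfl⟩
      exact ⟨⟨x, hx⟩, (hψ i hi ⟨x, hx⟩).symm⟩
    · rintro ⟨x, rfl⟩
      exact ⟨⟨x, hle i hi x.2⟩, x.2, hψ i hi x⟩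
  have hR : ∀ i j, i ≤ j → j < γ → K.Le (R i) (R j) := by
    intro i j hij hj
    have hS := hmono i j hij hj
    have hcomm : ∀ x, φ j hj (Substructure.inclusion hS.1 x) = φ i (hij.trans_lt hj) x := fun x => by
      rw [← hψ i (hij.trans_lt hj), ← hψ j hj]
      rfl
    rw [hRφ i (hij.trans_lt hj), hRφ j hj]
    have hr : (φ i (hij.trans_lt hj)).toHom.range ≤ (φ j hj).toHom.range := by
      rintro _ ⟨x, rfl⟩
      exact ⟨_, hcomm x⟩
    refine (isEmb_inclusion_iff hr).1 ?_
    exact (isEmb_inclusion hS).of_equiv (φ i _).equivRange (φ j hj).equivRange fun x =>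
      Subtype.ext (hcomm x).symm
  refine (K.chain Q γ R ψ.toHom.range hγ (fun i hi => (hR i i le_rfl hi).mem_left) hR ?_ ?_).2.2
    fun i hi => (hRφ i hi).symm ▸ hφe i hi
  · intro i hi hl
    ext z
    simp only [SetLike.mem_coe, Set.mem_iUnion, exists_prop, Set.mem_Iio]
    constructor
    · rintro ⟨x, hx, rfl⟩
      have hx : (x : V) ∈ (S i : Set V) := hx
      rw [hcont i hi hl] at hx
      simp only [Set.mem_iUnion, exists_prop, Set.mem_Iio] at hx
      obtain ⟨j, hj, hx⟩ := hx
      exact ⟨j, hj, x, hx, rfl⟩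
    · rintro ⟨j, hj, hz⟩
      exact (hR j i (le_of_lt hj) hi).1 hz
  · ext z
    simp only [SetLike.mem_coe, Set.mem_iUnion, exists_prop, Set.mem_Iio]
    constructor
    · rintro ⟨x, rfl⟩
      exact ⟨d x, hd x, x, hdx x, rfl⟩
    · rintro ⟨j, hj, x, -, rfl⟩
      exact ⟨x, rfl⟩

/-! ### Types represented by elements of extensions -/

section GaloisTypes

variable {A B N N' : Type u} [L.Structure A] [L.Structure B] [L.Structure N] [L.Structure N']

/-- The Galois type over `A` of an element `a` of a model `N ∈ K_μ` into which `A` is embedded. -/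
def gtp (hN : K.InK μ N) {e : A ↪[L] N} (he : K.IsEmb e) (a : N) : K.GaS μ A :=
  Quot.mk _ { carrier := N, inK := hN, emb := e, isEmb := he, elt := a }

theorem exists_eq_gtp (p : K.GaS μ A) : ∃ (N : Type u) (_ : L.Structure N) (hN : K.InK μ N)
    (e : A ↪[L] N) (he : K.IsEmb e) (a : N), p = gtp hN he a := by
  induction p using Quot.ind with
  | mk t => exact ⟨t.carrier, t.str, t.inK, t.emb, t.isEmb, t.elt, rfl⟩

theorem gtp_eq_iff (hAP : K.Amalgamation μ) (hN : K.InK μ N) (hN' : K.InK μ N') {e : A ↪[L] N}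
    {e' : A ↪[L] N'} (he : K.IsEmb e) (he' : K.IsEmb e') (a : N) (a' : N') :
    gtp hN he a = gtp hN' he' a' ↔ ∃ (P : Type u) (_ : L.Structure P) (f : N ↪[L] P)
      (g : N' ↪[L] P), K.InK μ P ∧ K.IsEmb f ∧ K.IsEmb g ∧ (∀ x : A, f (e x) = g (e' x)) ∧
        f a = g a' :=
  GaS.mk_eq_mk_iff hAP

theorem gtp_eq_of_comp (hN : K.InK μ N) (hN' : K.InK μ N') {e : A ↪[L] N} {e' : A ↪[L] N'}
    (he : K.IsEmb e) (he' : K.IsEmb e') {k : N ↪[L] N'} (hk : K.IsEmb k)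
    (h : ∀ x, k (e x) = e' x) {a : N} {a' : N'} (ha : k a = a') :
    gtp hN he a = gtp hN' he' a' :=
  Quot.sound ⟨N', inferInstance, k, Embedding.refl L _, hN', hk, isEmb_refl hN'.1, h, ha⟩

theorem pull_gtp (hN : K.InK μ N) {e : A ↪[L] N} (he : K.IsEmb e) (a : N) {f : B ↪[L] A}
    (hf : K.IsEmb f) : (gtp hN he a).pull f hf = gtp hN (he.comp hf) a :=
  rfl

/-- Every type over `A` is realized in `B`, where `A` is embedded into `B ∈ K_μ` by `f`. -/
def RealizesAll (K : AEC L) (μ : Cardinal.{u}) (f : A ↪[L] B) : Prop :=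
  ∃ (hB : K.InK μ B) (hf : K.IsEmb f), ∀ p : K.GaS μ A, ∃ c, p = gtp hB hf c

theorem exists_enumeration_types (hμ : ℵ₀ ≤ μ) (hStable : K.Stable μ) (hA : K.InK μ A) :
    ∃ p : Ordinal.{u} → K.GaS μ A, ∀ q, ∃ i < μ.ord, p i = q := by
  have h := hStable A hA
  have h1 : lift.{u + 1} μ = #(Set.Iio μ.ord) := by rw [mk_Iio_ordinal, card_ord]
  rw [h1] at h
  obtain ⟨j⟩ : Nonempty (K.GaS μ A ↪ Set.Iio μ.ord) := h
  have : Nonempty A := by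
    rw [← mk_ne_zero_iff, hA.2]
    exact (aleph0_pos.trans_le hμ).ne'
  have : Nonempty (K.GaS μ A) :=
    ⟨gtp hA (isEmb_refl hA.1) (Classical.arbitrary A)⟩
  let p : Ordinal.{u} → K.GaS μ A := Function.invFun fun q => (j q : Ordinal.{u})
  have hj : Function.Injective fun q => (j q : Ordinal.{u}) :=
    Subtype.val_injective.comp j.injective
  exact ⟨p, fun q => ⟨j q, (j q).2, Function.leftInverse_invFun hj q⟩⟩

end GaloisTypes

/-! ### Continuous chains, universal extensions and the monster model -/

namespace PartialModel

variable {X : Type u}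

theorem exists_chain (hμ : ℵ₀ ≤ μ) {θ : Ordinal.{u}} (hθ : θ ≤ (Order.succ μ).ord)
    {P₀ : PartialModel L X} (h₀ : K.InK μ P₀.carrier)
    (Φ : Ordinal.{u} → PartialModel L X → PartialModel L X → Prop)
    (step : ∀ i P, K.InK μ P.carrier → P₀.Le K P → ∃ Q : PartialModel L X,
      K.InK μ Q.carrier ∧ P.Le K Q ∧ Φ i P Q) :
    ∃ P : Ordinal.{u} → PartialModel L X, (0 < θ → P 0 = P₀) ∧
      (∀ i < θ, K.InK μ (P i).carrier) ∧ (∀ i j, i ≤ j → j < θ → (P i).Le K (P j)) ∧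
      (∀ i < θ, Order.IsSuccLimit i →
        Set.range (P i).ι = ⋃ j ∈ Set.Iio i, Set.range (P j).ι) ∧
      ∀ i, i + 1 < θ → Φ i (P i) (P (i + 1)) := by
  have : Nonempty (PartialModel L X) := ⟨P₀⟩
  -- The clauses cover all stages, stage zero, successors and limits in turn.
  let Good : Ordinal.{u} → (Ordinal.{u} → PartialModel L X) → PartialModel L X → Prop :=
    fun i f Q => K.InK μ Q.carrier ∧ (∀ j < i, (f j).Le K Q) ∧ (i = 0 → Q = P₀) ∧
      (∀ j < i, i = j + 1 → Φ j (f j) Q) ∧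
      (Order.IsSuccLimit i → Set.range Q.ι = ⋃ j ∈ Set.Iio i, Set.range (f j).ι)
  have key : ∃ f : Ordinal.{u} → PartialModel L X, ∀ i < θ, Good i f (f i) := by
    refine Ordinal.exists_seq Good ?_ θ ?_
    · rintro i f g x hfg ⟨h1, h2, h3, h4, h5⟩
      refine ⟨h1, fun j hj => hfg j hj ▸ h2 j hj, h3, fun j hj hij => hfg j hj ▸ h4 j hj hij,
        fun hi => ?_⟩
      rw [h5 hi]
      exact Set.iUnion₂_congr fun j hj => by rw [hfg j hj]
    · intro i hi f hf
      have hle : ∀ j k, j ≤ k → k < i → (f j).Le K (f k) := by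
        intro j k hjk hk
        rcases hjk.eq_or_lt with rfl | hlt
        · exact Le.refl (hf j hk).1.1
        · exact (hf k hk).2.1 j hlt
      rcases Ordinal.zero_or_succ_or_isSuccLimit i with rfl | ⟨j, rfl⟩ | hl
      · exact ⟨P₀, h₀, fun j hj => absurd hj (not_lt_bot), fun _ => rfl,
          fun j hj => absurd hj (not_lt_bot), fun hl => absurd rfl hl.ne_bot⟩
      · have hj : j < Order.succ j := Order.lt_succ j
        have h0 : P₀.Le K (f j) := by
          rw [← (hf 0 (lt_of_le_of_lt bot_le hj)).2.2.1 rfl]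
          exact hle 0 j bot_le hj
        obtain ⟨Q, hQ, hPQ, hΦ⟩ := step j (f j) (hf j hj).1 h0
        refine ⟨Q, hQ, fun k hk => (hle k j (Order.lt_succ_iff.1 hk) hj).trans hPQ,
          fun h => absurd h (Order.bot_lt_succ j).ne', fun k hk hjk => ?_,
          fun hl => absurd hl (Order.not_isSuccLimit_succ j)⟩
        have : j = k := Order.succ_injective hjk
        rwa [← this]
      · obtain ⟨Q, hQ, hle', hr⟩ := exists_union hl f hle fun j hj => (hf j hj).2.2.2.2
        have hi' : i < (Order.succ μ).ord := hi.trans_le hθ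
        exact ⟨Q, inK_of_range_eq hμ hi' hl.bot_lt (fun j hj => (hf j hj).1) hQ hr, hle',
          fun h => absurd h hl.ne_bot, fun k hk hik => absurd (hik ▸ hl : Order.IsSuccLimit (k + 1))
            (Order.not_isSuccLimit_succ k), fun _ => hr⟩
  obtain ⟨P, hP⟩ := key
  refine ⟨P, fun h => (hP 0 h).2.2.1 rfl, fun i hi => (hP i hi).1, fun i j hij hj => ?_,
    fun i hi => (hP i hi).2.2.2.2, fun i hi => (hP _ hi).2.2.2.1 i (Order.lt_succ i) rfl⟩
  rcases hij.eq_or_lt with rfl | hlt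
  · exact Le.refl (hP i hj).1.1
  · exact (hP j hj).2.1 i hlt

/-- A substructure of the carrier of `Q`, with the same points as `P`. -/
theorem Le.exists_equiv {P Q : PartialModel L X} (h : P.Le K Q) :
    ∃ (S : L.Substructure Q.carrier) (e : P.carrier ≃[L] S), K.Strong Q.carrier S ∧
      (∀ x, Q.ι (e x) = P.ι x) ∧ ∀ z, z ∈ S ↔ Q.ι z ∈ Set.range P.ι := by
  obtain ⟨f, hf, hfx⟩ := h
  refine ⟨f.toHom.range, f.equivRange, hf, hfx, fun z => ?_⟩
  constructor
  · rintro ⟨x, rfl⟩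
    exact ⟨x, (hfx x).symm⟩
  · rintro ⟨x, hx⟩
    exact ⟨x, Q.inj ((hfx x).trans hx)⟩

end PartialModel

/-- The index set `μ⁺` on which the chains of models of size `μ` are built. -/
theorem lt_mk_out_succ (μ : Cardinal.{u}) : μ < #(Order.succ μ).out := by
  rw [mk_out]
  exact Order.lt_succ μ

theorem exists_injective_out_succ {A : Type u} (hA : #A = μ) :
    ∃ ι : A → (Order.succ μ).out, Function.Injective ι := by
  have : #A ≤ #(Order.succ μ).out := by
    rw [hA]
    exact (lt_mk_out_succ μ).le
  obtain ⟨k⟩ : Nonempty (A ↪ (Order.succ μ).out) := this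
  exact ⟨k, k.injective⟩

/-- By stability and amalgamation, every model in `K_μ` has an extension in `K_μ` which realizes
all types over it. -/
theorem exists_realizesAll (hμ : ℵ₀ ≤ μ) (hAP : K.Amalgamation μ) (hStable : K.Stable μ)
    {A : Type u} [L.Structure A] (hA : K.InK μ A) :
    ∃ (B : Type u) (_ : L.Structure B) (f : A ↪[L] B), RealizesAll K μ f := by
  obtain ⟨p, hp⟩ := exists_enumeration_types hμ hStable hA
  obtain ⟨ι₀, hι₀⟩ := exists_injective_out_succ hA.2
  let P₀ : PartialModel L (Order.succ μ).out := ⟨A, ι₀, hι₀⟩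
  have hl : Order.IsSuccLimit μ.ord := isSuccLimit_ord hμ
  obtain ⟨P, h0, hP, hle, hcont, hΦ⟩ := PartialModel.exists_chain (K := K) hμ
    (θ := μ.ord) (ord_lt_succ_ord μ).le (P₀ := P₀) hA
    (fun i _ Q => ∃ (hQ : K.InK μ Q.carrier) (e : A ↪[L] Q.carrier) (he : K.IsEmb e)
      (c : Q.carrier), (∀ x, Q.ι (e x) = ι₀ x) ∧ p i = gtp hQ he c) (by
    rintro i P hP ⟨e₀, he₀, he₀x⟩
    -- Stage `i` amalgamates, over `A`, the model built so far with one realizing the `i`-th type of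
    -- an enumeration of length `μ`.
    obtain ⟨N, _, hN, e, he, a, hpi⟩ := exists_eq_gtp (p i)
    obtain ⟨B, _, g₁, g₂, hB, hg₁, hg₂, h12⟩ := hAP A P.carrier N e₀ e hA hP hN he₀ he
    obtain ⟨ι, hι, hιx⟩ := PartialModel.exists_extend hμ (lt_mk_out_succ μ) P hP.2 g₁ hB.2
    refine ⟨⟨B, ι, hι⟩, hB, ⟨g₁, hg₁, hιx⟩, hB, g₁.comp e₀, hg₁.comp he₀, g₂ a, fun x => ?_, ?_⟩
    · exact (hιx _).trans (he₀x x)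
    · rw [hpi]
      exact gtp_eq_of_comp _ _ _ _ hg₂ (fun x => (h12 x).symm) rfl)
  obtain ⟨Q, hQ, hPQ, hr⟩ := PartialModel.exists_union hl P hle hcont
  have hQK := PartialModel.inK_of_range_eq hμ (ord_lt_succ_ord μ) hl.bot_lt hP hQ hr
  have h0' := h0 hl.bot_lt
  have h0Q := hPQ 0 hl.bot_lt
  rw [h0'] at h0Q
  obtain ⟨f, hf, hfx⟩ := h0Q
  refine ⟨Q.carrier, Q.str, f, hQK, hf, fun q => ?_⟩
  obtain ⟨i, hi, rfl⟩ := hp q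
  obtain ⟨hK, e, he, c, hex, hpi⟩ := hΦ i (by simpa using hl.succ_lt hi)
  obtain ⟨k, hk, hkx⟩ := hPQ (i + 1) (by simpa using hl.succ_lt hi)
  refine ⟨k c, ?_⟩
  rw [hpi]
  exact gtp_eq_of_comp _ _ _ _ hk (fun x => Q.inj (by rw [hkx, hex, hfx])) rfl

theorem RealizesAll.of_equiv {A B A' B' : Type u} [L.Structure A] [L.Structure B] [L.Structure A']
    [L.Structure B'] {f : A ↪[L] B} (h : RealizesAll K μ f) (eA : A ≃[L] A') (eB : B ≃[L] B')
    {f' : A' ↪[L] B'} (hf' : ∀ x, f' (eA x) = eB (f x)) : RealizesAll K μ f' := by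
  obtain ⟨hB, hf, hr⟩ := h
  have hfe' := hf.of_equiv eA eB hf'
  refine ⟨hB.of_equiv eB, hfe', fun p => ?_⟩
  obtain ⟨c, hc⟩ := hr (p.pull eA.toEmbedding (isEmb_equiv eA hfe'.mem_dom))
  refine ⟨eB c, GaS.pull_equiv_injective eA hfe'.mem_dom ?_⟩
  rw [hc, pull_gtp]
  exact gtp_eq_of_comp _ _ _ _ (isEmb_equiv eB (hB.of_equiv eB).1) (fun x => (hf' x).symm) rfl

/-- The union of a continuous chain of length `μ`, each member of which realizes all types over the
preceding one, is universal over the first member. -/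
theorem universalOver_of_realizesAll (hμ : ℵ₀ ≤ μ) (hAP : K.Amalgamation μ) {W : Type u}
    [L.Structure W] {T : Ordinal.{u} → L.Substructure W} (hT : ∀ j ≤ μ.ord, K.InK μ (T j))
    (hmono : ∀ i j, i ≤ j → j ≤ μ.ord → K.Le (T i) (T j))
    (hcont : ∀ j ≤ μ.ord, Order.IsSuccLimit j → (T j : Set W) = ⋃ i ∈ Set.Iio j, (T i : Set W))
    (hreal : ∀ j < μ.ord, ∀ h : T j ≤ T (j + 1), RealizesAll K μ (Substructure.inclusion h)) :
    K.UniversalOver μ (T μ.ord) (T 0) := by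
  classical
  refine ⟨hT 0 bot_le, hT _ le_rfl, hmono 0 _ bot_le le_rfl, ?_⟩
  intro N _ g hN hg
  obtain ⟨ι₀, hι₀⟩ := exists_injective_out_succ hN.2
  let X := (Order.succ μ).out
  let P₀ : PartialModel L X := ⟨N, ι₀, hι₀⟩
  obtain ⟨a, ha⟩ : ∃ a : Ordinal.{u} → N, ∀ n, ∃ i < μ.ord, a i = n := by
    have h1 : lift.{u + 1} #N = lift.{u} #(Set.Iio μ.ord) := by
      rw [mk_Iio_ordinal, card_ord, hN.2, Cardinal.lift_lift]
    obtain ⟨j⟩ := Cardinal.lift_mk_eq'.1 h1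
    have : Nonempty N := by
      rw [← mk_ne_zero_iff, hN.2]
      exact (aleph0_pos.trans_le hμ).ne'
    have hj : Function.Injective fun n => (j n : Ordinal.{u}) :=
      Subtype.val_injective.comp j.injective
    exact ⟨Function.invFun fun n => (j n : Ordinal.{u}),
      fun n => ⟨j n, (j n).2, Function.leftInverse_invFun hj n⟩⟩
  have : Nonempty X := ⟨ι₀ (a 0)⟩
  -- The maps `T j → Q j` are recorded as functions from `W` to the label set, so that the data of
  -- the recursion have the same type at every stage.
  let h₀ : W → X := fun y => if h : y ∈ T 0 then ι₀ (g ⟨y, h⟩) else Classical.arbitrary X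
  have hh₀ : ∀ y : T 0, h₀ y = ι₀ (g y) := fun y => dif_pos y.2
  -- Growing models containing `N` are built together with compatible embeddings of the `T j`, so
  -- that stage `i + 1` puts `a i` into the range. The recursion includes stage `μ`, where all of
  -- `N` has been covered.
  let Good : Ordinal.{u} → (Ordinal.{u} → PartialModel L X × (W → X)) →
      PartialModel L X × (W → X) → Prop := fun j f x =>
    K.InK μ x.1.carrier ∧ (∀ i < j, (f i).1.Le K x.1) ∧
    (∃ φ : T j ↪[L] x.1.carrier, K.IsEmb φ ∧ ∀ y, x.1.ι (φ y) = x.2 y) ∧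
    (∀ i < j, ∀ y ∈ T i, x.2 y = (f i).2 y) ∧ (j = 0 → x = (P₀, h₀)) ∧
    (∀ i < j, j = i + 1 → ∃ y ∈ T j, x.2 y = ι₀ (a i)) ∧
    (Order.IsSuccLimit j → Set.range x.1.ι = ⋃ i ∈ Set.Iio j, Set.range (f i).1.ι)
  have key : ∃ f : Ordinal.{u} → PartialModel L X × (W → X),
      ∀ i < Order.succ μ.ord, Good i f (f i) := by
    have : Nonempty (PartialModel L X × (W → X)) := ⟨(P₀, h₀)⟩
    refine Ordinal.exists_seq Good ?_ _ ?_
    · rintro i f g x hfg ⟨h1, h2, h3, h4, h5, h6, h7⟩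
      refine ⟨h1, fun j hj => hfg j hj ▸ h2 j hj, h3, fun j hj => hfg j hj ▸ h4 j hj, h5, h6,
        fun hi => ?_⟩
      rw [h7 hi]
      exact Set.iUnion₂_congr fun j hj => by rw [hfg j hj]
    · intro i hi f hf
      rw [Order.lt_succ_iff] at hi
      have hle : ∀ j k, j ≤ k → k < i → (f j).1.Le K (f k).1 := by
        intro j k hjk hk
        rcases hjk.eq_or_lt with rfl | hlt
        · exact PartialModel.Le.refl (hf j hk).1.1
        · exact (hf k hk).2.1 j hlt
      have hfy : ∀ j k, j ≤ k → k < i → ∀ y ∈ T j, (f k).2 y = (f j).2 y := by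
        intro j k hjk hk y hy
        rcases hjk.eq_or_lt with rfl | hlt
        · rfl
        · exact (hf k hk).2.2.2.1 j hlt y hy
      rcases Ordinal.zero_or_succ_or_isSuccLimit i with rfl | ⟨j, rfl⟩ | hl
      · exact ⟨(P₀, h₀), hN, fun j hj => absurd hj not_lt_bot, ⟨g, hg, fun y => (hh₀ y).symm⟩,
          fun j hj => absurd hj not_lt_bot, fun _ => rfl, fun j hj => absurd hj not_lt_bot,
          fun hl => absurd rfl hl.ne_bot⟩
      · have hj : j < Order.succ j := Order.lt_succ j
        have hjμ : j < μ.ord := hj.trans_le hi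
        obtain ⟨hK, -, ⟨φ, hφ, hφx⟩, -⟩ := hf j hj
        have h0 : P₀.Le K (f j).1 := by
          have h00 := (hf 0 (lt_of_le_of_lt bot_le hj)).2.2.2.2.1 rfl
          have := hle 0 j bot_le hj
          rwa [h00] at this
        obtain ⟨e, he, hex⟩ := h0
        have hTj := hmono j (j + 1) hj.le hi
        obtain ⟨hB, hf', hr⟩ := hreal j hjμ hTj.1
        -- The type of `a j` over the embedded copy of `T j` is realized by some `c` in `T (j + 1)`;
        -- the amalgam witnessing this identifies `c` with `a j`.
        obtain ⟨c, hc⟩ := hr (gtp hK hφ (e (a j)))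
        obtain ⟨Q, _, g₁, g₂, hQ, hg₁, hg₂, h12, hac⟩ := (gtp_eq_iff hAP _ _ _ _ _ _).1 hc
        obtain ⟨ι, hι, hιx⟩ :=
          PartialModel.exists_extend hμ (lt_mk_out_succ μ) (f j).1 hK.2 g₁ hQ.2
        let h : W → X := fun y => if h : y ∈ T (j + 1) then ι (g₂ ⟨y, h⟩) else Classical.arbitrary X
        have hh : ∀ y : T (j + 1), h y = ι (g₂ y) := fun y => dif_pos y.2
        refine ⟨(⟨Q, ι, hι⟩, h), hQ, fun k hk => ?_, ⟨g₂, hg₂, fun y => (hh y).symm⟩,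
          fun k hk y hy => ?_, fun h => absurd h (Order.bot_lt_succ j).ne', fun k hk hjk => ?_,
          fun hl => absurd hl (Order.not_isSuccLimit_succ j)⟩
        · exact (hle k j (Order.lt_succ_iff.1 hk) hj).trans ⟨g₁, hg₁, hιx⟩
        · have hkj := Order.lt_succ_iff.1 hk
          have hyj : y ∈ T j := (hmono k j hkj hjμ.le).1 hy
          refine (hh ⟨y, hTj.1 hyj⟩).trans ?_
          rw [← hfy k j hkj hj y hy]
          change ι (g₂ (Substructure.inclusion hTj.1 ⟨y, hyj⟩)) = _
          rw [← h12, hιx, hφx]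
        · have hjk' : j = k := Order.succ_injective hjk
          subst hjk'
          refine ⟨c, c.2, ?_⟩
          refine (hh c).trans ?_
          rw [← hac, hιx, hex]
      · obtain ⟨Q, hQ, hle', hr⟩ := PartialModel.exists_union hl (fun j => (f j).1) hle
          fun j hj => (hf j hj).2.2.2.2.2.2
        have hi' : i < (Order.succ μ).ord := hi.trans_lt (ord_lt_succ_ord μ)
        have hmem : ∀ y ∈ T i, ∃ j < i, y ∈ T j := by
          intro y hy
          have hy : y ∈ (T i : Set W) := hy
          rw [hcont i hi hl] at hy
          simpa using hy
        -- At a limit, `d y` is a stage at which `y` has already appeared; the recorded values agree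
        -- from there on.
        let d : W → Ordinal.{u} := fun y => if h : ∃ j < i, y ∈ T j then h.choose else 0
        have hd : ∀ y ∈ T i, d y < i ∧ y ∈ T (d y) := by
          intro y hy
          have h := hmem y hy
          have hdy : d y = h.choose := dif_pos h
          rw [hdy]
          exact h.choose_spec
        let h : W → X := fun y => (f (d y)).2 y
        have hh : ∀ j < i, ∀ y ∈ T j, h y = (f j).2 y := by
          intro j hj y hy
          obtain ⟨h1, h2⟩ := hd y ((hmono j i hj.le hi).1 hy)
          rcases le_total (d y) j with hle | hle
          · exact (hfy _ _ hle hj y h2).symm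
          · exact hfy _ _ hle h1 y hy
        refine ⟨(Q, h), PartialModel.inK_of_range_eq hμ hi' hl.bot_lt (fun j hj => (hf j hj).1) hQ
          hr, hle', ?_, hh, fun h => absurd h hl.ne_bot,
          fun k hk hik => absurd (hik ▸ hl : Order.IsSuccLimit (k + 1))
            (Order.not_isSuccLimit_succ k), fun _ => hr⟩
        refine exists_glue hl (fun j k hjk hk => hmono j k hjk (hk.le.trans hi))
          (fun j hj => hcont j (hj.le.trans hi)) (hcont i hi hl) Q.inj h fun j hj => ?_
        obtain ⟨φ, hφ, hφx⟩ := (hf j hj).2.2.1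
        obtain ⟨k, hk, hkx⟩ := hle' j hj
        exact ⟨k.comp φ, hk.comp hφ, fun y => ((hkx _).trans (hφx y)).trans (hh j hj y y.2).symm⟩
  obtain ⟨f, hf⟩ := key
  obtain ⟨-, hle, ⟨φ, hφ, hφx⟩, hagree, -⟩ := hf _ (Order.lt_succ μ.ord)
  have hpos : 0 < μ.ord := (isSuccLimit_ord hμ).bot_lt
  have h00 := (hf 0 (hpos.trans (Order.lt_succ _))).2.2.2.2.1 rfl
  have h0 := hle 0 hpos
  rw [h00] at h0
  obtain ⟨e, he, hex⟩ := h0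
  -- The copy of `N` lies inside the image of `T μ`, so inverting `φ` on it gives the required
  -- embedding of `N`.
  have hrange : ∀ n : N, ∃ y : T μ.ord, φ y = e n := by
    intro n
    obtain ⟨i, hi, rfl⟩ := ha n
    have hi1 : i + 1 < μ.ord := by simpa using (isSuccLimit_ord hμ).succ_lt hi
    obtain ⟨y, hy, hyx⟩ := (hf (i + 1) (hi1.trans (Order.lt_succ _))).2.2.2.2.2.1 i
      (Order.lt_succ i) rfl
    refine ⟨⟨y, (hmono _ _ hi1.le le_rfl).1 hy⟩, (f μ.ord).1.inj ?_⟩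
    rw [hφx, hex, hagree _ hi1 y hy, hyx]
  let k : N ↪[L] T μ.ord := φ.equivRange.symm.toEmbedding.comp
    (e.codRestrict φ.toHom.range fun n => hrange n)
  have hφk : ∀ n, φ (k n) = e n := by
    intro n
    have := φ.equivRange.apply_symm_apply (e.codRestrict φ.toHom.range (fun n => hrange n) n)
    exact congrArg Subtype.val this
  refine ⟨k, IsEmb.of_comp hφ ?_, fun x => ?_⟩
  · have : φ.comp k = e := Embedding.ext hφk
    rwa [this]
  · have h1 : k (g x) = ⟨x, (hmono 0 _ bot_le le_rfl).1 x.2⟩ := by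
      apply φ.injective
      apply (f μ.ord).1.inj
      rw [hφk, hex, hφx, hagree 0 hpos x x.2, h00]
      exact (hh₀ x).symm
    rw [h1]

/-- A model in which every model of size `μ` has universal extensions containing any given set of
size `μ`. -/
structure IsMonster (K : AEC L) (μ : Cardinal.{u}) (V : Type u) [L.Structure V] : Prop where
  mem : K.Mem V
  exists_universal : ∀ S : L.Substructure V, K.Strong V S → K.InK μ S → ∀ A : Set V, #A ≤ μ →
    ∃ T : L.Substructure V, K.Strong V T ∧ K.UniversalOver μ T S ∧ A ⊆ T

/-- In a chain of length `μ⁺` any `μ` elements appear at a single stage `γ`, and stage `γ + μ` is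
universal over stage `γ`, hence over every smaller model in `K_μ`. -/
theorem exists_isMonster (hμ : ℵ₀ ≤ μ) (hAP : K.Amalgamation μ) (hStable : K.Stable μ)
    {U : Type u} [L.Structure U] (hU : K.InK μ U) :
    ∃ (V : Type u) (_ : L.Structure V) (e : U ↪[L] V), K.IsEmb e ∧ IsMonster K μ V := by
  obtain ⟨ι₀, hι₀⟩ := exists_injective_out_succ hU.2
  let P₀ : PartialModel L (Order.succ μ).out := ⟨U, ι₀, hι₀⟩
  have hl := isSuccLimit_succ_ord hμ
  obtain ⟨P, h0, hP, hle, hcont, hΦ⟩ := PartialModel.exists_chain (K := K) hμ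
    le_rfl (P₀ := P₀) hU
    (fun _ P Q => ∃ f : P.carrier ↪[L] Q.carrier, RealizesAll K μ f ∧ ∀ x, Q.ι (f x) = P.ι x) (by
    intro i P hP _
    obtain ⟨B, _, f, hf⟩ := exists_realizesAll hμ hAP hStable hP
    obtain ⟨ι, hι, hιx⟩ := PartialModel.exists_extend hμ (lt_mk_out_succ μ) P hP.2 f hf.1.2
    exact ⟨⟨B, ι, hι⟩, hf.1, ⟨f, hf.2.1, hιx⟩, f, hf, hιx⟩)
  obtain ⟨Q, hQ, hPQ, hr⟩ := PartialModel.exists_union hl P hle hcont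
  have h0Q := hPQ 0 hl.bot_lt
  rw [h0 hl.bot_lt] at h0Q
  obtain ⟨e, he, -⟩ := h0Q
  let lam := (Order.succ μ).ord
  have hS : ∀ i, ∃ S : L.Substructure Q.carrier, i < lam → ∃ e : (P i).carrier ≃[L] S,
      K.Strong Q.carrier S ∧ (∀ x, Q.ι (e x) = (P i).ι x) ∧
      ∀ z, z ∈ S ↔ Q.ι z ∈ Set.range (P i).ι := by
    intro i
    by_cases hi : i < lam
    · obtain ⟨S, hS⟩ := (hPQ i hi).exists_equiv
      exact ⟨S, fun _ => hS⟩
    · exact ⟨⊤, fun h => absurd h hi⟩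
  choose S hS using hS
  choose ε hεs hεx hεm using hS
  have hmono : ∀ i j, i ≤ j → j < lam → K.Le (S i) (S j) := by
    intro i j hij hj
    refine le_of_strong (hεs i (hij.trans_lt hj)) (hεs j hj) fun z hz => ?_
    rw [hεm j hj]
    exact (hle i j hij hj).range_subset ((hεm i (hij.trans_lt hj) z).1 hz)
  have hSK : ∀ i < lam, K.InK μ (S i) := fun i hi => (hP i hi).of_equiv (ε i hi)
  have hScont : ∀ i < lam, Order.IsSuccLimit i →
      (S i : Set Q.carrier) = ⋃ j ∈ Set.Iio i, (S j : Set Q.carrier) := by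
    intro i hi hil
    ext z
    simp only [SetLike.mem_coe, Set.mem_iUnion, exists_prop, Set.mem_Iio]
    rw [hεm i hi, hcont i hi hil]
    simp only [Set.mem_iUnion, exists_prop, Set.mem_Iio]
    exact exists_congr fun j => and_congr_right fun hj => (hεm j (lt_trans hj hi) z).symm
  have hSreal : ∀ i, i + 1 < lam → ∀ h : S i ≤ S (i + 1),
      RealizesAll K μ (Substructure.inclusion h) := by
    intro i hi h
    obtain ⟨f, hf, hfx⟩ := hΦ i hi
    have hi' : i < lam := (Order.lt_succ i).trans hi
    refine hf.of_equiv (ε i hi') (ε (i + 1) hi) fun x => ?_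
    apply Subtype.ext
    apply Q.inj
    rw [hεx, hfx, ← hεx i hi']
    rfl
  refine ⟨Q.carrier, Q.str, e, he, hQ, ?_⟩
  intro R hR hRK A hA
  have hbound : ∃ γ < lam, ∀ z ∈ (R : Set Q.carrier) ∪ A, z ∈ S γ := by
    have hc : #((R : Set Q.carrier) ∪ A : Set Q.carrier) ≤ μ := by
      refine (mk_union_le _ _).trans ?_
      refine (add_le_add hRK.2.le hA).trans ?_
      rw [add_eq_self hμ]
    have hz : ∀ z : Q.carrier, ∃ i < lam, z ∈ S i := by
      intro z
      have : Q.ι z ∈ Set.range Q.ι := ⟨z, rfl⟩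
      rw [hr] at this
      simp only [Set.mem_iUnion, exists_prop, Set.mem_Iio] at this
      obtain ⟨i, hi, hz⟩ := this
      exact ⟨i, hi, (hεm i hi z).2 hz⟩
    choose d hd hdz using hz
    obtain ⟨γ, hγ, hγd⟩ := Ordinal.exists_lt_succ_ord_forall_lt hμ hc
      (fun z => d z) fun z => hd z
    exact ⟨γ, hγ, fun z hz => (hmono _ _ (hγd ⟨z, hz⟩).le hγ).1 (hdz z)⟩
  obtain ⟨γ, hγ, hz⟩ := hbound
  -- As an infinite initial ordinal, `μ⁺` is closed under addition.
  have hγμ : γ + μ.ord < lam := 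
    Ordinal.isPrincipal_add_ord (hμ.trans (Order.le_succ μ)) hγ (ord_lt_succ_ord μ)
  · have hlt : ∀ {j}, j ≤ μ.ord → γ + j < lam := fun hj =>
      (add_le_add_right hj γ).trans_lt hγμ
    have huniv := universalOver_of_realizesAll hμ hAP (T := fun j => S (γ + j))
      (fun j hj => hSK _ (hlt hj))
      (fun i j hij hj => hmono _ _ (add_le_add_right hij γ) (hlt hj))
      (fun j hj hjl => by
        rw [hScont _ (hlt hj) (Ordinal.isSuccLimit_add γ hjl)]
        ext z
        simp only [SetLike.mem_coe, Set.mem_iUnion, exists_prop, Set.mem_Iio]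
        constructor
        · rintro ⟨k, hk, hzk⟩
          obtain ⟨l, hl, hkl⟩ := (Ordinal.lt_add_iff hjl.ne_bot).1 hk
          exact ⟨l, hl, (hmono _ _ hkl (hlt (hl.le.trans hj))).1 hzk⟩
        · rintro ⟨l, hl, hzl⟩
          exact ⟨γ + l, by simpa using hl, hzl⟩)
      (fun j hj h => by
        have h1 : γ + (j + 1) = γ + j + 1 := (add_assoc _ _ _).symm
        have h2 : ∀ R, S (γ + j + 1) = R → ∀ h : S (γ + j) ≤ R,
            RealizesAll K μ (Substructure.inclusion h) := by
          rintro _ rfl h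
          refine hSreal (γ + j) ?_ h
          rw [← h1]
          exact hlt (Order.succ_le_of_lt hj)
        exact h2 _ (by rw [h1]) h)
    simp only [add_zero] at huniv
    refine ⟨S (γ + μ.ord), hεs _ hγμ, ?_, fun z hzA => ?_⟩
    · exact huniv.mono_right hAP (le_of_strong hR (hεs γ hγ) fun z hzR => hz z (Or.inl hzR)) hRK
    · exact (hmono _ _ le_self_add hγμ).1 (hz z (Or.inr hzA))

/-! ### Types and limit models inside the monster model -/

section Monster

variable {V : Type u} [L.Structure V]

/-- Model homogeneity: `V` contains a universal extension of the image of `A`, and `B` maps into it.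
-/
theorem IsMonster.exists_extend (hV : IsMonster K μ V) {A B : Type u} [L.Structure A]
    [L.Structure B] (hA : K.InK μ A) (hB : K.InK μ B) {e : A ↪[L] V} (he : K.IsEmb e)
    {g : A ↪[L] B} (hg : K.IsEmb g) :
    ∃ f : B ↪[L] V, K.IsEmb f ∧ ∀ x, f (g x) = e x := by
  obtain ⟨T, hT, hTu, -⟩ := hV.exists_universal e.toHom.range he (inK_range hA) ∅ (by simp)
  obtain ⟨f, hf, hfx⟩ := hTu.2.2.2 B (g.comp e.equivRange.symm.toEmbedding) hB
    (hg.comp (isEmb_equiv _ hA.1))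
  refine ⟨T.subtype.comp f, (isEmb_subtype hT).comp hf, fun x => ?_⟩
  have := hfx (e.equivRange x)
  change (f (g (e.equivRange.symm (e.equivRange x))) : V) = e x at this
  rwa [FirstOrder.Language.Equiv.symm_apply_apply] at this

theorem IsMonster.exists_le (hV : IsMonster K μ V) {S : L.Substructure V} (hS : K.Strong V S)
    (hSK : K.InK μ S) {A : Set V} (hA : #A ≤ μ) :
    ∃ T, K.Strong V T ∧ K.InK μ T ∧ S ≤ T ∧ A ⊆ T := by
  obtain ⟨T, hT, hTu, hAT⟩ := hV.exists_universal S hS hSK A hA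
  exact ⟨T, hT, hTu.2.1, hTu.2.2.1.1, hAT⟩

section Vtp

variable {A B N : Type u} [L.Structure A] [L.Structure B] [L.Structure N]

theorem IsMonster.exists_model_mem (hV : IsMonster K μ V) (hμ : ℵ₀ ≤ μ) {e : A ↪[L] V}
    (he : K.IsEmb e) (hA : K.InK μ A) (a : V) :
    ∃ D : L.Substructure V, K.Strong V D ∧ K.InK μ D ∧ (∀ x, e x ∈ D) ∧ a ∈ D := by
  obtain ⟨T, hT, hTK, hle, haT⟩ := hV.exists_le he (inK_range hA) (A := {a})
    (by simpa using one_le_aleph0.trans hμ)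
  exact ⟨T, hT, hTK, fun x => hle ⟨x, rfl⟩, haT rfl⟩

/-- The Galois type of an element `a` of the monster model over an embedded model `A ∈ K_μ`. -/
noncomputable def vtp (hV : IsMonster K μ V) (hμ : ℵ₀ ≤ μ) {e : A ↪[L] V} (he : K.IsEmb e)
    (hA : K.InK μ A) (a : V) : K.GaS μ A :=
  gtp (hV.exists_model_mem hμ he hA a).choose_spec.2.1
    (he.codRestrict (hV.exists_model_mem hμ he hA a).choose_spec.1
      (hV.exists_model_mem hμ he hA a).choose_spec.2.2.1)
    ⟨a, (hV.exists_model_mem hμ he hA a).choose_spec.2.2.2⟩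

/-- The type does not depend on the model in which it is computed, because two such models lie in a
common third one. This makes the arbitrary choice in `vtp` harmless. -/
theorem gtp_codRestrict_eq (hV : IsMonster K μ V) {e : A ↪[L] V} (he : K.IsEmb e)
    {D D' : L.Substructure V} (hD : K.Strong V D) (hD' : K.Strong V D') (hDK : K.InK μ D)
    (hDK' : K.InK μ D') (h : ∀ x, e x ∈ D) (h' : ∀ x, e x ∈ D') {a : V} (ha : a ∈ D)
    (ha' : a ∈ D') :
    gtp hDK (he.codRestrict hD h) ⟨a, ha⟩ = gtp hDK' (he.codRestrict hD' h') ⟨a, ha'⟩ := by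
  obtain ⟨T, hT, hTK, hle, hle'⟩ := hV.exists_le hD hDK hDK'.2.le
  have h1 := gtp_eq_of_comp hDK hTK (he.codRestrict hD h)
    (he.codRestrict hT fun x => hle (h x)) (isEmb_inclusion (le_of_strong hD hT hle))
    (fun x => rfl) (a := ⟨a, ha⟩) rfl
  have h2 := gtp_eq_of_comp hDK' hTK (he.codRestrict hD' h')
    (he.codRestrict hT fun x => hle (h x)) (isEmb_inclusion (le_of_strong hD' hT hle'))
    (fun x => rfl) (a := ⟨a, ha'⟩) rfl
  rw [h1, h2]
  rfl

theorem vtp_eq_gtp_codRestrict (hV : IsMonster K μ V) (hμ : ℵ₀ ≤ μ) {e : A ↪[L] V}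
    (he : K.IsEmb e) (hA : K.InK μ A) {D : L.Substructure V} (hD : K.Strong V D)
    (hDK : K.InK μ D) (h : ∀ x, e x ∈ D) {a : V} (ha : a ∈ D) :
    vtp hV hμ he hA a = gtp hDK (he.codRestrict hD h) ⟨a, ha⟩ :=
  gtp_codRestrict_eq hV he (hV.exists_model_mem hμ he hA a).choose_spec.1 hD
    (hV.exists_model_mem hμ he hA a).choose_spec.2.1 hDK
    (hV.exists_model_mem hμ he hA a).choose_spec.2.2.1 h
    (hV.exists_model_mem hμ he hA a).choose_spec.2.2.2 ha

theorem vtp_eq_gtp (hV : IsMonster K μ V) (hμ : ℵ₀ ≤ μ) {e : A ↪[L] V}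
    (he : K.IsEmb e) (hA : K.InK μ A) {k : N ↪[L] V} (hk : K.IsEmb k) (hN : K.InK μ N)
    {j : A ↪[L] N} (hj : K.IsEmb j) (h : ∀ x, k (j x) = e x) {n : N} {a : V} (ha : k n = a) :
    vtp hV hμ he hA a = gtp hN hj n := by
  subst ha
  rw [vtp_eq_gtp_codRestrict hV hμ he hA hk (inK_range hN) (fun x => ⟨j x, h x⟩)
    (show k n ∈ k.toHom.range from ⟨n, rfl⟩)]
  symm
  exact gtp_eq_of_comp hN (inK_range hN) hj (he.codRestrict hk _)
    (isEmb_equiv k.equivRange (inK_range hN).1) (fun x => Subtype.ext (h x)) rfl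

theorem pull_vtp (hV : IsMonster K μ V) (hμ : ℵ₀ ≤ μ) {e : A ↪[L] V}
    (he : K.IsEmb e) (hA : K.InK μ A) {f : B ↪[L] A} (hf : K.IsEmb f) (hB : K.InK μ B)
    {e' : B ↪[L] V} (he' : K.IsEmb e') (h : ∀ x, e (f x) = e' x) (a : V) :
    (vtp hV hμ he hA a).pull f hf = vtp hV hμ he' hB a := by
  obtain ⟨D, hD, hDK, hx, ha⟩ := hV.exists_model_mem hμ he hA a
  rw [vtp_eq_gtp_codRestrict hV hμ he hA hD hDK hx ha, pull_gtp]
  symm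
  exact vtp_eq_gtp hV hμ he' hB (isEmb_subtype hD) hDK _ (fun x => h x) rfl

/-- An equality of types is witnessed by an embedding into the monster model. -/
theorem exists_embedding_of_vtp_eq_gtp (hV : IsMonster K μ V) (hμ : ℵ₀ ≤ μ)
    (hAP : K.Amalgamation μ) {e : A ↪[L] V} {he : K.IsEmb e} {hA : K.InK μ A}
    {hN : K.InK μ N} {j : A ↪[L] N} {hj : K.IsEmb j} {n : N} {a : V}
    (h : vtp hV hμ he hA a = gtp hN hj n) :
    ∃ k : N ↪[L] V, K.IsEmb k ∧ (∀ x, k (j x) = e x) ∧ k n = a := by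
  obtain ⟨D, hD, hDK, hx, ha⟩ := hV.exists_model_mem hμ he hA a
  rw [vtp_eq_gtp_codRestrict hV hμ he hA hD hDK hx ha, gtp_eq_iff hAP] at h
  obtain ⟨P, _, f, g, hP, hf, hg, hfg, hac⟩ := h
  obtain ⟨k, hk, hkx⟩ := hV.exists_extend hDK hP (isEmb_subtype hD) hf
  refine ⟨k.comp g, hk.comp hg, fun x => ?_, ?_⟩
  · change k (g (j x)) = e x
    rw [← hfg, hkx]
    rfl
  · change k (g n) = a
    rw [← hac, hkx]
    rfl

end Vtp

/-- The type over a strong submodel `M ∈ K_μ` of the monster model. -/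
noncomputable abbrev mtp (hV : IsMonster K μ V) (hμ : ℵ₀ ≤ μ) {M : L.Substructure V}
    (hM : K.Strong V M) (hMK : K.InK μ M) (a : V) : K.GaS μ M :=
  vtp hV hμ (isEmb_subtype hM) hMK a

theorem res_mtp (hV : IsMonster K μ V) (hμ : ℵ₀ ≤ μ) {M M' : L.Substructure V}
    (hM : K.Strong V M) (hMK : K.InK μ M) (hM' : K.Strong V M') (hMK' : K.InK μ M')
    (h : K.Le M M') (a : V) : (mtp hV hμ hM' hMK' a).res h = mtp hV hμ hM hMK a :=
  pull_vtp hV hμ _ _ _ _ _ (fun _ => rfl) a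

/-- The extension property of non-splitting. -/
theorem exists_nonsplitting_extension (hV : IsMonster K μ V) (hμ : ℵ₀ ≤ μ)
    {N M M' : L.Substructure V} (hM : K.Strong V M) (hMK : K.InK μ M) (hM' : K.Strong V M')
    (hMK' : K.InK μ M') (hMM' : K.Le M M') (hN : K.UniversalOver μ M N) {a : V}
    (ha : ¬ (mtp hV hμ hM hMK a).Splits N) :
    ∃ a', mtp hV hμ hM hMK a' = mtp hV hμ hM hMK a ∧ ¬ (mtp hV hμ hM' hMK' a').Splits N ∧
      (a ∉ M → a' ∉ M') := by
  have hNM := hN.2.2.1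
  have hNM' := hNM.trans hMM'
  -- Universality folds `M'` back into `M` over `N` by `f`. The desired type is the pullback of
  -- `tp(a/M)` along `f`, realized by the image of `a` under a `k` with `k ∘ f` the identity on
  -- `M'`.
  obtain ⟨f, hf, hfx⟩ := hN.2.2.2 M' (Substructure.inclusion hNM'.1) hMK' (isEmb_inclusion hNM')
  obtain ⟨D, hD, hDK, hx, haD⟩ := hV.exists_model_mem hμ (isEmb_subtype hM) hMK a
  have hMD : K.Le M D := le_of_strong hM hD fun x hxM => hx ⟨x, hxM⟩
  obtain ⟨k, hk, hkx⟩ := hV.exists_extend hMK' hDK (isEmb_subtype hM')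
    ((isEmb_inclusion hMD).comp hf)
  have h1 : mtp hV hμ hM' hMK' (k ⟨a, haD⟩) = (mtp hV hμ hM hMK a).pull f hf := by
    have h2 : mtp hV hμ hM' hMK' (k ⟨a, haD⟩) = _ :=
      vtp_eq_gtp hV hμ _ _ hk hDK ((isEmb_inclusion hMD).comp hf) hkx rfl
    have h3 : mtp hV hμ hM hMK a = _ :=
      vtp_eq_gtp hV hμ _ _ (isEmb_subtype hD) hDK (isEmb_inclusion hMD) (fun _ => rfl)
        (n := ⟨a, haD⟩) rfl
    rw [h2, h3]
    rfl
  rw [GaS.not_splits_iff hNM] at ha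
  have hfN : ∀ x : N, f (Substructure.inclusion hNM'.1 x) = Substructure.inclusion hNM.1 x :=
    fun x => Subtype.ext (hfx x)
  refine ⟨k ⟨a, haD⟩, ?_, ?_, ?_⟩
  · rw [← res_mtp hV hμ hM hMK hM' hMK' hMM', h1]
    unfold GaS.res
    rw [GaS.pull_pull]
    -- The map `f` restricted to `M` and the identity both embed `M` into `M` over `N`, so
    -- non-splitting makes the two pullbacks equal.
    refine (ha M (Substructure.inclusion hNM.1) _ (Embedding.refl L M) _ (isEmb_refl hMK.1) hMK
      (isEmb_inclusion hNM) hfN fun _ => rfl).trans ?_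
    exact GaS.pull_refl _ _
  · rw [GaS.not_splits_iff hNM', h1]
    intro C _ g f₁ f₂ h₁ h₂ hC hg e₁ e₂
    rw [GaS.pull_pull, GaS.pull_pull]
    refine ha C g _ _ _ _ hC hg (fun x => ?_) fun x => ?_
    · change f (f₁ (g x)) = _
      rw [e₁, hfN]
    · change f (f₂ (g x)) = _
      rw [e₂, hfN]
  · intro haM hk'
    -- If the new element lay in `M'`, injectivity of `k` would make `a` a value of `f`, hence an
    -- element of `M`.
    have h2 := hkx ⟨_, hk'⟩
    have h3 := congrArg Subtype.val (k.injective h2)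
    change (f _ : V) = a at h3
    exact haM (h3 ▸ (f _).2)

theorem exists_coe_eq_biUnion {γ : Ordinal.{u}} (hγ : 0 < γ) {S : Ordinal.{u} → L.Substructure V}
    (hmono : ∀ i j, i ≤ j → j < γ → S i ≤ S j) :
    ∃ T : L.Substructure V, (T : Set V) = ⋃ i ∈ Set.Iio γ, (S i : Set V) := by
  have : Nonempty (Set.Iio γ) := ⟨⟨0, hγ⟩⟩
  have hdir : Directed (· ≤ ·) fun i : Set.Iio γ => S i := by
    intro i j
    rcases le_total i j with h | h
    · exact ⟨j, hmono _ _ h j.2, le_rfl⟩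
    · exact ⟨i, le_rfl, hmono _ _ h i.2⟩
  refine ⟨⨆ i : Set.Iio γ, S i, ?_⟩
  ext x
  simp only [SetLike.mem_coe, Set.mem_iUnion, exists_prop]
  rw [Substructure.mem_iSup_of_directed hdir]
  simp

theorem IsLimitOver.universalOver {θ : Ordinal.{u}} {M N : L.Substructure V}
    (h : K.IsLimitOver μ θ M N) (hμ : ℵ₀ ≤ μ) : K.UniversalOver μ M N := by
  obtain ⟨S, hS, rfl⟩ := h
  have h1 := hS.universal 0 hS.pos
  refine h1.mono_left (hS.le ?_) (hS.inK_union hμ)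
  simpa using hS.isLimit.succ_lt hS.pos

theorem IsLimitModel.inK {M : L.Substructure V} (h : K.IsLimitModel μ M) (hμ : ℵ₀ ≤ μ) :
    K.InK μ M := by
  obtain ⟨θ, N, S, hS, -⟩ := h
  exact hS.inK_union hμ

/-- Universal extensions are iterated `ω` times, with `A` absorbed at the first step. Length `ω`
suffices for all limit models constructed here, and its continuity condition is vacuous. -/
theorem exists_isLimitOver_omega0 (hV : IsMonster K μ V) (hμ : ℵ₀ ≤ μ) {S : L.Substructure V}
    (hS : K.Strong V S) (hSK : K.InK μ S) {A : Set V} (hA : #A ≤ μ) :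
    ∃ T : L.Substructure V, K.Strong V T ∧ K.IsLimitOver μ Ordinal.omega0 T S ∧ A ⊆ T := by
  choose next hnext hnextu hnextA using fun
    R : {R : L.Substructure V // K.Strong V R ∧ K.InK μ R} =>
    hV.exists_universal R R.2.1 R.2.2 A hA
  let R : ℕ → {R : L.Substructure V // K.Strong V R ∧ K.InK μ R} := fun n =>
    Nat.rec ⟨S, hS, hSK⟩ (fun _ r => ⟨next r, hnext r, (hnextu r).2.1⟩) n
  have hR : ∀ n, K.UniversalOver μ (R (n + 1)).1 (R n).1 := fun n =>
    hnextu (R n)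
  have hRm : Monotone fun n => (R n).1 :=
    monotone_nat_of_le_succ fun n => (hR n).2.2.1.1
  -- Only the values at finite ordinals matter.
  let Q : Ordinal.{u} → L.Substructure V := fun i => (R (Cardinal.toNat i.card)).1
  have hQn : ∀ n : ℕ, Q n = (R n).1 := fun n => by simp [Q]
  have hl : Order.IsSuccLimit Ordinal.omega0.{u} := Ordinal.isSuccLimit_omega0
  have hmono : ∀ i j, i ≤ j → j < Ordinal.omega0 → K.Le (Q i) (Q j) := by
    intro i j hij hj
    obtain ⟨n, rfl⟩ := Ordinal.lt_omega0.1 hj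
    obtain ⟨m, rfl⟩ := Ordinal.lt_omega0.1 (hij.trans_lt hj)
    rw [hQn, hQn]
    exact le_of_strong (R m).2.1 (R n).2.1 (hRm (by exact_mod_cast hij))
  have hcont : ∀ i < Ordinal.omega0, Order.IsSuccLimit i →
      (Q i : Set V) = ⋃ j ∈ Set.Iio i, (Q j : Set V) := by
    intro i hi hil
    exact absurd (Ordinal.omega0_le_of_isSuccLimit hil) (not_le.2 hi)
  obtain ⟨T, hT⟩ := exists_coe_eq_biUnion hl.bot_lt fun i j hij hj => (hmono i j hij hj).1
  refine ⟨T, (K.chain V _ Q T hl (fun i hi => (hmono i i le_rfl hi).mem_left) hmono hcont hT).2.2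
    fun i _ => (R _).2.1, ⟨Q, ⟨hl, ?_, fun i _ => (R _).2.2, hmono, hcont, ?_, hT⟩, ?_⟩, ?_⟩
  · rw [← ord_aleph0]
    exact (ord_le_ord.2 hμ).trans_lt (ord_lt_succ_ord μ)
  · intro i hi
    obtain ⟨n, rfl⟩ := Ordinal.lt_omega0.1 hi
    have h1 : (n : Ordinal.{u}) + 1 = ((n + 1 : ℕ) : Ordinal.{u}) := by push_cast; rfl
    rw [h1, hQn, hQn]
    exact hR n
  · have := hQn 0
    rw [Nat.cast_zero] at this
    exact this
  · intro x hx
    have h1 : x ∈ Q ((1 : ℕ) : Ordinal.{u}) := by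
      rw [hQn]
      exact hnextA _ hx
    have h2 : x ∈ (T : Set V) := by
      rw [hT]
      exact Set.mem_biUnion (show ((1 : ℕ) : Ordinal.{u}) ∈ Set.Iio Ordinal.omega0 from
        Ordinal.natCast_lt_omega0 1) h1
    exact h2

/-- Non-splitting of types computed in a model `U ∈ K_μ` embedded in the monster model. -/
theorem not_splits_tp_iff (hV : IsMonster K μ V) (hμ : ℵ₀ ≤ μ) {U : Type u} [L.Structure U]
    (hU : K.InK μ U) {e : U ↪[L] V} (he : K.IsEmb e) {M N : L.Substructure U}
    (hM : K.Strong U M) (hMe : K.Strong V (M.map e.toHom)) (hMK : K.InK μ (M.map e.toHom))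
    (hN : K.Le N M) (a : U) :
    ¬ (tp hU hM a).Splits N ↔ ¬ (mtp hV hμ hMe hMK (e a)).Splits (N.map e.toHom) := by
  rw [← GaS.not_splits_map_iff e hN hMK.1]
  have h : (mtp hV hμ hMe hMK (e a)).pull (e.substructureEquivMap M).toEmbedding
      (isEmb_equiv _ hMK.1) = tp hU hM a := by
    refine (pull_vtp hV hμ (f := (e.substructureEquivMap M).toEmbedding)
      (e' := e.comp M.subtype) _ _ _ ((inK_map_iff e).1 hMK) (he.comp (isEmb_subtype hM))
      (fun _ => rfl) _).trans ?_
    exact vtp_eq_gtp hV hμ _ _ he hU (isEmb_subtype hM) (fun _ => rfl) rfl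
  rw [h]

end Monster

end AEC

/-- A diagonal argument: a continuous increasing family of `μ⁺` sets of size `μ` has no
one-to-one choice function. -/
theorem Cardinal.false_of_injOn_of_continuous {μ : Cardinal.{u}} (hμ : ℵ₀ ≤ μ) {P : Type u}
    {C : Ordinal.{u} → Set P} (hC : ∀ ζ < (Order.succ μ).ord, #(C ζ) ≤ μ)
    (hmono : ∀ ζ ξ, ζ ≤ ξ → ξ < (Order.succ μ).ord → C ζ ⊆ C ξ)
    (hcont : ∀ ζ < (Order.succ μ).ord, Order.IsSuccLimit ζ → ∀ x ∈ C ζ, ∃ ξ < ζ, x ∈ C ξ)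
    (p : Ordinal.{u} → P) (hp : ∀ ζ < (Order.succ μ).ord, p ζ ∈ C ζ)
    (hinj : Set.InjOn p (Set.Iio (Order.succ μ).ord)) : False := by
  classical
  let lam := (Order.succ μ).ord
  have hlam : Order.IsSuccLimit lam := isSuccLimit_succ_ord hμ
  -- `s` inverts `p`. Closing off below `μ⁺` gives a limit `ζ` such that `s` maps each `C ξ` with `ξ
  -- < ζ` below `ζ`; but continuity puts `p ζ` in such a `C ξ`, although `s (p ζ) = ζ`.
  let s : P → Ordinal.{u} := fun x => if h : ∃ ζ < lam, p ζ = x then h.choose else 0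
  have hs : ∀ x, s x < lam := by
    intro x
    by_cases h : ∃ ζ < lam, p ζ = x
    · have : s x = h.choose := dif_pos h
      rw [this]
      exact h.choose_spec.1
    · have : s x = 0 := dif_neg h
      rw [this]
      exact hlam.bot_lt
  have hsp : ∀ ζ < lam, s (p ζ) = ζ := by
    intro ζ hζ
    have h : ∃ ξ < lam, p ξ = p ζ := ⟨ζ, hζ, rfl⟩
    have : s (p ζ) = h.choose := dif_pos h
    rw [this]
    exact hinj h.choose_spec.1 hζ h.choose_spec.2
  have hF : ∀ ξ : Set.Iio lam, ∃ γ : Set.Iio lam, ξ < γ ∧ ∀ x ∈ C ξ, s x < γ := by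
    intro ξ
    obtain ⟨γ, hγ, h⟩ := Ordinal.exists_lt_succ_ord_forall_lt hμ (hC ξ ξ.2) (fun x => s x)
      fun x => hs x
    exact ⟨⟨max γ (Order.succ ξ), max_lt hγ (hlam.succ_lt ξ.2)⟩,
      Subtype.mk_lt_mk.2 ((Order.lt_succ (ξ : Ordinal.{u})).trans_le (le_max_right _ _)),
      fun x hx => (h ⟨x, hx⟩).trans_le (le_max_left _ _)⟩
  choose F hF₁ hF₂ using hF
  let z : ℕ → Set.Iio lam := fun n => Nat.rec ⟨0, hlam.bot_lt⟩ (fun _ ξ => F ξ) n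
  have hz : ∀ n, z (n + 1) = F (z n) := fun n => rfl
  obtain ⟨γ, hγ, hzγ⟩ := Ordinal.exists_lt_succ_ord_forall_lt hμ (ι := ULift.{u} ℕ)
    (by simpa using hμ) (fun n => (z n.down).1) fun n => (z n.down).2
  let ζ : Ordinal.{u} := ⨆ n : ULift.{u} ℕ, (z n.down).1
  have hζ : ζ < lam := lt_of_le_of_lt (Ordinal.iSup_le fun n => (hzγ n).le) hγ
  have hzζ : ∀ n, (z n).1 < ζ := by
    intro n
    refine lt_of_lt_of_le (b := (z (n + 1)).1) ?_
      (Ordinal.le_iSup (fun n : ULift.{u} ℕ => (z n.down).1) ⟨n + 1⟩)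
    rw [hz]
    exact hF₁ (z n)
  have hlt : ∀ ξ < ζ, ∃ n, ξ < (z n).1 := by
    intro ξ hξ
    obtain ⟨n, hn⟩ := Ordinal.lt_iSup_iff.1 hξ
    exact ⟨n.down, hn⟩
  have hlim : Order.IsSuccLimit ζ := by
    rw [Order.isSuccLimit_iff, Order.isSuccPrelimit_iff_succ_lt]
    refine ⟨fun h => ?_, fun ξ hξ => ?_⟩
    · exact not_lt_bot (h.eq_bot ▸ hzζ 0)
    · obtain ⟨n, hn⟩ := hlt ξ hξ
      exact (Order.succ_le_of_lt hn).trans_lt (hzζ n)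
  obtain ⟨ξ, hξ, hx⟩ := hcont ζ hζ hlim _ (hp ζ hζ)
  obtain ⟨n, hn⟩ := hlt ξ hξ
  have h1 := hF₂ (z n) _ (hmono ξ _ hn.le (z n).2 hx)
  rw [hsp ζ hζ] at h1
  have h2 := hzζ (n + 1)
  rw [hz] at h2
  exact lt_asymm h1 h2

namespace AEC

variable {L : FirstOrder.Language.{u, u}} {K : AEC L} {μ : Cardinal.{u}}

/-! ### Thinning out chains with repetitions -/

section Dedup

variable {V : Type u} [L.Structure V]

/-- `S = T`, or `T` is universal over `S`. -/
def EqOrUniversal (K : AEC L) (μ : Cardinal.{u}) (S T : L.Substructure V) : Prop :=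
  K.Le S T ∧ (T ≠ S → K.UniversalOver μ T S)

/-- A continuous chain in which every member is equal to or universal over the preceding ones is
eventually constant or can be thinned out to a witness for its union being a limit model. -/
theorem exists_limitWitness_of_eqOrUniversal {γ : Ordinal.{u}}
    (hγ : Order.IsSuccLimit γ) (hγμ : γ < (Order.succ μ).ord) {S : Ordinal.{u} → L.Substructure V}
    (hSK : ∀ i < γ, K.InK μ (S i))
    (hS : ∀ i j, i ≤ j → j < γ → EqOrUniversal K μ (S i) (S j))
    (hcont : ∀ i < γ, Order.IsSuccLimit i → (S i : Set V) = ⋃ j ∈ Set.Iio i, (S j : Set V))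
    {M : L.Substructure V} (hM : (M : Set V) = ⋃ i ∈ Set.Iio γ, (S i : Set V))
    (hne : ∀ i < γ, ∃ j < γ, i < j ∧ S j ≠ S i) :
    ∃ (θ : Ordinal.{u}) (S' : Ordinal.{u} → L.Substructure V), K.LimitWitness μ θ M S' ∧
      S' 0 = S 0 ∧ ∀ i < θ, ∃ j < γ, S' i = S j := by
  classical
  -- A later index at which the chain has changed. The value `i + 1` from `γ` on keeps the iteration
  -- `d` strictly increasing, so that it eventually reaches `γ`.
  let nx : Ordinal.{u} → Ordinal.{u} := fun i => if h : i < γ then (hne i h).choose else i + 1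
  have hnx : ∀ i < γ, nx i < γ ∧ i < nx i ∧ S (nx i) ≠ S i := by
    intro i hi
    have : nx i = (hne i hi).choose := dif_pos hi
    rw [this]
    exact (hne i hi).choose_spec
  have hnx' : ∀ i, i < nx i := by
    intro i
    by_cases hi : i < γ
    · exact (hnx i hi).2.1
    · have : nx i = i + 1 := dif_neg hi
      rw [this]
      exact Order.lt_succ i
  let d : Ordinal.{u} → Ordinal.{u} := fun k =>
    Ordinal.limitRecOn k 0 (fun _ x => nx x) fun k _ ih => ⨆ j : Set.Iio k, ih j j.2
  have hd0 : d 0 = 0 := Ordinal.limitRecOn_zero _ _ _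
  have hds : ∀ k, d (k + 1) = nx (d k) := fun k => Ordinal.limitRecOn_add_one _ _ _ _
  have hdl : ∀ k, Order.IsSuccLimit k → d k = ⨆ j : Set.Iio k, d j := fun k hk =>
    Ordinal.limitRecOn_limit _ _ _ _ hk
  have hmono : StrictMono d := by
    suffices ∀ k, ∀ j < k, d j < d k from fun j k hjk => this k j hjk
    intro k
    induction k using WellFoundedLT.induction with
    | ind k ih =>
      intro j hj
      rcases Ordinal.zero_or_succ_or_isSuccLimit k with rfl | ⟨l, rfl⟩ | hl
      · exact absurd hj not_lt_bot
      · have h1 : d (Order.succ l) = nx (d l) := hds l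
        rw [h1]
        rcases (Order.lt_succ_iff.1 hj).eq_or_lt with rfl | hlt
        · exact hnx' _
        · exact (ih l (Order.lt_succ l) j hlt).trans (hnx' _)
      · have hj' := hl.succ_lt hj
        rw [hdl k hl]
        exact (ih _ hj' j (Order.lt_succ j)).trans_le
          (Ordinal.le_iSup (fun j : Set.Iio k => d j) ⟨_, hj'⟩)
  have hex : ∃ k, γ ≤ d k := ⟨γ, hmono.le_apply⟩
  -- The length of the thinned chain is the first stage at which `d` reaches `γ`; it is a limit
  -- because `nx` maps `γ` into itself.
  let θ := sInf {k | γ ≤ d k}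
  have hθ : γ ≤ d θ := csInf_mem (s := {k | γ ≤ d k}) hex
  have hlt : ∀ k < θ, d k < γ := fun k hk => not_le.1 fun h => notMem_of_lt_csInf' hk h
  have hθl : Order.IsSuccLimit θ := by
    rcases Ordinal.zero_or_succ_or_isSuccLimit θ with h | ⟨j, hj⟩ | h
    · rw [h, hd0] at hθ
      exact absurd hγ.bot_lt (not_lt.2 hθ)
    · have h1 := hlt j (hj ▸ Order.lt_succ j)
      have h2 := (hnx _ h1).1
      rw [← hds] at h2
      have h3 : j + 1 = θ := hj
      rw [h3] at h2
      exact absurd hθ (not_le.2 h2)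
    · exact h
  have hcof : ∀ k, Order.IsSuccLimit k → ∀ i < d k, ∃ j < k, i < d j := by
    intro k hk i hi
    rw [hdl k hk] at hi
    obtain ⟨j, hj⟩ := Ordinal.lt_iSup_iff.1 hi
    exact ⟨j, j.2, hj⟩
  have hle : ∀ i j, i ≤ j → j < γ → S i ≤ S j := fun i j hij hj => (hS i j hij hj).1.1
  have hdlim : ∀ k, Order.IsSuccLimit k → Order.IsSuccLimit (d k) := by
    intro k hk
    rw [Order.isSuccLimit_iff, Order.isSuccPrelimit_iff_succ_lt]
    refine ⟨fun h => ?_, fun ξ hξ => ?_⟩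
    · exact not_lt_bot (h.eq_bot ▸ hmono hk.bot_lt)
    · obtain ⟨j, hj, hξj⟩ := hcof k hk ξ hξ
      exact (Order.succ_le_of_lt hξj).trans_lt (hmono hj)
  refine ⟨θ, fun k => S (d k), ⟨hθl, ?_, fun i hi => hSK _ (hlt i hi),
    fun i j hij hj => (hS _ _ (hmono.monotone hij) (hlt j hj)).1, ?_, ?_, ?_⟩, by simp only [hd0],
    fun i hi => ⟨d i, hlt i hi, rfl⟩⟩
  · refine lt_of_le_of_lt (csInf_le' ?_) hγμ
    exact hmono.le_apply
  · intro k hk hkl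
    rw [hcont (d k) (hlt k hk) (hdlim k hkl)]
    ext x
    simp only [SetLike.mem_coe, Set.mem_iUnion, exists_prop, Set.mem_Iio]
    constructor
    · rintro ⟨i, hi, hx⟩
      obtain ⟨j, hj, hij⟩ := hcof k hkl i hi
      exact ⟨j, hj, hle _ _ hij.le (hlt j (hj.trans hk)) hx⟩
    · rintro ⟨j, hj, hx⟩
      exact ⟨d j, hmono hj, hx⟩
  · intro k hk
    have h := hnx _ (hlt k hk)
    simp only [hds]
    exact (hS _ _ h.2.1.le h.1).2 h.2.2
  · rw [hM]
    ext x
    simp only [SetLike.mem_coe, Set.mem_iUnion, exists_prop, Set.mem_Iio]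
    constructor
    · rintro ⟨i, hi, hx⟩
      obtain ⟨j, hj, hij⟩ := hcof θ hθl i (hi.trans_le hθ)
      exact ⟨j, hj, hle _ _ hij.le (hlt j hj) hx⟩
    · rintro ⟨j, hj, hx⟩
      exact ⟨d j, hlt j hj, hx⟩

end Dedup

/-- A tower in the monster model. -/
structure IsTower {V : Type u} [L.Structure V] (hV : IsMonster K μ V) (hμ : ℵ₀ ≤ μ)
    (α : Ordinal.{u}) (a : Ordinal.{u} → V) (N M : Ordinal.{u} → L.Substructure V) : Prop where
  strong : ∀ i < α, K.Strong V (M i)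
  mono : ∀ i j, i ≤ j → j < α → M i ≤ M j
  limit : ∀ i < α, K.IsLimitModel μ (M i)
  a_mem : ∀ i, i + 1 < α → a i ∈ M (i + 1)
  a_notMem : ∀ i, i + 1 < α → a i ∉ M i
  universal : ∀ i, i + 1 < α → K.UniversalOver μ (M i) (N i)
  nonsplit : ∀ (i : Ordinal.{u}) (_ : i + 1 < α) (hM : K.Strong V (M i)) (hMK : K.InK μ (M i)),
    ¬ (mtp hV hμ hM hMK (a i)).Splits (N i)

theorem exists_biUnion_eq_or {γ : Ordinal.{u}} {V : Type u} [L.Structure V]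
    {S : Ordinal.{u} → L.Substructure V}
    (hle : ∀ i j, i ≤ j → j < γ → S i ≤ S j) {M : L.Substructure V}
    (hM : (M : Set V) = ⋃ i ∈ Set.Iio γ, (S i : Set V)) (i : Ordinal.{u}) (hi : i < γ) :
    M = S i ∨ ∃ j < γ, i < j ∧ S j ≠ S i := by
  by_cases h : ∃ j < γ, i < j ∧ S j ≠ S i
  · exact Or.inr h
  · push Not at h
    refine Or.inl (SetLike.coe_injective ?_)
    rw [hM]
    refine Set.Subset.antisymm (Set.iUnion₂_subset fun j hj => ?_)
      (Set.subset_biUnion_of_mem (u := fun i => (S i : Set V)) (show i ∈ Set.Iio γ from hi))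
    rcases le_or_gt j i with hji | hij
    · exact hle j i hji hi
    · rw [h j hj hij]

/-! ### Unions of towers and reduced towers -/

section Union

variable {V : Type u} [L.Structure V] {hV : IsMonster K μ V} {hμ : ℵ₀ ≤ μ} {α : Ordinal.{u}}
  {a : Ordinal.{u} → V} {N : Ordinal.{u} → L.Substructure V}

/-- Unions of continuous chains of towers are towers. -/
theorem IsTower.union (hCont : K.ContinuousNonsplitting μ) {γ : Ordinal.{u}}
    (hγ : Order.IsSuccLimit γ) (hγμ : γ < (Order.succ μ).ord)
    {T : Ordinal.{u} → Ordinal.{u} → L.Substructure V}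
    (hT : ∀ ζ < γ, IsTower hV hμ α a N (T ζ))
    (hext : ∀ ζ ξ, ζ ≤ ξ → ξ < γ → ∀ i < α, EqOrUniversal K μ (T ζ i) (T ξ i))
    (hcont : ∀ ζ < γ, Order.IsSuccLimit ζ → ∀ i < α,
      (T ζ i : Set V) = ⋃ ξ ∈ Set.Iio ζ, (T ξ i : Set V))
    {M : Ordinal.{u} → L.Substructure V}
    (hM : ∀ i < α, (M i : Set V) = ⋃ ζ ∈ Set.Iio γ, (T ζ i : Set V)) :
    IsTower hV hμ α a N M ∧ ∀ ζ < γ, ∀ i < α, EqOrUniversal K μ (T ζ i) (M i) := by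
  have hmem : ∀ i < α, ∀ x, x ∈ M i ↔ ∃ ζ < γ, x ∈ T ζ i := by
    intro i hi x
    rw [← SetLike.mem_coe, hM i hi]
    simp
  have hTK : ∀ ζ < γ, ∀ i < α, K.InK μ (T ζ i) := fun ζ hζ i hi => ((hT ζ hζ).limit i hi).inK hμ
  have hle : ∀ i < α, ∀ ζ ξ, ζ ≤ ξ → ξ < γ → T ζ i ≤ T ξ i := fun i hi ζ ξ h hξ =>
    (hext ζ ξ h hξ i hi).1.1
  have hchain : ∀ i < α, _ := fun i hi => K.chain V γ (fun ζ => T ζ i) (M i) hγ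
    (fun ζ hζ => (hTK ζ hζ i hi).1) (fun ζ ξ h hξ => (hext ζ ξ h hξ i hi).1)
    (fun ζ hζ hl => hcont ζ hζ hl i hi) (hM i hi)
  have hstrong : ∀ i < α, K.Strong V (M i) := fun i hi =>
    (hchain i hi).2.2 fun ζ hζ => (hT ζ hζ).strong i hi
  have hTM : ∀ ζ < γ, ∀ i < α, K.Le (T ζ i) (M i) := fun ζ hζ i hi =>
    ⟨fun x hx => (hmem i hi x).2 ⟨ζ, hζ, hx⟩, (hchain i hi).2.1 ζ hζ⟩
  -- The order on towers lets a level stand still. Thus each level of the union either is already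
  -- attained or is a limit model witnessed by a subchain starting at `T 0 i`, and limit continuity
  -- of non-splitting applies in the second case.
  have halt : ∀ i < α, (∃ ζ < γ, M i = T ζ i) ∨ ∃ (θ : Ordinal.{u})
      (S' : Ordinal.{u} → L.Substructure V), K.LimitWitness μ θ (M i) S' ∧
      S' 0 = T 0 i ∧ ∀ k < θ, ∃ ζ < γ, S' k = T ζ i := by
    intro i hi
    by_cases h : ∃ ζ < γ, M i = T ζ i
    · exact Or.inl h
    · push Not at h
      exact Or.inr (exists_limitWitness_of_eqOrUniversal hγ hγμ (fun ζ hζ => hTK ζ hζ i hi)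
        (fun ζ ξ h hξ => hext ζ ξ h hξ i hi) (fun ζ hζ hl => hcont ζ hζ hl i hi) (hM i hi)
        fun ζ hζ => (exists_biUnion_eq_or (hle i hi) (hM i hi) ζ hζ).resolve_left (h ζ hζ))
  have hlimit : ∀ i < α, K.IsLimitModel μ (M i) := by
    intro i hi
    rcases halt i hi with ⟨ζ, hζ, h⟩ | ⟨θ, S', hS', -⟩
    · rw [h]
      exact (hT ζ hζ).limit i hi
    · exact ⟨θ, _, S', hS', rfl⟩
  have h0 : 0 < γ := hγ.bot_lt
  have hlt : ∀ {i : Ordinal.{u}}, i + 1 < α → i < α := fun h => (Order.lt_succ _).trans h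
  refine ⟨⟨hstrong, ?_, hlimit, ?_, ?_, ?_, ?_⟩, ?_⟩
  · intro i j hij hj x hx
    obtain ⟨ζ, hζ, hx⟩ := (hmem i (hij.trans_lt hj) x).1 hx
    exact (hmem j hj x).2 ⟨ζ, hζ, (hT ζ hζ).mono i j hij hj hx⟩
  · intro i hi
    exact (hmem _ hi _).2 ⟨0, h0, (hT 0 h0).a_mem i hi⟩
  · intro i hi hx
    obtain ⟨ζ, hζ, hx⟩ := (hmem i (hlt hi) _).1 hx
    exact (hT ζ hζ).a_notMem i hi hx
  · intro i hi
    exact ((hT 0 h0).universal i hi).mono_left (hTM 0 h0 i (hlt hi))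
      ((hlimit i (hlt hi)).inK hμ)
  · intro i hi hMi hMK
    rcases halt i (hlt hi) with ⟨ζ, hζ, h⟩ | ⟨θ, S', hS', hS0, hST⟩
    · have key : ∀ R, R = T ζ i → ∀ (hR : K.Strong V R) (hRK : K.InK μ R),
          ¬ (mtp hV hμ hR hRK (a i)).Splits (N i) := by
        rintro _ rfl hR hRK
        exact (hT ζ hζ).nonsplit i hi hR hRK
      exact key _ h hMi hMK
    · have hu := (hT 0 h0).universal i hi
      refine hCont V θ (M i) S' hS' _ (N i) hu.1 (hS0 ▸ hu.2.2.1) fun k hk => ?_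
      have hR := (hS'.le hk).strong hMi
      have hRK := hS'.inK k hk
      rw [res_mtp hV hμ hR hRK]
      obtain ⟨ζ, hζ, h⟩ := hST k hk
      have key : ∀ R, R = T ζ i → ∀ (hR : K.Strong V R) (hRK : K.InK μ R),
          ¬ (mtp hV hμ hR hRK (a i)).Splits (N i) := by
        rintro _ rfl hR hRK
        exact (hT ζ hζ).nonsplit i hi hR hRK
      exact key _ h hR hRK
  · intro ζ hζ i hi
    refine ⟨hTM ζ hζ i hi, fun hne => ?_⟩
    obtain ⟨ξ, hξ, hζξ, hne'⟩ :=
      (exists_biUnion_eq_or (hle i hi) (hM i hi) ζ hζ).resolve_left hne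
    exact ((hext ζ ξ hζξ.le hξ i hi).2 hne').mono_left (hTM ξ hξ i hi) ((hlimit i hi).inK hμ)

theorem EqOrUniversal.refl {S : L.Substructure V} (h : K.Mem S) : EqOrUniversal K μ S S :=
  ⟨Le.refl h, fun h => absurd rfl h⟩

theorem EqOrUniversal.trans {S T R : L.Substructure V} (h : EqOrUniversal K μ S T)
    (h' : EqOrUniversal K μ T R) (hRK : K.InK μ R) : EqOrUniversal K μ S R := by
  refine ⟨h.1.trans h'.1, fun hne => ?_⟩
  by_cases hT : T = S
  · subst hT
    exact h'.2 hne
  · exact (h.2 hT).mono_left h'.1 hRK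

/-- A tower in the monster model none of whose extensions picks up further elements of it. -/
def IsReducedTower (hV : IsMonster K μ V) (hμ : ℵ₀ ≤ μ) (α : Ordinal.{u})
    (a : Ordinal.{u} → V) (N M : Ordinal.{u} → L.Substructure V) : Prop :=
  ∀ M' : Ordinal.{u} → L.Substructure V, IsTower hV hμ α a N M' →
    (∀ i < α, EqOrUniversal K μ (M i) (M' i)) → ∀ i < α, ∀ j < α, ∀ x ∈ M' i, x ∈ M j → x ∈ M i

/-- Every tower has a reduced extension. -/
theorem IsTower.exists_isReducedTower (hCont : K.ContinuousNonsplitting μ)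
    (hα : α < (Order.succ μ).ord) {M : Ordinal.{u} → L.Substructure V}
    (hM : IsTower hV hμ α a N M) :
    ∃ M', IsTower hV hμ α a N M' ∧ (∀ i < α, EqOrUniversal K μ (M i) (M' i)) ∧
      IsReducedTower hV hμ α a N M' := by
  by_contra hcon
  push Not at hcon
  -- If no extension is reduced, every successor tower can be chosen to move into some level `i` an
  -- element that lay in another level but not in level `i`.
  let Good : Ordinal.{u} → (Ordinal.{u} → Ordinal.{u} → L.Substructure V) →
      (Ordinal.{u} → L.Substructure V) → Prop := fun ζ f T =>
    IsTower hV hμ α a N T ∧ (∀ ξ < ζ, ∀ i < α, EqOrUniversal K μ (f ξ i) (T i)) ∧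
    (ζ = 0 → T = M) ∧
    (∀ ξ < ζ, ζ = ξ + 1 → ∃ i < α, ∃ j < α, ∃ x ∈ T i, x ∈ f ξ j ∧ x ∉ f ξ i) ∧
    (Order.IsSuccLimit ζ → ∀ i < α, (T i : Set V) = ⋃ ξ ∈ Set.Iio ζ, (f ξ i : Set V))
  let lam := (Order.succ μ).ord
  have hlam : Order.IsSuccLimit lam := isSuccLimit_succ_ord hμ
  have key : ∃ f : Ordinal.{u} → Ordinal.{u} → L.Substructure V, ∀ ζ < lam, Good ζ f (f ζ) := by
    refine Ordinal.exists_seq Good ?_ _ ?_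
    · rintro i f g x hfg ⟨h1, h2, h3, h4, h5⟩
      refine ⟨h1, fun j hj => hfg j hj ▸ h2 j hj, h3, fun j hj hij => hfg j hj ▸ h4 j hj hij,
        fun hi k hk => ?_⟩
      rw [h5 hi k hk]
      exact Set.iUnion₂_congr fun j hj => by rw [hfg j hj]
    · intro ζ hζ f hf
      have hle : ∀ ξ η, ξ ≤ η → η < ζ → ∀ i < α, EqOrUniversal K μ (f ξ i) (f η i) := by
        intro ξ η hξη hη i hi
        rcases hξη.eq_or_lt with rfl | hlt
        · exact EqOrUniversal.refl (((hf ξ hη).1.limit i hi).inK hμ).1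
        · exact (hf η hη).2.1 ξ hlt i hi
      rcases Ordinal.zero_or_succ_or_isSuccLimit ζ with rfl | ⟨ξ, rfl⟩ | hl
      · exact ⟨M, hM, fun j hj => absurd hj not_lt_bot, fun _ => rfl,
          fun j hj => absurd hj not_lt_bot, fun hl => absurd rfl hl.ne_bot⟩
      · have hξ : ξ < Order.succ ξ := Order.lt_succ ξ
        have hM' : ∀ i < α, EqOrUniversal K μ (M i) (f ξ i) := by
          have h0 := hle 0 ξ bot_le hξ
          rwa [(hf 0 (lt_of_le_of_lt bot_le hξ)).2.2.1 rfl] at h0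
        have h1 := hcon (f ξ) (hf ξ hξ).1 hM'
        unfold IsReducedTower at h1
        push Not at h1
        obtain ⟨T, hT, hfT, i, hi, j, hj, x, hx, hxj, hxi⟩ := h1
        refine ⟨T, hT, fun η hη k hk => ?_, fun h => absurd h (Order.bot_lt_succ ξ).ne',
          fun η hη hξη => ?_, fun hl => absurd hl (Order.not_isSuccLimit_succ ξ)⟩
        · exact (hle η ξ (Order.lt_succ_iff.1 hη) hξ k hk).trans (hfT k hk)
            ((hT.limit k hk).inK hμ)
        · have : ξ = η := Order.succ_injective hξη
          subst this
          exact ⟨i, hi, j, hj, x, hx, hxj, hxi⟩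
      · have hT : ∀ i, ∃ R : L.Substructure V, i < α →
            (R : Set V) = ⋃ ξ ∈ Set.Iio ζ, (f ξ i : Set V) := by
          intro i
          by_cases hi : i < α
          · obtain ⟨R, hR⟩ := exists_coe_eq_biUnion hl.bot_lt
              fun ξ η h hη => (hle ξ η h hη i hi).1.1
            exact ⟨R, fun _ => hR⟩
          · exact ⟨⊤, fun h => absurd h hi⟩
        choose T hT using hT
        obtain ⟨h1, h2⟩ := IsTower.union hCont hl hζ (fun ξ hξ => (hf ξ hξ).1) hle
          (fun ξ hξ hξl => (hf ξ hξ).2.2.2.2 hξl) hT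
        exact ⟨T, h1, h2, fun h => absurd h hl.ne_bot,
          fun k hk hik => absurd (hik ▸ hl : Order.IsSuccLimit (k + 1))
            (Order.not_isSuccLimit_succ k), fun _ => hT⟩
  obtain ⟨f, hf⟩ := key
  have hle : ∀ ξ η, ξ ≤ η → η < lam → ∀ i < α, f ξ i ≤ f η i := by
    intro ξ η hξη hη i hi
    rcases hξη.eq_or_lt with rfl | hlt
    · exact le_rfl
    · exact ((hf η hη).2.1 ξ hlt i hi).1.1
  -- The level is recorded with the element, since one element may enter several levels at different
  -- stages. A given pair can occur only once: after entering level `i` the element stays there.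
  have hw : ∀ ζ, ∃ p : α.ToType × V, ζ < lam → ∃ i < α, ∃ hi : i < α, ∃ j < α,
      p.1 = Ordinal.ToType.mk ⟨i, hi⟩ ∧ p.2 ∈ f (ζ + 1) i ∧ p.2 ∈ f ζ j ∧ p.2 ∉ f ζ i := by
    intro ζ
    by_cases hζ : ζ < lam
    · obtain ⟨i, hi, j, hj, x, hx⟩ := (hf (ζ + 1) (hlam.succ_lt hζ)).2.2.2.1 ζ
        (Order.lt_succ ζ) rfl
      exact ⟨⟨Ordinal.ToType.mk ⟨i, hi⟩, x⟩, fun _ => ⟨i, hi, hi, j, hj, rfl, hx⟩⟩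
    · obtain ⟨i, hi, j, hj, x, hx⟩ := (hf (0 + 1) (hlam.succ_lt hlam.bot_lt)).2.2.2.1 0
        (Order.lt_succ 0) rfl
      exact ⟨⟨Ordinal.ToType.mk ⟨i, hi⟩, x⟩, fun h => absurd h hζ⟩
  choose p hp using hw
  refine false_of_injOn_of_continuous hμ
    (C := fun ζ => Set.univ ×ˢ ⋃ j ∈ Set.Iio α, (f ζ j : Set V)) ?_ ?_ ?_ p ?_ ?_
  · intro ζ hζ
    rw [mk_setProd]
    have h1 : #(Set.univ : Set α.ToType) ≤ μ := by
      rw [mk_univ, mk_toType]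
      exact card_le_iff.2 hα
    have h2 := mk_biUnion_Iio_le hμ hα (fun j => (f ζ j : Set V)) fun j hj =>
      (((hf ζ hζ).1.limit j hj).inK hμ).2.le
    exact (mul_le_mul' h1 h2).trans (mul_eq_self hμ).le
  · intro ζ ξ h hξ
    refine Set.prod_mono le_rfl (Set.iUnion₂_mono fun j hj => hle ζ ξ h hξ j hj)
  · rintro ζ hζ hl x ⟨-, hx⟩
    simp only [Set.mem_iUnion, exists_prop, Set.mem_Iio] at hx
    obtain ⟨j, hj, hx⟩ := hx
    rw [(hf ζ hζ).2.2.2.2 hl j hj] at hx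
    simp only [Set.mem_iUnion, exists_prop, Set.mem_Iio] at hx
    obtain ⟨ξ, hξ, hx⟩ := hx
    exact ⟨ξ, hξ, trivial, Set.mem_biUnion (show j ∈ Set.Iio α from hj) hx⟩
  · intro ζ hζ
    obtain ⟨i, hi, hi', j, hj, -, -, hx, -⟩ := hp ζ hζ
    exact ⟨trivial, Set.mem_biUnion (show j ∈ Set.Iio α from hj) hx⟩
  · have hne : ∀ ζ ξ, ζ < ξ → ξ < lam → p ζ ≠ p ξ := by
      intro ζ ξ hζξ hξ he
      obtain ⟨i, hi, hi', j, hj, h1, h2, -, -⟩ := hp ζ (hζξ.trans hξ)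
      obtain ⟨k, hk, hk', l, hl, h1', -, -, h4⟩ := hp ξ hξ
      have hik : i = k := by
        have := h1.symm.trans ((congrArg Prod.fst he).trans h1')
        exact congrArg Subtype.val (Ordinal.ToType.mk.injective this)
      subst hik
      rw [← he] at h4
      exact h4 (hle _ _ (Order.succ_le_of_lt hζξ) hξ i hi h2)
    intro ζ hζ ξ hξ he
    rcases lt_trichotomy ζ ξ with h | h | h
    · exact absurd he (hne ζ ξ h hξ)
    · exact h
    · exact absurd he.symm (hne ξ ζ h hζ)

end Union

/-! ### Passing between towers in `U` and in the monster model -/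

section Conversion

variable {V : Type u} [L.Structure V] {hV : IsMonster K μ V} {hμ : ℵ₀ ≤ μ} {α : Ordinal.{u}}
  {a : Ordinal.{u} → V} {N M : Ordinal.{u} → L.Substructure V}

theorem IsTower.congr (h : IsTower hV hμ α a N M) {a' : Ordinal.{u} → V}
    {N' : Ordinal.{u} → L.Substructure V} (ha : ∀ i, i + 1 < α → a i = a' i)
    (hN : ∀ i, i + 1 < α → N i = N' i) : IsTower hV hμ α a' N' M :=
  ⟨h.strong, h.mono, h.limit, fun i hi => ha i hi ▸ h.a_mem i hi,
    fun i hi => ha i hi ▸ h.a_notMem i hi, fun i hi => hN i hi ▸ h.universal i hi,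
    fun i hi hM hMK => ha i hi ▸ hN i hi ▸ h.nonsplit i hi hM hMK⟩

/-- The image in the monster model of a tower in a model `U ∈ K_μ`. -/
theorem Tower.isTower (hV : IsMonster K μ V) (hμ : ℵ₀ ≤ μ) {U : Type u} [L.Structure U]
    {hU : K.InK μ U} (T : K.Tower μ α hU) {e : U ↪[L] V} (he : K.IsEmb e) :
    IsTower hV hμ α (fun i => e (T.a i)) (fun i => (T.N i).map e.toHom)
      (fun i => (T.M i).map e.toHom) where
  strong i hi := (strong_map_iff he).2 (T.strong i hi)
  mono i j hij hj := Substructure.monotone_map (T.mono i j hij hj).1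
  limit i hi := (isLimitModel_map_iff e).2 (T.limit i hi)
  a_mem i hi := ⟨_, T.a_mem i hi, rfl⟩
  a_notMem i hi := by
    rintro ⟨x, hx, he⟩
    exact T.a_notMem i hi (e.injective he ▸ hx)
  universal i hi := (T.universal i hi).map e
  nonsplit i hi hM hMK := (not_splits_tp_iff hV hμ hU he
    (T.strong i ((Order.lt_succ i).trans hi)) hM hMK (T.universal i hi).2.2.1 _).1
      (T.nonsplit i hi _)

/-- A tower in the monster model as a tower in a model `U ∈ K_μ`. -/
theorem IsTower.exists_tower (h : IsTower hV hμ α a N M) {U : L.Substructure V}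
    (hUV : K.Strong V U) (hU : K.InK μ U) (hM : ∀ i < α, M i ≤ U) :
    ∃ T : K.Tower μ α hU, (∀ i < α, (T.M i).map U.subtype.toHom = M i) ∧
      (∀ i, i + 1 < α → (T.a i : V) = a i) ∧
      ∀ i, i + 1 < α → (T.N i).map U.subtype.toHom = N i := by
  classical
  have hlt : ∀ {i : Ordinal.{u}}, i + 1 < α → i < α := fun h => (Order.lt_succ _).trans h
  have hMm : ∀ i < α, ((M i).within U).map U.subtype.toHom = M i := fun i hi =>
    within_map_subtype (hM i hi)
  have hNm : ∀ i, i + 1 < α → ((N i).within U).map U.subtype.toHom = N i := fun i hi =>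
    within_map_subtype ((h.universal i hi).2.2.1.1.trans (hM i (hlt hi)))
  have hU0 : Nonempty U := by
    rw [← mk_ne_zero_iff, hU.2]
    exact (aleph0_pos.trans_le hμ).ne'
  let a' : Ordinal.{u} → U := fun i => if h : a i ∈ U then ⟨a i, h⟩ else Classical.arbitrary U
  have ha' : ∀ i, i + 1 < α → (a' i : V) = a i := by
    intro i hi
    have : a i ∈ U := hM _ hi (h.a_mem i hi)
    have h1 : a' i = ⟨a i, this⟩ := dif_pos this
    rw [h1]
  have hstrong : ∀ i < α, K.Strong U ((M i).within U) := fun i hi =>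
    (le_of_strong (h.strong i hi) hUV (hM i hi)).2
  have huniv : ∀ i, i + 1 < α → K.UniversalOver μ ((M i).within U) ((N i).within U) := by
    intro i hi
    rw [← universalOver_map_iff U.subtype, hMm i (hlt hi), hNm i hi]
    exact h.universal i hi
  refine ⟨⟨fun i => (M i).within U, a', fun i => (N i).within U, hstrong, ?_, ?_, ?_, ?_, huniv,
    ?_⟩, hMm, ha', hNm⟩
  · intro i j hij hj
    exact le_of_strong (hstrong i (hij.trans_lt hj)) (hstrong j hj)
      (Substructure.monotone_comap (h.mono i j hij hj))
  · intro i hi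
    rw [← isLimitModel_map_iff U.subtype, hMm i hi]
    exact h.limit i hi
  · intro i hi
    change (a' i : V) ∈ M (i + 1)
    rw [ha' i hi]
    exact h.a_mem i hi
  · intro i hi
    change ¬ (a' i : V) ∈ M i
    rw [ha' i hi]
    exact h.a_notMem i hi
  · intro i hi hMi
    have hs := (strong_map_iff (isEmb_subtype hUV)).2 hMi
    have hk : K.InK μ (((M i).within U).map U.subtype.toHom) :=
      (inK_map_iff _).2 (huniv i hi).2.1
    rw [not_splits_tp_iff hV hμ hU (isEmb_subtype hUV) hMi hs hk (huniv i hi).2.2.1]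
    have key : ∀ R R' c, R = M i → R' = N i → c = a i → ∀ (hR : K.Strong V R) (hRK : K.InK μ R),
        ¬ (mtp hV hμ hR hRK c).Splits R' := by
      rintro _ _ _ rfl rfl rfl hR hRK
      exact h.nonsplit i hi hR hRK
    exact key _ _ _ (hMm i (hlt hi)) (hNm i hi) (ha' i hi) hs hk

/-- A competing extension lives in an arbitrary model `U'`; embedding `U'` into `V` over `U` turns
it into an extension inside `V`, where reducedness applies. -/
theorem IsReducedTower.reduced (h : IsReducedTower hV hμ α a N M) {U : L.Substructure V}
    (hUV : K.Strong V U) (hU : K.InK μ U) (T : K.Tower μ α hU)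
    (hTM : ∀ i < α, (T.M i).map U.subtype.toHom = M i)
    (hTa : ∀ i, i + 1 < α → (T.a i : V) = a i)
    (hTN : ∀ i, i + 1 < α → (T.N i).map U.subtype.toHom = N i) : T.Reduced := by
  intro U' _ hU' g T' hg hT' i hi
  obtain ⟨hT'a, hT'N, hT'M⟩ := hT'
  obtain ⟨e, he, heg⟩ := hV.exists_extend hU hU' (isEmb_subtype hUV) hg
  have hmap : ∀ R : L.Substructure U, (R.map g.toHom).map e.toHom = R.map U.subtype.toHom := by
    intro R
    ext x
    constructor
    · rintro ⟨_, ⟨y, hy, rfl⟩, rfl⟩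
      exact ⟨y, hy, (heg y).symm⟩
    · rintro ⟨y, hy, rfl⟩
      exact ⟨_, ⟨y, hy, rfl⟩, heg y⟩
  have htower := (T'.isTower hV hμ he).congr (a' := a) (N' := N)
    (fun i hi => by rw [hT'a i hi, heg]; exact hTa i hi)
    (fun i hi => by rw [hT'N i hi, hmap]; exact hTN i hi)
  have hext : ∀ i < α, EqOrUniversal K μ (M i) ((T'.M i).map e.toHom) := by
    intro i hi
    rw [← hTM i hi, ← hmap]
    refine ⟨(le_map_iff e).2 (hT'M i hi).1, fun hne => ?_⟩
    exact ((hT'M i hi).2 fun h => hne (by rw [h])).map e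
  have hmem : ∀ j < α, ∀ y : U, (y : V) ∈ M j ↔ y ∈ T.M j := by
    intro j hj y
    rw [← hTM j hj]
    constructor
    · rintro ⟨z, hz, hzy⟩
      have : z = y := Subtype.ext hzy
      exact this ▸ hz
    · intro hy
      exact ⟨y, hy, rfl⟩
  refine Set.Subset.antisymm ?_ ?_
  · rintro x ⟨hx, hxj⟩
    simp only [Set.mem_iUnion, exists_prop, Set.mem_Iio] at hxj
    obtain ⟨j, hj, y, hy, rfl⟩ := hxj
    refine ⟨y, (hmem i hi y).1 ?_, rfl⟩
    exact h _ htower hext i hi j hj y ⟨g y, hx, heg y⟩ ((hmem j hj y).2 hy)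
  · rintro _ ⟨y, hy, rfl⟩
    exact ⟨(hT'M i hi).1.1 ⟨y, hy, rfl⟩,
      Set.mem_biUnion (show i ∈ Set.Iio α from hi) ⟨y, hy, rfl⟩⟩

end Conversion

/-! ### Moving elements by embeddings and copying `a` -/

section Realizing

variable {V : Type u} [L.Structure V]

/-- Two elements with the same type over the image of `S` are conjugate over it. -/
theorem exists_embedding_of_mtp_eq (hV : IsMonster K μ V) (hμ : ℵ₀ ≤ μ)
    (hAP : K.Amalgamation μ) {U : Type u} [L.Structure U] (hU : K.InK μ U) {e : U ↪[L] V}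
    (he : K.IsEmb e) {S : L.Substructure U} {R : L.Substructure V} (hRS : S.map e.toHom = R)
    (hS : K.Strong U S) (hR : K.Strong V R) (hRK : K.InK μ R) {b : U} {b' : V}
    (h : mtp hV hμ hR hRK b' = mtp hV hμ hR hRK (e b)) :
    ∃ k : U ↪[L] V, K.IsEmb k ∧ (∀ x ∈ S, k x = e x) ∧ k b = b' := by
  subst hRS
  have hSK := (inK_map_iff e).1 hRK
  have key : ∀ c, (mtp hV hμ hR hRK c).pull (e.substructureEquivMap S).toEmbedding
      (isEmb_equiv _ hRK.1) = vtp hV hμ (he.comp (isEmb_subtype hS)) hSK c := fun c =>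
    pull_vtp hV hμ (f := (e.substructureEquivMap S).toEmbedding) (e' := e.comp S.subtype) _ _ _ _
      (he.comp (isEmb_subtype hS)) (fun _ => rfl) c
  have h1 := congrArg (fun p => GaS.pull (e.substructureEquivMap S).toEmbedding
    (isEmb_equiv _ hRK.1) p) h
  simp only [key] at h1
  rw [vtp_eq_gtp hV hμ (he.comp (isEmb_subtype hS)) hSK he hU (isEmb_subtype hS) (fun _ => rfl)
    (rfl : e b = e b)] at h1
  obtain ⟨k, hk, hkx, hkb⟩ := exists_embedding_of_vtp_eq_gtp hV hμ hAP h1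
  exact ⟨k, hk, fun x hx => hkx ⟨x, hx⟩, hkb⟩

/-- If `k : U → V` agrees with `e` on `M₀` and maps `M` into `M'`, and the type of `b'` over `M'`
does not split over `e(M₀)` and extends the type of `e(b)` over `e(M)`, then `k ↾ M` extends to an
embedding sending `b` to `b'`. -/
theorem exists_embedding_of_nonsplitting (hV : IsMonster K μ V) (hμ : ℵ₀ ≤ μ)
    (hAP : K.Amalgamation μ) {U : Type u} [L.Structure U] (hU : K.InK μ U) {e k : U ↪[L] V}
    (he : K.IsEmb e) (hk : K.IsEmb k) {M₀ M : L.Substructure U} (hM : K.Strong U M)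
    (hMK : K.InK μ M) (hM₀M : K.Le M₀ M) {M' : L.Substructure V} (hM' : K.Strong V M')
    (hMK' : K.InK μ M') (heM : M.map e.toHom ≤ M') (hkM : M.map k.toHom ≤ M')
    (hke : ∀ x ∈ M₀, k x = e x) {b : U} {b' : V}
    (hns : ¬ (mtp hV hμ hM' hMK' b').Splits (M₀.map e.toHom))
    (hR : K.Strong V (M.map e.toHom)) (hRK : K.InK μ (M.map e.toHom))
    (hb : mtp hV hμ hR hRK b' = mtp hV hμ hR hRK (e b)) :
    ∃ l : U ↪[L] V, K.IsEmb l ∧ (∀ x ∈ M, l x = k x) ∧ l b = b' := by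
  obtain ⟨l₀, hl₀, hl₀x, hl₀b⟩ := exists_embedding_of_mtp_eq hV hμ hAP hU he rfl hM hR hRK hb
  have hle : K.Le (M₀.map e.toHom) M' :=
    ((le_map_iff e).2 hM₀M).trans (le_of_strong hR hM' heM)
  rw [GaS.not_splits_iff hle] at hns
  have hMs := isEmb_subtype hM
  have h₁ : ∀ x, (e.comp M.subtype) x ∈ M' := fun x => heM ⟨x, x.2, rfl⟩
  have h₂ : ∀ x, (k.comp M.subtype) x ∈ M' := fun x => hkM ⟨x, x.2, rfl⟩
  -- The restrictions of `e` and `k` to `M` are two embeddings into `M'` that agree on `M₀`, so they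
  -- pull the type of `b'` back to the same type over `M`. Along `e` this is the type of `b`, as
  -- `l₀` shows.
  have h := hns M ((Substructure.inclusion hM₀M.1).comp
      (e.substructureEquivMap M₀).symm.toEmbedding)
    ((e.comp M.subtype).codRestrict M' h₁) ((k.comp M.subtype).codRestrict M' h₂)
    ((he.comp hMs).codRestrict hM' h₁) ((hk.comp hMs).codRestrict hM' h₂) hMK
    ((isEmb_inclusion hM₀M).comp (isEmb_equiv _ hM₀M.mem_left)) (fun x => by
      obtain ⟨y, rfl⟩ := (e.substructureEquivMap M₀).surjective x
      apply Subtype.ext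
      change e (((e.substructureEquivMap M₀).symm ((e.substructureEquivMap M₀) y) : M₀) : U) = _
      rw [FirstOrder.Language.Equiv.symm_apply_apply]
      rfl) (fun x => by
      obtain ⟨y, rfl⟩ := (e.substructureEquivMap M₀).surjective x
      apply Subtype.ext
      change k (((e.substructureEquivMap M₀).symm ((e.substructureEquivMap M₀) y) : M₀) : U) = _
      rw [FirstOrder.Language.Equiv.symm_apply_apply]
      exact hke y y.2)
  have h1 := pull_vtp hV hμ (isEmb_subtype hM') hMK' ((he.comp hMs).codRestrict hM' h₁) hMK
    (he.comp hMs) (fun _ => rfl) b'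
  have h2 := pull_vtp hV hμ (isEmb_subtype hM') hMK' ((hk.comp hMs).codRestrict hM' h₂) hMK
    (hk.comp hMs) (fun _ => rfl) b'
  have h3 := vtp_eq_gtp hV hμ (he.comp hMs) hMK hl₀ hU hMs (fun x => hl₀x x x.2) hl₀b
  have h4 : vtp hV hμ (hk.comp hMs) hMK b' = gtp hU hMs b := by
    rw [← h2, ← h3, ← h1]
    exact h.symm
  obtain ⟨l, hl, hlx, hlb⟩ := exists_embedding_of_vtp_eq_gtp hV hμ hAP h4
  exact ⟨l, hl, fun x hx => hlx ⟨x, hx⟩, hlb⟩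

end Realizing

/-- Copies `a i = h i a` of `a` over `M₀` in an increasing chain of limit models `S i`, so that the
type of `a i` over `S i` does not split over `N`. -/
theorem exists_chain_of_copies {V : Type u} [L.Structure V] (hV : IsMonster K μ V) (hμ : ℵ₀ ≤ μ)
    (hAP : K.Amalgamation μ) {δ : Ordinal.{u}} (hδμ : δ < (Order.succ μ).ord)
    {U : Type u} [L.Structure U] (hU : K.InK μ U) {e : U ↪[L] V} (he : K.IsEmb e)
    {N M₀ : L.Substructure U} (hM₀ : K.Strong U M₀)
    (hN : K.UniversalOver μ M₀ N) {a : U} (ha : a ∉ M₀) (hns : ¬ (tp hU hM₀ a).Splits N) :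
    ∃ (S : Ordinal.{u} → L.Substructure V) (h : Ordinal.{u} → U ↪[L] V), ∀ i < δ,
      K.Strong V (S i) ∧ K.IsLimitModel μ (S i) ∧ M₀.map e.toHom ≤ S i ∧
      (∀ j < i, S j ≤ S i ∧ ∀ x, h j x ∈ S i) ∧ K.IsEmb (h i) ∧ (∀ x ∈ M₀, h i x = e x) ∧
      h i a ∉ S i ∧ ∀ (hS : K.Strong V (S i)) (hSK : K.InK μ (S i)),
        ¬ (mtp hV hμ hS hSK (h i a)).Splits (N.map e.toHom) := by
  have hM₀K := hN.2.1
  have hRK : K.InK μ (M₀.map e.toHom) := (inK_map_iff e).2 hM₀K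
  have hR : K.Strong V (M₀.map e.toHom) := (strong_map_iff he).2 hM₀
  rw [not_splits_tp_iff hV hμ hU he hM₀ hR hRK hN.2.2.1] at hns
  have haR : e a ∉ M₀.map e.toHom := by
    rintro ⟨x, hx, hxa⟩
    exact ha (e.injective hxa ▸ hx)
  have : Nonempty (L.Substructure V × (U ↪[L] V)) := ⟨⟨⊤, e⟩⟩
  obtain ⟨f, hf⟩ := Ordinal.exists_seq
    (fun i (f : Ordinal.{u} → L.Substructure V × (U ↪[L] V)) x =>
      K.Strong V x.1 ∧ K.IsLimitModel μ x.1 ∧ M₀.map e.toHom ≤ x.1 ∧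
      (∀ j < i, (f j).1 ≤ x.1 ∧ ∀ y, (f j).2 y ∈ x.1) ∧ K.IsEmb x.2 ∧ (∀ y ∈ M₀, x.2 y = e y) ∧
      x.2 a ∉ x.1 ∧ ∀ (hS : K.Strong V x.1) (hSK : K.InK μ x.1),
        ¬ (mtp hV hμ hS hSK (x.2 a)).Splits (N.map e.toHom))
    (by
      rintro i f g x hfg ⟨h1, h2, h3, h4, h5⟩
      exact ⟨h1, h2, h3, fun j hj => hfg j hj ▸ h4 j hj, h5⟩) δ (by
    intro i hi f hf
    -- The new limit model must absorb the earlier models together with the whole earlier copies of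
    -- `U`. Continuity at limit stages is not sought.
    have hA : #(⋃ j ∈ Set.Iio i, (((f j).1 : Set V) ∪ Set.range (f j).2) : Set V) ≤ μ := by
      refine mk_biUnion_Iio_le hμ (hi.trans hδμ) _ fun j hj => (mk_union_le _ _).trans ?_
      refine (add_le_add (((hf j hj).2.1.inK hμ).2.le) (mk_range_le.trans hU.2.le)).trans ?_
      rw [add_eq_self hμ]
    obtain ⟨T, hT, hTl, hAT⟩ := exists_isLimitOver_omega0 hV hμ hR hRK hA
    have hTu := hTl.universalOver hμ
    have hTm : K.IsLimitModel μ T := ⟨_, _, hTl⟩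
    obtain ⟨a', ha', hns', hmem⟩ := exists_nonsplitting_extension hV hμ hR hRK hT hTu.2.1
      hTu.2.2.1 (hN.map e) hns
    obtain ⟨k, hk, hkx, hka⟩ := exists_embedding_of_mtp_eq hV hμ hAP hU he rfl hM₀ hR hRK ha'
    have hAT' : ∀ j < i, ((f j).1 : Set V) ∪ Set.range (f j).2 ⊆ T := fun j hj =>
      (Set.subset_biUnion_of_mem (u := fun j => ((f j).1 : Set V) ∪ Set.range (f j).2)
        (show j ∈ Set.Iio i from hj)).trans hAT
    refine ⟨(T, k), hT, hTm, hTu.2.2.1.1, fun j hj => ⟨fun x hx => hAT' j hj (Or.inl hx),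
      fun x => hAT' j hj (Or.inr ⟨x, rfl⟩)⟩, hk, hkx, ?_, fun hS hSK => ?_⟩
    · change k a ∉ T
      rw [hka]
      exact hmem haR
    · change ¬ (mtp hV hμ hS hSK (k a)).Splits _
      rw [hka]
      exact hns')
  exact ⟨fun i => (f i).1, fun i => (f i).2, hf⟩

/-! ### The tower of copies and the proof of symmetry -/

section Symmetry

variable {V : Type u} [L.Structure V]

theorem strong_within {S T : L.Substructure V} (hS : K.Strong V S) (hT : K.Strong V T)
    (h : S ≤ T) : K.Strong T (S.within T) :=
  (le_of_strong hS hT h).2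

/-- A configuration witnessing symmetry inside the monster model can be found inside a model of
cardinality `μ`. -/
theorem exists_strong_extension_of_embedding (hV : IsMonster K μ V) (hμ : ℵ₀ ≤ μ) {U : Type u}
    [L.Structure U] (hU : K.InK μ U) {g : U ↪[L] V} (hg : K.IsEmb g) {N M₀ : L.Substructure U}
    {Mb : L.Substructure V} {θ : Ordinal.{u}} (hMb : K.Strong V Mb)
    (hMbK : K.InK μ Mb) (hMbl : K.IsLimitOver μ θ Mb (M₀.map g.toHom)) (hN : K.Le N M₀) {a b : U}
    (hb : g b ∈ Mb) (ha : ¬ (mtp hV hμ hMb hMbK (g a)).Splits (N.map g.toHom)) :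
    ∃ (U' : Type u) (_ : L.Structure U') (hU' : K.InK μ U') (g : U ↪[L] U')
      (Mb : L.Substructure U') (hMb : K.Strong U' Mb) (θ : Ordinal.{u}),
      K.IsEmb g ∧ K.IsLimitOver μ θ Mb (M₀.map g.toHom) ∧ g b ∈ Mb ∧
      ¬ (tp hU' hMb (g a)).Splits (N.map g.toHom) := by
  obtain ⟨W, hW, hWK, hMbW, hgW⟩ := hV.exists_le hMb hMbK (mk_range_le.trans hU.2.le :
    #(Set.range g) ≤ μ)
  have hgW' : ∀ x, g x ∈ W := fun x => hgW ⟨x, rfl⟩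
  have hmap : ∀ R : L.Substructure U,
      (R.map (g.codRestrict W hgW').toHom).map W.subtype.toHom = R.map g.toHom := by
    intro R
    ext x
    constructor
    · rintro ⟨_, ⟨y, hy, rfl⟩, rfl⟩
      exact ⟨y, hy, rfl⟩
    · rintro ⟨y, hy, rfl⟩
      exact ⟨_, ⟨y, hy, rfl⟩, rfl⟩
  have hs := strong_within hMb hW hMbW
  have hsV := (strong_map_iff (isEmb_subtype hW)).2 hs
  have hMm := within_map_subtype hMbW
  have hsK : K.InK μ ((Mb.within W).map W.subtype.toHom) := by rwa [hMm]
  have hle : K.Le (N.map (g.codRestrict W hgW').toHom) (Mb.within W) := by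
    rw [← le_map_iff W.subtype, hmap, hMm]
    exact ((le_map_iff g).2 hN).trans (hMbl.universalOver hμ).2.2.1
  refine ⟨W, inferInstance, hWK, g.codRestrict W hgW', Mb.within W, hs, θ,
    hg.codRestrict hW hgW', ?_, hb, ?_⟩
  · rw [← isLimitOver_map_iff W.subtype, hmap, hMm]
    exact hMbl
  · rw [not_splits_tp_iff hV hμ hWK (isEmb_subtype hW) hs hsV hsK hle, hmap]
    have key : ∀ R, R = Mb → ∀ (hR : K.Strong V R) (hRK : K.InK μ R),
        ¬ (mtp hV hμ hR hRK (g a)).Splits (N.map g.toHom) := by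
      rintro _ rfl hR hRK
      exact ha
    exact key _ hMm hsV hsK

/-- A tower of length `δ + 1` from a chain of copies of `a` and a limit model on top. -/
theorem isTower_of_chain (hV : IsMonster K μ V) (hμ : ℵ₀ ≤ μ) {δ : Ordinal.{u}}
    (hδ : Order.IsSuccLimit δ) {S : Ordinal.{u} → L.Substructure V} {a : Ordinal.{u} → V}
    {M₀ N Mδ : L.Substructure V} (hN : K.UniversalOver μ M₀ N) (hM₀ : K.Strong V M₀)
    (hS : ∀ i < δ, K.Strong V (S i) ∧ K.IsLimitModel μ (S i) ∧ M₀ ≤ S i ∧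
      (∀ j < i, S j ≤ S i ∧ a j ∈ S i) ∧ a i ∉ S i ∧
      ∀ (h : K.Strong V (S i)) (hK : K.InK μ (S i)), ¬ (mtp hV hμ h hK (a i)).Splits N)
    (hMδ : K.Strong V Mδ) (hMδl : K.IsLimitModel μ Mδ) (hSM : ∀ i < δ, S i ≤ Mδ) :
    IsTower hV hμ (δ + 1) a (fun _ => N)
      (fun i => open Classical in if i < δ then S i else Mδ) := by
  -- The top level `δ` carries neither an element nor a base model, so nothing about types over `Mδ`
  -- has to be checked.
  have hlt : ∀ {i}, i + 1 < δ + 1 → i < δ := fun {i} h => by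
    rw [← Order.succ_eq_add_one, ← Order.succ_eq_add_one] at h
    exact Order.succ_lt_succ_iff.1 h
  refine ⟨fun i _ => ?_, fun i j hij _ => ?_, fun i _ => ?_, fun i hi => ?_, fun i hi => ?_,
    fun i hi => ?_, fun i hi => ?_⟩
  · split_ifs with h
    exacts [(hS i h).1, hMδ]
  · by_cases hj : j < δ
    · rw [if_pos hj, if_pos (hij.trans_lt hj)]
      rcases hij.eq_or_lt with rfl | h
      exacts [le_rfl, ((hS j hj).2.2.2.1 i h).1]
    · rw [if_neg hj]
      split_ifs with h
      exacts [hSM i h, le_rfl]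
  · split_ifs with h
    exacts [(hS i h).2.1, hMδl]
  · have h := hδ.succ_lt (hlt hi)
    rw [Order.succ_eq_add_one] at h
    rw [if_pos h]
    exact ((hS _ h).2.2.2.1 i (Order.lt_succ i)).2
  · rw [if_pos (hlt hi)]
    exact (hS i (hlt hi)).2.2.2.2.1
  · rw [if_pos (hlt hi)]
    have h := hS i (hlt hi)
    exact hN.mono_left (le_of_strong hM₀ h.1 h.2.2.1) (h.2.1.inK hμ)
  · rw [if_pos (hlt hi)]
    exact (hS i (hlt hi)).2.2.2.2.2

/-- Continuity of reduced towers at `δ`, for towers in the monster model. -/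
theorem IsReducedTower.exists_mem {hV : IsMonster K μ V} {hμ : ℵ₀ ≤ μ} {δ : Ordinal.{u}}
    (hδ : Order.IsSuccLimit δ) (hδμ : δ < (Order.succ μ).ord)
    (hReduced : ∀ α < (Order.succ μ).ord, ∀ (U : Type u) [L.Structure U] (hU : K.InK μ U)
      (T : K.Tower μ α hU), T.Reduced →
      ∀ β < α, Order.IsSuccLimit β → β.cof = δ.cof → T.ContinuousAt β)
    {a : Ordinal.{u} → V} {N M : Ordinal.{u} → L.Substructure V}
    (hM : IsTower hV hμ (δ + 1) a N M) (hMr : IsReducedTower hV hμ (δ + 1) a N M) {x : V}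
    (hx : x ∈ M δ) : ∃ i < δ, x ∈ M i := by
  have hδ1 : δ + 1 < (Order.succ μ).ord := (isSuccLimit_succ_ord hμ).succ_lt hδμ
  have hlt : δ < δ + 1 := Order.lt_succ δ
  have hle : ∀ i < δ + 1, M i ≤ M δ := fun i hi => hM.mono i δ (Order.lt_succ_iff.1 hi) hlt
  -- The top level `M δ` contains all the others and serves as the ambient model in `K_μ`.
  obtain ⟨T, hTM, hTa, hTN⟩ := hM.exists_tower (hM.strong δ hlt) ((hM.limit δ hlt).inK hμ) hle
  have h := hReduced _ hδ1 _ _ T (hMr.reduced (hM.strong δ hlt) _ T hTM hTa hTN) δ hlt hδ rfl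
  rw [← hTM δ hlt] at hx
  obtain ⟨y, hy, rfl⟩ := hx
  have hy' : y ∈ (T.M δ : Set (M δ)) := hy
  rw [h] at hy'
  obtain ⟨i, hi, hyi⟩ := Set.mem_iUnion₂.1 hy'
  have hi' : i < δ := hi
  refine ⟨i, hi', ?_⟩
  rw [← hTM i (hi'.trans hlt)]
  exact ⟨y, hyi, rfl⟩

end Symmetry

end AEC

theorem mainTheorem5 {L : FirstOrder.Language.{u, u}} (K : AEC L)
    (μ : Cardinal.{u}) (hμ : K.LS ≤ μ)
    (δ : Ordinal.{u}) (hδ : Order.IsSuccLimit δ) (hδμ : δ < (Order.succ μ).ord)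
    (hJEP : K.JointEmbedding μ) (hAP : K.Amalgamation μ) (hNMM : K.NoMaximalModel μ)
    (hStable : K.Stable μ) (hCont : K.ContinuousNonsplitting μ)
    (hReduced : ∀ α < (Order.succ μ).ord, ∀ (U : Type u) [L.Structure U] (hU : K.InK μ U)
      (T : K.Tower μ α hU), T.Reduced →
      ∀ β < α, Order.IsSuccLimit β → β.cof = δ.cof → T.ContinuousAt β) :
    K.Symmetry μ δ := by
  open AEC in
  intro U _ hU N M₀ M hM₀ hM a b hMu hM₀l haM haM₀ _ hspa _ hspb
  have hμ0 : ℵ₀ ≤ μ := (aleph0_le_LS K).trans hμ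
  obtain ⟨V, _, e, he, hV⟩ := exists_isMonster hμ0 hAP hStable hU
  have hNu := hM₀l.universalOver hμ0
  have hM₀V := (strong_map_iff he).2 hM₀
  have hM₀K := (inK_map_iff e).2 hNu.2.1
  have hMV := (strong_map_iff he).2 hM
  have hMK := (inK_map_iff e).2 hMu.2.1
  obtain ⟨S, h, hS⟩ := exists_chain_of_copies hV hμ0 hAP hδμ hU he hM₀ hNu haM₀ hspa
  -- a nonsplitting extension of the type of `b` to a model containing the chain
  have hA : #(⋃ j ∈ Set.Iio δ, ((S j : Set V) ∪ Set.range (h j)) : Set V) ≤ μ := by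
    refine mk_biUnion_Iio_le hμ0 hδμ _ fun j hj => (mk_union_le _ _).trans ?_
    refine (add_le_add (((hS j hj).2.1.inK hμ0).2.le) (mk_range_le.trans hU.2.le)).trans ?_
    rw [add_eq_self hμ0]
  obtain ⟨D, hD, hDK, hMD, hAD⟩ := hV.exists_le hMV hMK hA
  have hAD' : ∀ j < δ, (S j : Set V) ∪ Set.range (h j) ⊆ D := fun j hj =>
    (Set.subset_biUnion_of_mem (u := fun j => (S j : Set V) ∪ Set.range (h j))
      (show j ∈ Set.Iio δ from hj)).trans hAD
  rw [not_splits_tp_iff hV hμ0 hU he hM hMV hMK hMu.2.2.1] at hspb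
  obtain ⟨b', hb', hb'D, -⟩ := exists_nonsplitting_extension hV hμ0 hMV hMK hD hDK
    (le_of_strong hMV hD hMD) (hMu.map e) hspb
  -- a reduced tower whose last model contains `b'`
  obtain ⟨Mδ, hMδ, hMδl, hDMδ⟩ := exists_isLimitOver_omega0 hV hμ0 hM₀V hM₀K
    (A := insert b' (D : Set V))
    ((mk_insert_le).trans ((add_le_add hDK.2.le (one_le_aleph0.trans hμ0)).trans
      (add_eq_self hμ0).le))
  have hT := isTower_of_chain hV hμ0 hδ (a := fun i => h i a) (hNu.map e) hM₀V
    (fun i hi => by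
      obtain ⟨h1, h2, h3, h4, -, -, h5, h6⟩ := hS i hi
      exact ⟨h1, h2, h3, fun j hj => ⟨(h4 j hj).1, (h4 j hj).2 a⟩, h5, h6⟩) hMδ ⟨_, _, hMδl⟩
    (fun i hi x hx => hDMδ (Or.inr (hAD' i hi (Or.inl hx))))
  obtain ⟨M', hM', hext, hred⟩ := hT.exists_isReducedTower hCont
    ((isSuccLimit_succ_ord hμ0).succ_lt hδμ)
  -- The element `b'` was put into the top level; continuity of the reduced tower at `δ` pushes it
  -- down to a level `i < δ`, over which the type of `h i a` is controlled.
  have hb'δ : b' ∈ M' δ := (hext δ (Order.lt_succ δ)).1.1 <| by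
    rw [if_neg (lt_irrefl δ)]
    exact hDMδ (Or.inl rfl)
  obtain ⟨i, hi, hb'i⟩ := hred.exists_mem hδ hδμ hReduced hM' hb'δ
  have hi1 : i + 1 < δ + 1 := (hδ.succ_lt hi).trans (Order.lt_succ δ)
  have hiδ : i < δ + 1 := hi.trans (Order.lt_succ δ)
  have hMi := hM'.strong i hiδ
  have hMiK := (hM'.limit i hiδ).inK hμ0
  have hM₀i : M₀.map e.toHom ≤ M' i := (hS i hi).2.2.1.trans <| by
    have := (hext i hiδ).1.1
    rwa [if_pos hi] at this
  obtain ⟨-, -, -, -, hhe, hhx, -, -⟩ := hS i hi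
  -- a nonsplitting extension of the type of `h i a` to a limit model over `e(M₀)`
  obtain ⟨Mb, hMb, hMbl, hMiMb⟩ := exists_isLimitOver_omega0 hV hμ0 hM₀V hM₀K hMiK.2.le
  have hMbK := (hMbl.universalOver hμ0).2.1
  obtain ⟨a', ha', ha'Mb, -⟩ := exists_nonsplitting_extension hV hμ0 hMi hMiK hMb hMbK
    (le_of_strong hMi hMb hMiMb) (hM'.universal i hi1) (hM'.nonsplit i hi1 hMi hMiK)
  -- embeddings of `U`
  obtain ⟨l, hl, hlx, hlb⟩ := exists_embedding_of_nonsplitting hV hμ0 hAP hU he hhe hM hMu.2.1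
    hMu.2.2.1 hD hDK hMD (by rintro _ ⟨x, -, rfl⟩; exact hAD' i hi (Or.inr ⟨x, rfl⟩)) hhx hb'D
    hMV hMK hb'
  obtain ⟨W, hW, hWK, hMiW, hlW⟩ := hV.exists_le hMi hMiK (mk_range_le.trans hU.2.le :
    #(Set.range l) ≤ μ)
  have hlW' : ∀ x, l x ∈ W := fun x => hlW ⟨x, rfl⟩
  -- The map `l` agrees with `h i` on `M` and sends `b` to `b'`. Since `a'` and `l a` have the same
  -- type over `M' i`, some `F` fixes `M' i` and sends `l a` to `a'`; it fixes `b'`, which lies in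
  -- `M' i`.
  obtain ⟨F, hF, hFx, hFa⟩ := exists_embedding_of_mtp_eq hV hμ0 hAP hWK (isEmb_subtype hW)
    (within_map_subtype hMiW) (strong_within hMi hW hMiW) hMi hMiK (b := ⟨l a, hlW' a⟩)
    (b' := a') (by rw [ha', ← hlx a haM]; rfl)
  have hg := hF.comp (hl.codRestrict hW hlW')
  have hgx : ∀ x, l x ∈ M' i → F (l.codRestrict W hlW' x) = l x := fun x hx =>
    hFx ⟨l x, hlW' x⟩ hx
  -- On `M₀` the maps `l`, `h i` and `e` coincide, and `e(M₀)` lies in `M' i`, where `F` is the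
  -- identity.
  have hgM₀ : ∀ x ∈ M₀, F (l.codRestrict W hlW' x) = e x := by
    intro x hx
    have hle : l x = e x := (hlx x (hMu.2.2.1.1 hx)).trans (hhx x hx)
    rw [hgx x (hle ▸ hM₀i ⟨x, hx, rfl⟩), hle]
  have hmap : ∀ R ≤ M₀, R.map (F.comp (l.codRestrict W hlW')).toHom = R.map e.toHom := by
    intro R hR
    ext x
    constructor
    · rintro ⟨y, hy, rfl⟩
      exact ⟨y, hy, (hgM₀ y (hR hy)).symm⟩
    · rintro ⟨y, hy, rfl⟩
      exact ⟨y, hy, hgM₀ y (hR hy)⟩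
  have hgb : F (l.codRestrict W hlW' b) = b' := by
    rw [hgx b (hlb ▸ hb'i), hlb]
  refine exists_strong_extension_of_embedding hV hμ0 hU hg hMb hMbK (θ := Ordinal.omega0) ?_
    hNu.2.2.1 (a := a) (b := b) ?_ ?_
  · rwa [hmap _ le_rfl]
  · change F (l.codRestrict W hlW' b) ∈ Mb
    rw [hgb]
    exact hMiMb hb'i
  · rw [hmap _ hNu.2.2.1.1]
    change ¬ (mtp hV hμ0 hMb hMbK (F (l.codRestrict W hlW' a))).Splits _
    have : F (l.codRestrict W hlW' a) = a' := hFa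
    rwa [this]
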